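/- Let $\Omega\subset\mathbb R^2$ and, for $m=1,2,\dots$, let $\mathcal T_m$ be a triangulation of $\overline\Omega$, in one of two settings: (i) $\Omega$ is an open regular hexagon and $\mathcal T_m$ is its uniform partition into $6m^2$ equilateral triangles (each side divided into $m$ equal parts); (ii) $\Omega=(0,1)^2$ and $\mathcal T_m$ is the Friedrichs–Keller mesh with $2m^2$ triangles ($m^2$ equal squares, all cut by parallel diagonals). Let $a\in C^2(\overline\Omega)$ with $a\ge a_0>0$, and let $\mathbf b\in C^1(\overline\Omega;\mathbb R^2)$ with $\operatorname{div}\mathbf b\ge 0$ in $\Omega$. Let $\varphi_1,\dots,\varphi_n$, $n=n(m)$, be the nodal basis, associated with the internal nodes of $\mathcal T_m$, of the space of continuous functions on $\overline\Omega$ that are affine on each triangle and vanish on $\partial\Omega$. Put $$A_n(a,\mathbf b)=\Theta_n(a)+\Psi_n(\mathbf b),\quad (\Theta_n(a))_{ij}=\int_\Omega a\,\nabla\varphi_j\cdot\nabla\varphi_i,\quad (\Psi_n(\mathbf b))_{ij}=-\int_\Omega(\mathbf b\cdot\nabla\varphi_i)\,\varphi_j,$$ $$P_n(a)=D_n(a)^{1/2}A_n(1,0)\,D_n(a)^{1/2},\qquad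 D_n(a)=\operatorname{diag}(A_n(a,0))\,\operatorname{diag}(A_n(1,0))^{-1}.$$ Then the sequence $\{P_n(a)^{-1}A_n(a,\mathbf b)\}$ is properly clustered at $1$ in the eigenvalue sense: for every $\varepsilon>0$ there is a constant $C_\varepsilon$ such that, for all $m$, at most $C_\varepsilon$ of the complex eigenvalues (counted with algebraic multiplicity) lie outside the disk $\{z\in\mathbb C:|z-1|<\varepsilon\}$. Moreover, there are constants $0<d\le D$ and $\hat d\ge 0$ such that, for all $m$, every eigenvalue $\lambda$ satisfies $d\le\operatorname{Re}\lambda\le D$ and $|\operatorname{Im}\lambda|\le\hat d$. The same holds, the rectangle bound being then asserted for all sufficiently large $m$, if the integrals involving $a$ and $\mathbf b$ are evaluated triangle by triangle with quadrature formulas with error $O(h^2)$. Precisely: for every $m$ and every triangle $K\in\mathcal T_m$ let $Q_K(g)=\sum_x w_K(x)\,g(x)$ be a finite sum over points $x\in K$ with real weights, such that, with constants $C,W$ independent of $m$ and $K$, $\sum_x|w_K(x)|\le W|K|$ and $$\Bigl|Q_K(g)-\int_K g\Bigr|\le C\,\operatorname{diam}(K)^2\,|K|\,\|g\|_{C^2(K)}\quad\text{for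 all } g\in C^2(\mathbb R^2).$$ The entries of $\Theta_n(a)$ and $\Psi_n(\mathbf b)$ are then replaced by $\sum_K Q_K(a\,\nabla\varphi_j|_K\cdot\nabla\varphi_i|_K)$ and $-\sum_K Q_K((\mathbf b\cdot\nabla\varphi_i|_K)\,\varphi_j)$, also in $D_n(a)$, while $A_n(1,0)$ is exact. -/

import Mathlib

open Set Filter Topology MeasureTheory
open scoped InnerProductSpace Gradient

noncomputable section

/-! ## The plane and uniform triangular grids -/

/-- The Euclidean plane. -/
abbrev Plane : Type := EuclideanSpace ℝ (Fin 2)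

/-- The determinant of two plane vectors. -/
def cross (x y : Plane) : ℝ := x 0 * y 1 - x 1 * y 0

/-- A triangle of a uniform grid: the lower left corner `p` of the lattice cell that contains it,
and which of the two halves of the cell it is. -/
abbrev Cell : Type := (ℤ × ℤ) × Bool

/-- A uniform triangular mesh: the nodes are the lattice points `origin + i • u + j • v`, and every
lattice parallelogram is cut into two triangles by its diagonal in direction `u + v`.
`dom` is the meshed open domain, `inner` the finite set of (indices of) internal nodes, and `cells`
the finite set of triangles of the mesh. -/
structure GridMesh where
  origin : Plane
  u : Plane
  v : Plane
  dom : Set Plane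
  inner : Finset (ℤ × ℤ)
  cells : Finset Cell

/-- The indices of the three vertices of a triangle. -/
def Cell.vertex (K : Cell) : Fin 3 → ℤ × ℤ :=
  ![K.1, if K.2 then K.1 + (0, 1) else K.1 + (1, 0), K.1 + (1, 1)]

namespace GridMesh

variable (M : GridMesh)

/-- The node with index `p`. -/
def node (p : ℤ × ℤ) : Plane := M.origin + (p.1 : ℝ) • M.u + (p.2 : ℝ) • M.v

/-- The closed triangle `K`. -/
def triangle (K : Cell) : Set Plane := convexHull ℝ (range fun k => M.node (K.vertex k))

/-- The barycenter of the triangle `K`. -/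
def barycenter (K : Cell) : Plane := (1 / 3 : ℝ) • ∑ k, M.node (K.vertex k)

/-- The linear finite element space: functions that are continuous on the closed domain, affine
on each triangle and zero on the boundary. -/
def feSpace : Set (Plane → ℝ) :=
  {φ | ContinuousOn φ (closure M.dom) ∧
    (∀ K ∈ M.cells, ∃ α β γ : ℝ, ∀ x ∈ M.triangle K, φ x = α + β * x 0 + γ * x 1) ∧
    ∀ x ∈ frontier M.dom, φ x = 0}

/-- First lattice coordinate: `x = origin + coordS x • u + coordT x • v`. -/
def coordS (x : Plane) : ℝ := cross (x - M.origin) M.v / cross M.u M.v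

/-- Second lattice coordinate. -/
def coordT (x : Plane) : ℝ := cross M.u (x - M.origin) / cross M.u M.v

/-- The nodal basis function (hat function) of the node `p`, in lattice coordinates. For the
meshes below it is the element of `feSpace` that is `1` at the node `p` and `0` at all other
nodes: see `hexagonMesh_hat_mem`, `squareMesh_hat_mem` and `hat_node`. -/
def hat (p : ℤ × ℤ) (x : Plane) : ℝ :=
  max 0 (1 - max |M.coordS x - p.1|
    (max |M.coordT x - p.2| |(M.coordS x - p.1) - (M.coordT x - p.2)|))

/-! ### Stiffness and convection matrices, integrals evaluated exactly -/

/-- `(Θ(a))_{ij} = ∫_Ω a ∇φ_j · ∇φ_i`. -/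
def diffusion (a : Plane → ℝ) : Matrix M.inner M.inner ℝ :=
  Matrix.of fun i j => ∫ x in M.dom, a x * ⟪∇ (M.hat j) x, ∇ (M.hat i) x⟫_ℝ

/-- `(Ψ(b))_{ij} = - ∫_Ω (b · ∇φ_i) φ_j`. -/
def convection (b : Plane → Plane) : Matrix M.inner M.inner ℝ :=
  Matrix.of fun i j => - ∫ x in M.dom, ⟪b x, ∇ (M.hat i) x⟫_ℝ * M.hat j x

/-! ### The same matrices, integrals evaluated by a quadrature formula on each triangle -/

/-- The constant value of `∇φ_p` on the (open) triangle `K`. -/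
def gradOn (K : Cell) (p : ℤ × ℤ) : Plane := ∇ (M.hat p) (M.barycenter K)

end GridMesh

/-- The value `∑ₓ w(x) g(x)` of a quadrature formula with finitely many points `x` and
weights `w(x)`. -/
def quadApply (w : Plane →₀ ℝ) (g : Plane → ℝ) : ℝ := w.sum fun x c => c * g x

namespace GridMesh

variable (M : GridMesh)

/-- `∑_K Q_K(a ∇φ_j · ∇φ_i)`. -/
def diffusionQuad (Q : Cell → Plane →₀ ℝ) (a : Plane → ℝ) : Matrix M.inner M.inner ℝ :=
  Matrix.of fun i j =>
    ∑ K ∈ M.cells, quadApply (Q K) fun x => a x * ⟪M.gradOn K j, M.gradOn K i⟫_ℝ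

/-- `- ∑_K Q_K((b · ∇φ_i) φ_j)`. -/
def convectionQuad (Q : Cell → Plane →₀ ℝ) (b : Plane → Plane) : Matrix M.inner M.inner ℝ :=
  Matrix.of fun i j =>
    - ∑ K ∈ M.cells, quadApply (Q K) fun x => ⟪b x, M.gradOn K i⟫_ℝ * M.hat j x

end GridMesh

/-- A family of quadrature formulas, one on each triangle of each mesh of a sequence, with points
in the triangle, weights that are uniformly bounded relative to the area, and error `O(h²)`
(relative to the area) on `C²` functions. -/
structure IsQuadratureOrderTwo (mesh : ℕ → GridMesh) (Q : ℕ → Cell → Plane →₀ ℝ) : Prop where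
  mem_triangle : ∀ m, ∀ K ∈ (mesh m).cells, ∀ x ∈ (Q m K).support, x ∈ (mesh m).triangle K
  stable : ∃ W : ℝ, ∀ m, ∀ K ∈ (mesh m).cells,
    ((Q m K).sum fun _ c => |c|) ≤ W * volume.real ((mesh m).triangle K)
  error : ∃ C : ℝ, ∀ m, ∀ K ∈ (mesh m).cells, ∀ g : Plane → ℝ, ContDiff ℝ 2 g → ∀ B : ℝ,
    (∀ x ∈ (mesh m).triangle K,
      |g x| ≤ B ∧ ‖fderiv ℝ g x‖ ≤ B ∧ ‖iteratedFDeriv ℝ 2 g x‖ ≤ B) →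
    |quadApply (Q m K) g - ∫ x in (mesh m).triangle K, g x| ≤
      C * Metric.diam ((mesh m).triangle K) ^ 2 * volume.real ((mesh m).triangle K) * B

/-! ## Preconditioner, eigenvalues, clusters -/

/-- `D^{1/2} T₁ D^{1/2}` with `D = diag(T) diag(T₁)⁻¹`. -/
def scaledPrecond {ι : Type} [Fintype ι] [DecidableEq ι] (T T₁ : Matrix ι ι ℝ) : Matrix ι ι ℝ :=
  Matrix.diagonal (fun i => Real.sqrt (T i i / T₁ i i)) * T₁ *
    Matrix.diagonal (fun i => Real.sqrt (T i i / T₁ i i))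

/-- The complex eigenvalues of a real matrix, with algebraic multiplicity. -/
def complexEigenvalues {ι : Type} [Fintype ι] [DecidableEq ι] (X : Matrix ι ι ℝ) : Multiset ℂ :=
  (X.map (algebraMap ℝ ℂ)).charpoly.roots

open Classical in
/-- A sequence of matrices is properly clustered at `p` if for every `ε > 0` the number of
eigenvalues outside the disk `D(p, ε)` is bounded independently of the matrix. -/
def ProperlyClustered {ι : ℕ → Type} [∀ m, Fintype (ι m)] [∀ m, DecidableEq (ι m)]
    (X : ∀ m, Matrix (ι m) (ι m) ℝ) (p : ℂ) : Prop :=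
  ∀ ε : ℝ, 0 < ε → ∃ C : ℕ, ∀ m,
    ((complexEigenvalues (X m)).filter fun z => z ∉ Metric.ball p ε).card ≤ C

namespace GridMesh

variable (M : GridMesh)

/-- `P(a)⁻¹ A(a, b)` with exactly evaluated integrals, where `A(a, b) = Θ(a) + Ψ(b)` and `P(a)`
is built from `A(a, 0) = Θ(a)` and `A(1, 0) = Θ(1)`. -/
def precondMatrix (a : Plane → ℝ) (b : Plane → Plane) : Matrix M.inner M.inner ℝ :=
  (scaledPrecond (M.diffusion a) (M.diffusion fun _ => 1))⁻¹ * (M.diffusion a + M.convection b)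

/-- `P(a)⁻¹ A(a, b)` where the integrals with the coefficients `a` and `b` are evaluated by a
quadrature formula; those in `A(1, 0)` have piecewise constant integrands and are exact. -/
def precondMatrixQuad (Q : Cell → Plane →₀ ℝ) (a : Plane → ℝ) (b : Plane → Plane) :
    Matrix M.inner M.inner ℝ :=
  (scaledPrecond (M.diffusionQuad Q a) (M.diffusion fun _ => 1))⁻¹ *
    (M.diffusionQuad Q a + M.convectionQuad Q b)

end GridMesh

/-! ## Coefficients -/

/-- The divergence of a plane vector field. -/
def planeDiv (b : Plane → Plane) (x : Plane) : ℝ :=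
  ∑ k, (fderiv ℝ b x (EuclideanSpace.single k 1)) k

/-- `a ∈ C²(Ω̄)` with `a ≥ a₀ > 0`, `b ∈ C¹(Ω̄)` with `div b ≥ 0` in `Ω`. -/
structure AdmissibleCoefficients (Ω : Set Plane) (a : Plane → ℝ) (b : Plane → Plane) : Prop where
  a_smooth : ContDiffOn ℝ 2 a (closure Ω)
  a_pos : ∃ a₀ : ℝ, 0 < a₀ ∧ ∀ x ∈ closure Ω, a₀ ≤ a x
  b_smooth : ContDiffOn ℝ 1 b (closure Ω)
  div_nonneg : ∀ x ∈ Ω, 0 ≤ planeDiv b x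

/-! ## The two model meshes -/

/-- The vector `v` rotated by `120` degrees. -/
def rot120 (v : Plane) : Plane :=
  !₂[-(1 / 2) * v 0 - Real.sqrt 3 / 2 * v 1, Real.sqrt 3 / 2 * v 0 - 1 / 2 * v 1]

/-- The open regular hexagon with center `c` and vertices `c ± v`, `c ± w`, `c ± (v + w)`, where
`w` is `v` rotated by `120` degrees. -/
def hexagon (c v : Plane) : Set Plane :=
  {x | ∃ s t : ℝ, |s| < 1 ∧ |t| < 1 ∧ |s - t| < 1 ∧ x = c + s • v + t • rot120 v}

/-- The index `p` lies in the closed lattice hexagon of radius `m`. -/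
def inHex (m : ℕ) (p : ℤ × ℤ) : Prop := |p.1| ≤ m ∧ |p.2| ≤ m ∧ |p.1 - p.2| ≤ m

instance (m : ℕ) : DecidablePred (inHex m) := fun p => by unfold inHex; infer_instance

/-- The mesh of the regular hexagon into `6 m ^ 2` equilateral triangles, every side being
divided into `m` equal parts. -/
def hexagonMesh (c v : Plane) (m : ℕ) : GridMesh where
  origin := c
  u := (1 / (m : ℝ)) • v
  v := (1 / (m : ℝ)) • rot120 v
  dom := hexagon c v
  inner := (Finset.Icc (-(m : ℤ)) m ×ˢ Finset.Icc (-(m : ℤ)) m).filter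
    fun p => |p.1| < m ∧ |p.2| < m ∧ |p.1 - p.2| < m
  cells := ((Finset.Icc (-(m : ℤ)) m ×ˢ Finset.Icc (-(m : ℤ)) m) ×ˢ Finset.univ).filter
    fun K => ∀ k, inHex m (Cell.vertex K k)

/-- The open unit square. -/
def unitSquare : Set Plane := {x | ∀ k, 0 < x k ∧ x k < 1}

/-- The Friedrichs-Keller mesh of the unit square into `2 m ^ 2` triangles: `m ^ 2` equal squares,
all cut by the diagonal in direction `(1, 1)`, or all in direction `(-1, 1)` if `flip` holds. -/
def squareMesh (flip : Bool) (m : ℕ) : GridMesh where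
  origin := if flip then !₂[1, 0] else 0
  u := if flip then !₂[-(1 / (m : ℝ)), 0] else !₂[1 / (m : ℝ), 0]
  v := !₂[0, 1 / (m : ℝ)]
  dom := unitSquare
  inner := Finset.Ioo (0 : ℤ) m ×ˢ Finset.Ioo (0 : ℤ) m
  cells := (Finset.Ico (0 : ℤ) m ×ˢ Finset.Ico (0 : ℤ) m) ×ˢ Finset.univ

/-- `mesh` is the sequence of uniform meshes of a regular hexagon into equilateral triangles, or
of Friedrichs-Keller meshes of the unit square, and `Ω` is the meshed domain. -/
def IsModelMesh (Ω : Set Plane) (mesh : ℕ → GridMesh) : Prop :=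
  (∃ c v : Plane, v ≠ 0 ∧ Ω = hexagon c v ∧ mesh = hexagonMesh c v) ∨
    (Ω = unitSquare ∧ ∃ flip : Bool, mesh = squareMesh flip)

/-! ## The hat functions are the nodal basis functions of the finite element space -/

namespace GridMesh

variable (M : GridMesh)

theorem coordS_node (h : cross M.u M.v ≠ 0) (p : ℤ × ℤ) : M.coordS (M.node p) = p.1 := by
  unfold coordS node
  rw [div_eq_iff h]
  simp [cross]; ring

theorem coordT_node (h : cross M.u M.v ≠ 0) (p : ℤ × ℤ) : M.coordT (M.node p) = p.2 := by
  unfold coordT node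
  rw [div_eq_iff h]
  simp [cross]; ring

theorem hat_node (h : cross M.u M.v ≠ 0) (p q : ℤ × ℤ) :
    M.hat p (M.node q) = if q = p then 1 else 0 := by
  unfold hat
  rw [M.coordS_node h, M.coordT_node h]
  split_ifs with hq
  · subst hq; simp
  · apply max_eq_left
    have : q.1 ≠ p.1 ∨ q.2 ≠ p.2 := by
      by_contra hc
      push Not at hc
      exact hq (Prod.ext hc.1 hc.2)
    rcases this with h1 | h1
    · have h2 : (1 : ℤ) ≤ |q.1 - p.1| := Int.one_le_abs (sub_ne_zero.2 h1)
      have h3 : (1 : ℝ) ≤ |(q.1 : ℝ) - p.1| := by exact_mod_cast h2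
      linarith [le_max_left |(q.1 : ℝ) - p.1|
        (max |(q.2 : ℝ) - p.2| |((q.1 : ℝ) - p.1) - (q.2 - p.2)|)]
    · have h2 : (1 : ℤ) ≤ |q.2 - p.2| := Int.one_le_abs (sub_ne_zero.2 h1)
      have h3 : (1 : ℝ) ≤ |(q.2 : ℝ) - p.2| := by exact_mod_cast h2
      linarith [le_max_right |(q.1 : ℝ) - p.1|
        (max |(q.2 : ℝ) - p.2| |((q.1 : ℝ) - p.1) - (q.2 - p.2)|),
        le_max_left |(q.2 : ℝ) - p.2| |((q.1 : ℝ) - p.1) - (q.2 - p.2)|]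

theorem coordS_affine : ∃ α β γ : ℝ, ∀ x, M.coordS x = α + β * x 0 + γ * x 1 :=
  ⟨-(M.origin 0 * M.v 1 - M.origin 1 * M.v 0) / cross M.u M.v, M.v 1 / cross M.u M.v,
    - M.v 0 / cross M.u M.v, fun x => by simp [coordS, cross]; ring⟩

theorem coordT_affine : ∃ α β γ : ℝ, ∀ x, M.coordT x = α + β * x 0 + γ * x 1 :=
  ⟨-(M.u 0 * M.origin 1 - M.u 1 * M.origin 0) / cross M.u M.v, - M.u 1 / cross M.u M.v,
    M.u 0 / cross M.u M.v, fun x => by simp [coordT, cross]; ring⟩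

theorem continuous_hat (p : ℤ × ℤ) : Continuous (M.hat p) := by
  unfold hat coordS coordT cross
  fun_prop

/-- A triangle in lattice coordinates. -/
theorem coords_of_mem_triangle (h : cross M.u M.v ≠ 0) (K : Cell) (x : Plane)
    (hx : x ∈ M.triangle K) :
    if K.2 then 0 ≤ M.coordS x - K.1.1 ∧ M.coordS x - K.1.1 ≤ M.coordT x - K.1.2 ∧
        M.coordT x - K.1.2 ≤ 1
      else 0 ≤ M.coordT x - K.1.2 ∧ M.coordT x - K.1.2 ≤ M.coordS x - K.1.1 ∧
        M.coordS x - K.1.1 ≤ 1 := by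
  obtain ⟨α, β, γ, hS⟩ := M.coordS_affine
  obtain ⟨α', β', γ', hT⟩ := M.coordT_affine
  have key : ∀ A B C : ℝ, (∀ k, A + B * M.coordS (M.node (K.vertex k)) +
      C * M.coordT (M.node (K.vertex k)) ≤ 0) → A + B * M.coordS x + C * M.coordT x ≤ 0 := by
    intro A B C hk
    have hconv : Convex ℝ {y : Plane | A + B * M.coordS y + C * M.coordT y ≤ 0} := by
      intro y hy z hz s t hs ht hst
      simp only [mem_ofPred_eq, hS, hT] at hy hz ⊢
      simp only [PiLp.add_apply, PiLp.smul_apply, smul_eq_mul]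
      have e : A + B * (α + β * (s * y 0 + t * z 0) + γ * (s * y 1 + t * z 1)) +
          C * (α' + β' * (s * y 0 + t * z 0) + γ' * (s * y 1 + t * z 1)) =
          s * (A + B * (α + β * y 0 + γ * y 1) + C * (α' + β' * y 0 + γ' * y 1)) +
          t * (A + B * (α + β * z 0 + γ * z 1) + C * (α' + β' * z 0 + γ' * z 1)) := by
        obtain rfl : t = 1 - s := by linarith
        ring
      rw [e]
      nlinarith [mul_nonneg hs (neg_nonneg.2 hy), mul_nonneg ht (neg_nonneg.2 hz)]
    refine convexHull_min ?_ hconv hx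
    rintro _ ⟨k, rfl⟩
    exact hk k
  simp only [M.coordS_node h, M.coordT_node h] at key
  obtain ⟨⟨q1, q2⟩, b⟩ := K
  cases b
  · have h1 := key q2 0 (-1) (by intro k; fin_cases k <;> simp [Cell.vertex])
    have h2 := key (q1 - q2) (-1) 1 (by intro k; fin_cases k <;> (simp [Cell.vertex]; try linarith))
    have h3 := key (-q1 - 1) 1 0 (by intro k; fin_cases k <;> (simp [Cell.vertex]; try linarith))
    simp only [Bool.false_eq_true, if_false]
    refine ⟨?_, ?_, ?_⟩ <;> linarith
  · have h1 := key q1 (-1) 0 (by intro k; fin_cases k <;> simp [Cell.vertex])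
    have h2 := key (q2 - q1) 1 (-1) (by intro k; fin_cases k <;> (simp [Cell.vertex]; try linarith))
    have h3 := key (-q2 - 1) 0 1 (by intro k; fin_cases k <;> (simp [Cell.vertex]; try linarith))
    simp only [if_true]
    refine ⟨?_, ?_, ?_⟩ <;> linarith

theorem hat_lattice_affine (a b : ℤ) : ∃ A B C : ℝ, ∀ S T : ℝ, 0 ≤ T → T ≤ S → S ≤ 1 →
    max 0 (1 - max |S - a| (max |T - b| |(S - a) - (T - b)|)) = A + B * S + C * T := by
  have zero : (∀ S T : ℝ, 0 ≤ T → T ≤ S → S ≤ 1 →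
      1 ≤ |S - a| ∨ 1 ≤ |T - b| ∨ 1 ≤ |(S - a) - (T - b)|) →
      ∃ A B C : ℝ, ∀ S T : ℝ, 0 ≤ T → T ≤ S → S ≤ 1 →
      max 0 (1 - max |S - a| (max |T - b| |(S - a) - (T - b)|)) = A + B * S + C * T := by
    intro hh
    refine ⟨0, 0, 0, fun S T h0 h1 h2 => ?_⟩
    rw [max_eq_left]
    · ring
    · rw [sub_nonpos]
      simpa only [le_max_iff] using hh S T h0 h1 h2
  by_cases ha : a = 0 ∧ b = 0
  · obtain ⟨rfl, rfl⟩ := ha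
    refine ⟨1, -1, 0, fun S T h0 h1 h2 => ?_⟩
    simp only [Int.cast_zero, sub_zero]
    rw [abs_of_nonneg (h0.trans h1), abs_of_nonneg h0, abs_of_nonneg (sub_nonneg.2 h1),
      max_eq_left (max_le h1 (by linarith)), max_eq_right (by linarith)]
    ring
  by_cases hb : a = 1 ∧ b = 0
  · obtain ⟨rfl, rfl⟩ := hb
    refine ⟨0, 1, -1, fun S T h0 h1 h2 => ?_⟩
    simp only [Int.cast_zero, Int.cast_one, sub_zero]
    rw [abs_of_nonpos (by linarith : S - 1 ≤ 0), abs_of_nonneg h0,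
      abs_of_nonpos (by linarith : S - 1 - T ≤ 0),
      max_eq_right (le_max_of_le_right (by linarith)),
      max_eq_right (by linarith : T ≤ -(S - 1 - T)), max_eq_right (by linarith)]
    ring
  by_cases hc : a = 1 ∧ b = 1
  · obtain ⟨rfl, rfl⟩ := hc
    refine ⟨0, 0, 1, fun S T h0 h1 h2 => ?_⟩
    simp only [Int.cast_one]
    rw [abs_of_nonpos (by linarith : S - 1 ≤ 0), abs_of_nonpos (by linarith : T - 1 ≤ 0),
      abs_of_nonneg (by linarith : 0 ≤ S - 1 - (T - 1)),
      max_eq_right (le_max_of_le_left (by linarith)),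
      max_eq_left (by linarith : S - 1 - (T - 1) ≤ -(T - 1)), max_eq_right (by linarith)]
    ring
  apply zero
  intro S T h0 h1 h2
  have hcases : a ≤ -1 ∨ 2 ≤ a ∨ b ≤ -1 ∨ 2 ≤ b ∨ a - b ≤ -1 := by omega
  rcases hcases with h | h | h | h | h
  · have h' : (a : ℝ) ≤ -1 := by exact_mod_cast h
    left; rw [le_abs]; left; linarith
  · have h' : (2 : ℝ) ≤ a := by exact_mod_cast h
    left; rw [le_abs]; right; linarith
  · have h' : (b : ℝ) ≤ -1 := by exact_mod_cast h
    right; left; rw [le_abs]; left; linarith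
  · have h' : (2 : ℝ) ≤ b := by exact_mod_cast h
    right; left; rw [le_abs]; right; linarith
  · have h' : (a : ℝ) - b ≤ -1 := by exact_mod_cast h
    right; right; rw [le_abs]; left; linarith

theorem hat_affine_on_triangle (h : cross M.u M.v ≠ 0) (p : ℤ × ℤ) (K : Cell) :
    ∃ α β γ : ℝ, ∀ x ∈ M.triangle K, M.hat p x = α + β * x 0 + γ * x 1 := by
  obtain ⟨α, β, γ, hS⟩ := M.coordS_affine
  obtain ⟨α', β', γ', hT⟩ := M.coordT_affine
  obtain ⟨⟨q1, q2⟩, b⟩ := K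
  have fin : ∀ A B C : ℝ, (∀ x ∈ M.triangle ((q1, q2), b),
      M.hat p x = A + B * (M.coordS x - q1) + C * (M.coordT x - q2)) →
      ∃ α β γ : ℝ, ∀ x ∈ M.triangle ((q1, q2), b), M.hat p x = α + β * x 0 + γ * x 1 := by
    intro A B C hh
    refine ⟨A + B * (α - q1) + C * (α' - q2), B * β + C * β', B * γ + C * γ', fun x hx => ?_⟩
    rw [hh x hx, hS, hT]; ring
  cases b
  · obtain ⟨A, B, C, hh⟩ := hat_lattice_affine (p.1 - q1) (p.2 - q2)
    refine fin A B C fun x hx => ?_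
    have hc := M.coords_of_mem_triangle h _ x hx
    simp only [Bool.false_eq_true, if_false] at hc
    rw [← hh _ _ hc.1 hc.2.1 hc.2.2, hat]
    push_cast
    simp only [sub_sub_sub_cancel_right]
  · obtain ⟨A, B, C, hh⟩ := hat_lattice_affine (p.2 - q2) (p.1 - q1)
    refine fin A C B fun x hx => ?_
    have hc := M.coords_of_mem_triangle h _ x hx
    simp only [if_true] at hc
    have := hh _ _ hc.1 hc.2.1 hc.2.2
    push_cast at this
    simp only [sub_sub_sub_cancel_right] at this
    rw [hat, max_left_comm, abs_sub_comm (M.coordS x - p.1), this]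
    ring

theorem hat_eq_zero (p : ℤ × ℤ) (x : Plane)
    (hx : 1 ≤ |M.coordS x - p.1| ∨ 1 ≤ |M.coordT x - p.2| ∨
      1 ≤ |(M.coordS x - p.1) - (M.coordT x - p.2)|) : M.hat p x = 0 := by
  unfold hat
  apply max_eq_left
  rw [sub_nonpos]
  simpa only [le_max_iff] using hx

theorem coords_eq (h : cross M.u M.v ≠ 0) (x : Plane) :
    x = M.origin + M.coordS x • M.u + M.coordT x • M.v := by
  have key : ∀ k, cross M.u M.v * (x k - M.origin k) =
      cross (x - M.origin) M.v * M.u k + cross M.u (x - M.origin) * M.v k := by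
    intro k
    fin_cases k <;> simp [cross] <;> ring
  ext k
  have hk := key k
  simp only [coordS, coordT, PiLp.add_apply, PiLp.smul_apply, smul_eq_mul]
  field_simp
  linarith

end GridMesh

theorem cross_rot120 (v : Plane) (hv : v ≠ 0) : 0 < cross v (rot120 v) := by
  have h : v 0 ≠ 0 ∨ v 1 ≠ 0 := by
    by_contra hc
    push Not at hc
    exact hv (by ext k; fin_cases k <;> simp [hc.1, hc.2])
  have h3 : 0 < Real.sqrt 3 := by positivity
  have e : cross v (rot120 v) = Real.sqrt 3 / 2 * (v 0 ^ 2 + v 1 ^ 2) := by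
    simp [cross, rot120]; ring
  rw [e]
  rcases h with h | h <;> positivity

theorem hexagonMesh_cross (c v : Plane) (hv : v ≠ 0) (m : ℕ) (hm : m ≠ 0) :
    cross (hexagonMesh c v m).u (hexagonMesh c v m).v ≠ 0 := by
  have h := (cross_rot120 v hv).ne'
  have hm' : (m : ℝ) ≠ 0 := by exact_mod_cast hm
  have e : cross (hexagonMesh c v m).u (hexagonMesh c v m).v =
      (1 / (m : ℝ)) ^ 2 * cross v (rot120 v) := by
    simp [cross, hexagonMesh]; ring
  rw [e]
  positivity

theorem squareMesh_cross (flip : Bool) (m : ℕ) (hm : m ≠ 0) :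
    cross (squareMesh flip m).u (squareMesh flip m).v ≠ 0 := by
  have hm' : (m : ℝ) ≠ 0 := by exact_mod_cast hm
  cases flip <;> simp [cross, squareMesh, hm']

theorem isOpen_unitSquare : IsOpen unitSquare := by
  have : unitSquare = ⋂ k : Fin 2, {x : Plane | 0 < x k} ∩ {x : Plane | x k < 1} := by
    ext x; simp [unitSquare]
  rw [this]
  refine isOpen_iInter_of_finite fun k => IsOpen.inter ?_ ?_
  · exact isOpen_lt (by fun_prop) (by fun_prop)
  · exact isOpen_lt (by fun_prop) (by fun_prop)

theorem hexagon_eq (c v : Plane) (hv : v ≠ 0) :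
    hexagon c v = {x | |(hexagonMesh c v 1).coordS x| < 1 ∧ |(hexagonMesh c v 1).coordT x| < 1 ∧
      |(hexagonMesh c v 1).coordS x - (hexagonMesh c v 1).coordT x| < 1} := by
  have hc := (cross_rot120 v hv).ne'
  ext x
  constructor
  · rintro ⟨s, t, hs, ht, hst, rfl⟩
    have e1 : (hexagonMesh c v 1).coordS (c + s • v + t • rot120 v) = s := by
      unfold GridMesh.coordS hexagonMesh
      simp only [Nat.cast_one, div_one, one_smul]
      rw [div_eq_iff hc]
      simp [cross]; ring
    have e2 : (hexagonMesh c v 1).coordT (c + s • v + t • rot120 v) = t := by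
      unfold GridMesh.coordT hexagonMesh
      simp only [Nat.cast_one, div_one, one_smul]
      rw [div_eq_iff hc]
      simp [cross]; ring
    rw [mem_ofPred_eq, e1, e2]
    exact ⟨hs, ht, hst⟩
  · rintro ⟨hs, ht, hst⟩
    refine ⟨_, _, hs, ht, hst, ?_⟩
    have := (hexagonMesh c v 1).coords_eq (hexagonMesh_cross c v hv 1 one_ne_zero) x
    simpa [hexagonMesh] using this

theorem isOpen_hexagon (c v : Plane) (hv : v ≠ 0) : IsOpen (hexagon c v) := by
  rw [hexagon_eq c v hv]
  have hS : Continuous (hexagonMesh c v 1).coordS := by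
    unfold GridMesh.coordS cross
    fun_prop
  have hT : Continuous (hexagonMesh c v 1).coordT := by
    unfold GridMesh.coordT cross
    fun_prop
  exact (isOpen_lt hS.abs continuous_const).inter
    ((isOpen_lt hT.abs continuous_const).inter (isOpen_lt (hS.sub hT).abs continuous_const))

/-- For an internal node `p` of the square mesh, `hat p` belongs to the finite element space. -/
theorem squareMesh_hat_mem (flip : Bool) (m : ℕ) (hm : m ≠ 0) (p : ℤ × ℤ)
    (hp : p ∈ (squareMesh flip m).inner) :
    (squareMesh flip m).hat p ∈ (squareMesh flip m).feSpace := by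
  refine ⟨(GridMesh.continuous_hat _ p).continuousOn,
    fun K _ => GridMesh.hat_affine_on_triangle _ (squareMesh_cross flip m hm) p K, ?_⟩
  intro x hx
  have hx' : x ∉ unitSquare := by
    have := hx.2
    rwa [show (squareMesh flip m).dom = unitSquare from rfl, isOpen_unitSquare.interior_eq] at this
  apply GridMesh.hat_eq_zero
  have hm' : (0 : ℝ) < m := by positivity
  simp only [squareMesh, Finset.mem_product, Finset.mem_Ioo] at hp
  obtain ⟨⟨h1, h2⟩, h3, h4⟩ := hp
  have h1' : (1 : ℝ) ≤ p.1 := by exact_mod_cast h1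
  have h2' : (p.1 : ℝ) + 1 ≤ m := by exact_mod_cast h2
  have h3' : (1 : ℝ) ≤ p.2 := by exact_mod_cast h3
  have h4' : (p.2 : ℝ) + 1 ≤ m := by exact_mod_cast h4
  have eT : (squareMesh flip m).coordT x = m * x 1 := by
    cases flip <;> simp [GridMesh.coordT, cross, squareMesh] <;> field_simp
  have eS : (squareMesh flip m).coordS x = if flip then m * (1 - x 0) else m * x 0 := by
    cases flip <;> simp [GridMesh.coordS, cross, squareMesh] <;> field_simp
    ring
  have hor : x 0 ≤ 0 ∨ 1 ≤ x 0 ∨ x 1 ≤ 0 ∨ 1 ≤ x 1 := by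
    by_contra hc
    push Not at hc
    apply hx'
    intro k
    fin_cases k
    · exact ⟨hc.1, hc.2.1⟩
    · exact ⟨hc.2.2.1, hc.2.2.2⟩
  rw [eT, eS]
  rcases hor with h | h | h | h
  · left
    cases flip
    · simp only [Bool.false_eq_true, if_false]; rw [le_abs]; right; nlinarith
    · simp only [if_true]; rw [le_abs]; left; nlinarith
  · left
    cases flip
    · simp only [Bool.false_eq_true, if_false]; rw [le_abs]; left; nlinarith
    · simp only [if_true]; rw [le_abs]; right; nlinarith
  · right; left; rw [le_abs]; right; nlinarith
  · right; left; rw [le_abs]; left; nlinarith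

/-- For an internal node `p` of the hexagon mesh, `hat p` belongs to the finite element space. -/
theorem hexagonMesh_hat_mem (c v : Plane) (hv : v ≠ 0) (m : ℕ) (hm : m ≠ 0) (p : ℤ × ℤ)
    (hp : p ∈ (hexagonMesh c v m).inner) :
    (hexagonMesh c v m).hat p ∈ (hexagonMesh c v m).feSpace := by
  refine ⟨(GridMesh.continuous_hat _ p).continuousOn,
    fun K _ => GridMesh.hat_affine_on_triangle _ (hexagonMesh_cross c v hv m hm) p K, ?_⟩
  intro x hx
  have hx' : x ∉ hexagon c v := by
    have := hx.2
    rwa [show (hexagonMesh c v m).dom = hexagon c v from rfl,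
      (isOpen_hexagon c v hv).interior_eq] at this
  apply GridMesh.hat_eq_zero
  have hm' : (0 : ℝ) < m := by positivity
  have hp' := (Finset.mem_filter.1 hp).2
  obtain ⟨h1, h2, h3⟩ := hp'
  have h1' : |(p.1 : ℝ)| + 1 ≤ m := by exact_mod_cast h1
  have h2' : |(p.2 : ℝ)| + 1 ≤ m := by exact_mod_cast h2
  have h3' : |(p.1 : ℝ) - p.2| + 1 ≤ m := by exact_mod_cast h3
  have hc := (cross_rot120 v hv).ne'
  have hcr : cross (hexagonMesh c v m).u (hexagonMesh c v m).v =
      (1 / (m : ℝ)) ^ 2 * cross v (rot120 v) := by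
    simp [cross, hexagonMesh]; ring
  have eS : (hexagonMesh c v m).coordS x = m * (hexagonMesh c v 1).coordS x := by
    unfold GridMesh.coordS
    rw [hcr]
    have : cross (hexagonMesh c v 1).u (hexagonMesh c v 1).v = cross v (rot120 v) := by
      simp [cross, hexagonMesh]
    rw [this]
    field_simp
    simp [cross, hexagonMesh]
    field_simp
  have eT : (hexagonMesh c v m).coordT x = m * (hexagonMesh c v 1).coordT x := by
    unfold GridMesh.coordT
    rw [hcr]
    have : cross (hexagonMesh c v 1).u (hexagonMesh c v 1).v = cross v (rot120 v) := by
      simp [cross, hexagonMesh]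
    rw [this]
    field_simp
    simp [cross, hexagonMesh]
    field_simp
  rw [eS, eT]
  rw [hexagon_eq c v hv, mem_ofPred_eq] at hx'
  set S := (hexagonMesh c v 1).coordS x
  set T := (hexagonMesh c v 1).coordT x
  have big : ∀ y q : ℝ, 1 ≤ |y| → |q| + 1 ≤ m → 1 ≤ |m * y - q| := by
    intro y q hy hq
    have e1 := abs_sub_abs_le_abs_sub (m * y) q
    rw [abs_mul, abs_of_pos hm'] at e1
    nlinarith
  by_cases hS : |S| < 1
  · by_cases hT : |T| < 1
    · right; right
      have := big (S - T) (p.1 - p.2) (by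
        by_contra hst
        exact hx' ⟨hS, hT, not_le.1 hst⟩) h3'
      rwa [show (m : ℝ) * S - p.1 - (m * T - p.2) = m * (S - T) - (p.1 - p.2) by ring]
    · right; left
      exact big T p.2 (not_lt.1 hT) h2'
  · left
    exact big S p.1 (not_lt.1 hS) h1'

end

/-!
The eigenvalues of `P⁻¹ A` with `P` symmetric positive definite are the values `xᴴ A x` on some
`P`-orthonormal family of vectors, by Schur triangularization of the similar matrix `B⁻ᴴ A B⁻¹`,
`P = Bᴴ B` (`exists_orthonormal_complexEigenvalues`). Everything is thereby reduced to estimates of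
sesquilinear forms.

**Lower order.** On a uniform mesh with parameter `m`, compare with the discrete energy `G x`, the
sum of the squared nodal differences of `x` over the edges of the triangles, and with the squared
Euclidean norm `N x` of the nodal values. The `P`-form is equivalent to `G`. The diagonal ratio in
`D` is at every node a weighted mean of the values of `a` on the adjacent triangles
(`diag_ratio_bounds`), so only `a` being Lipschitz is needed to see that `Θ(a) - P`, as well as the
convection matrix, is of size `(G N) ^ (1 / 2) / m`: one order lower than `G`
(`exists_form_bounds`).

**Cluster.** Cut the domain into `R ^ 2` square blocks. By Poincaré's inequality on every block,
`N / m ^ 2` is at most a multiple of `G / R ^ 2`, up to `R ^ 2` bounded linear functionals, the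
block sums (`normSqSum_le_blocks`). An eigenvalue outside of the disk of radius `ε` makes the form
of `A - P` at least `ε` at its vector. Since Bessel's inequality bounds the total contribution of
the `R ^ 2` functionals over all vectors of the `P`-orthonormal family, and the term
`G / R ^ 2` is negligible for `R` large, the number of such eigenvalues is bounded independently of
`m` (`card_eigenvalues_notMem_ball_le`, `properlyClustered_of_form_bounds`).

**Rectangle.** Upper bounds follow from the Poincaré–Friedrichs inequality `N ≤ C m ^ 2 G`. The
lower bound of the real part needs `Re xᴴ Ψ x ≥ 0`. With exact integration it equals
`½ ∫ (div b) |v| ^ 2`, by the integration by parts formula for Lipschitz functions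
(`sum_sum_convection_nonneg`). With quadrature, replacing `b` by a constant on each triangle shows
that the element moments change by `O(m⁻²)`, hence the form by `O(m⁻¹) G`, which is absorbed for
large `m` (`eventually_neg_mul_gridEnergy_le`).

Exact integration and quadrature are treated together as an `IsElementRule`: a stable linear
functional on each triangle that integrates constants and barycentric coordinates up to a relative
error `O(m⁻¹)`.
-/

noncomputable section

/-! ### Eigenvalues as values of a form on an orthonormal family -/

/-- Schur's theorem: every operator is upper triangular in some orthonormal basis. The orthogonal
complement of an eigenvector of the adjoint is invariant, and that vector comes last. -/
theorem exists_orthonormalBasis_inner_eq_zero_of_lt (n : ℕ) :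
    ∀ (E : Type) [NormedAddCommGroup E] [InnerProductSpace ℂ E] [FiniteDimensional ℂ E],
      Module.finrank ℂ E = n → ∀ T : E →ₗ[ℂ] E,
      ∃ b : OrthonormalBasis (Fin n) ℂ E, ∀ i j, j < i → ⟪b i, T (b j)⟫_ℂ = 0 := by
  induction n with
  | zero =>
    intro E _ _ _ hn T
    exact ⟨(stdOrthonormalBasis ℂ E).reindex (finCongr hn), fun i => i.elim0⟩
  | succ n ih =>
    intro E _ _ _ hn T
    have : Nontrivial E := Module.nontrivial_of_finrank_pos (R := ℂ) (by omega)
    obtain ⟨μ, hμ⟩ := Module.End.exists_eigenvalue (LinearMap.adjoint T)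
    obtain ⟨w₀, hw₀⟩ := hμ.exists_hasEigenvector
    have hw0 : w₀ ≠ 0 := hw₀.2
    obtain ⟨w, hw, hwμ⟩ : ∃ w : E, ‖w‖ = 1 ∧ LinearMap.adjoint T w = μ • w := by
      refine ⟨((‖w₀‖⁻¹ : ℝ) : ℂ) • w₀, ?_, ?_⟩
      · rw [norm_smul]; simp [hw0]
      · rw [map_smul, hw₀.apply_eq_smul, smul_comm]
    have hwne : w ≠ 0 := by rintro rfl; simp at hw
    set W : Submodule ℂ E := (ℂ ∙ w)ᗮ with hW
    have hmem : ∀ x, x ∈ W ↔ ⟪w, x⟫_ℂ = 0 := fun x =>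
      Submodule.mem_orthogonal_singleton_iff_inner_right
    have hinv : ∀ x ∈ W, T x ∈ W := by
      intro x hx
      rw [hmem] at hx ⊢
      rw [← LinearMap.adjoint_inner_left, hwμ, inner_smul_left, hx, mul_zero]
    have hfin : Module.finrank ℂ W = n := by
      have : Fact (Module.finrank ℂ E = n + 1) := ⟨hn⟩
      exact Submodule.finrank_orthogonal_span_singleton hwne
    obtain ⟨b', hb'⟩ := ih W hfin (T.restrict hinv)
    let e : Fin (n + 1) → E := Fin.snoc (fun i => (b' i : E)) w
    have e_last : e (Fin.last n) = w := Fin.snoc_last _ _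
    have e_cast : ∀ i : Fin n, e i.castSucc = b' i := fun i => Fin.snoc_castSucc _ _ _
    have horth : Orthonormal ℂ e := by
      rw [orthonormal_iff_ite]
      intro i j
      induction i using Fin.lastCases with
      | last =>
        induction j using Fin.lastCases with
        | last => simp [e_last, hw, inner_self_eq_norm_sq_to_K]
        | cast j =>
          rw [e_last, e_cast, (hmem _).1 (b' j).2, if_neg (Fin.castSucc_lt_last j).ne']
      | cast i =>
        induction j using Fin.lastCases with
        | last =>
          rw [e_last, e_cast, if_neg (Fin.castSucc_lt_last i).ne, ← inner_conj_symm,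
            (hmem _).1 (b' i).2, map_zero]
        | cast j =>
          rw [e_cast, e_cast, ← Submodule.coe_inner, orthonormal_iff_ite.1 b'.orthonormal i j]
          simp
    let B := basisOfOrthonormalOfCardEqFinrank horth (by simp [hn])
    have hB : ⇑B = e := coe_basisOfOrthonormalOfCardEqFinrank horth _
    refine ⟨B.toOrthonormalBasis (hB ▸ horth), ?_⟩
    intro i j hij
    simp only [Module.Basis.coe_toOrthonormalBasis, hB]
    induction j using Fin.lastCases with
    | last => exact absurd hij (Fin.le_last i).not_gt
    | cast j =>
      induction i using Fin.lastCases with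
      | last => rw [e_last, e_cast]; exact (hmem _).1 (hinv _ (b' j).2)
      | cast i =>
        rw [e_cast, e_cast]
        exact hb' i j (by simpa using hij)

/-- Schur triangularization, as a statement on the spectrum. -/
theorem exists_orthonormalBasis_charpoly_roots {E : Type} [NormedAddCommGroup E]
    [InnerProductSpace ℂ E] [FiniteDimensional ℂ E] (T : E →ₗ[ℂ] E) :
    ∃ b : OrthonormalBasis (Fin (Module.finrank ℂ E)) ℂ E,
      T.charpoly.roots = Finset.univ.val.map fun i => ⟪b i, T (b i)⟫_ℂ := by
  obtain ⟨b, hb⟩ := exists_orthonormalBasis_inner_eq_zero_of_lt _ E rfl T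
  refine ⟨b, ?_⟩
  have happ : ∀ i j, LinearMap.toMatrix b.toBasis b.toBasis T i j = ⟪b i, T (b j)⟫_ℂ := by
    intro i j
    rw [LinearMap.toMatrix_apply]
    simp [OrthonormalBasis.repr_apply_apply]
  rw [← LinearMap.charpoly_toMatrix T b.toBasis, Matrix.charpoly_of_isUpperTriangular]
  · simp_rw [happ]
    have := Polynomial.roots_multiset_prod_X_sub_C (Finset.univ.val.map fun i => ⟪b i, T (b i)⟫_ℂ)
    rw [Multiset.map_map] at this
    exact this
  · intro i j hij
    rw [happ]
    exact hb i j hij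

/-- The value `∑ᵢⱼ conj xᵢ Mᵢⱼ xⱼ` of the sesquilinear form of a real matrix. -/
def hform {ι : Type} [Fintype ι] (M : Matrix ι ι ℝ) (x : ι → ℂ) : ℂ :=
  ∑ i, ∑ j, (starRingEnd ℂ) (x i) * (M i j : ℂ) * x j

theorem hform_eq_dotProduct {ι : Type} [Fintype ι] (M : Matrix ι ι ℝ) (x : ι → ℂ) :
    hform M x = star x ⬝ᵥ (M.map (algebraMap ℝ ℂ)).mulVec x := by
  simp [hform, dotProduct, Matrix.mulVec, Finset.mul_sum, mul_assoc]

theorem hform_add {ι : Type} [Fintype ι] (M N : Matrix ι ι ℝ) (x : ι → ℂ) :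
    hform (M + N) x = hform M x + hform N x := by
  simp [hform, mul_add, add_mul, Finset.sum_add_distrib]

theorem hform_sub {ι : Type} [Fintype ι] (M N : Matrix ι ι ℝ) (x : ι → ℂ) :
    hform (M - N) x = hform M x - hform N x := by
  simp [hform, mul_sub, sub_mul, Finset.sum_sub_distrib]

theorem hform_im_of_symm {ι : Type} [Fintype ι] (M : Matrix ι ι ℝ) (hM : M.IsSymm) (x : ι → ℂ) :
    (hform M x).im = 0 := by
  rw [← Complex.conj_eq_iff_im]
  unfold hform
  simp only [map_sum, map_mul, Complex.conj_conj, Complex.conj_ofReal]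
  rw [Finset.sum_comm]
  refine Finset.sum_congr rfl fun i _ => Finset.sum_congr rfl fun j _ => ?_
  rw [← hM.apply i j]; ring

open scoped ComplexOrder in
theorem posDef_map_of_hform_pos {ι : Type} [Fintype ι] (P : Matrix ι ι ℝ) (hs : P.IsSymm)
    (hpos : ∀ x : ι → ℂ, x ≠ 0 → 0 < (hform P x).re) : (P.map (algebraMap ℝ ℂ)).PosDef := by
  refine Matrix.PosDef.of_dotProduct_mulVec_pos ?_ fun x hx => ?_
  · ext i j
    simp [Matrix.conjTranspose_apply, hs.apply i j]
  · rw [← hform_eq_dotProduct, Complex.pos_iff]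
    exact ⟨hpos x hx, (hform_im_of_symm P hs x).symm⟩

open scoped ComplexOrder MatrixOrder in
/-- For a positive definite `P`, the spectrum of `P⁻¹ A` consists of the values of the form of `A`
on a `P`-orthonormal family. -/
theorem exists_orthonormal_complexEigenvalues {ι : Type} [Fintype ι] [DecidableEq ι]
    (A P : Matrix ι ι ℝ) (hs : P.IsSymm)
    (hpos : ∀ x : ι → ℂ, x ≠ 0 → 0 < (hform P x).re) :
    ∃ (n : ℕ) (q : Fin n → ι → ℂ),
      (∀ i j, star (q i) ⬝ᵥ (P.map (algebraMap ℝ ℂ)).mulVec (q j) = if i = j then 1 else 0) ∧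
      complexEigenvalues (P⁻¹ * A) = Finset.univ.val.map fun i => hform A (q i) := by
  have hP := posDef_map_of_hform_pos P hs hpos
  set Pc := P.map (algebraMap ℝ ℂ) with hPc
  set Ac := A.map (algebraMap ℝ ℂ) with hAc
  obtain ⟨B, hB⟩ : ∃ B : Matrix ι ι ℂ, Pc = B.conjTranspose * B := by
    have h0 : 0 ≤ Pc := Matrix.nonneg_iff_posSemidef.2 hP.posSemidef
    obtain ⟨B, hB⟩ := CStarAlgebra.nonneg_iff_eq_star_mul_self.1 h0
    exact ⟨B, hB⟩
  have hdet : IsUnit B.det := by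
    have h1 : IsUnit Pc.det := (Matrix.isUnit_iff_isUnit_det _).1 hP.isUnit
    rw [hB, Matrix.det_mul] at h1
    exact isUnit_of_mul_isUnit_right h1
  have hBB : B * B⁻¹ = 1 := Matrix.mul_nonsing_inv _ hdet
  have hinv : (P⁻¹).map (algebraMap ℝ ℂ) = B⁻¹ * B⁻¹.conjTranspose := by
    have h1 : (P⁻¹).map (algebraMap ℝ ℂ) = Pc⁻¹ := by
      have hu : IsUnit P.det := by
        have h1 : IsUnit Pc.det := (Matrix.isUnit_iff_isUnit_det _).1 hP.isUnit
        rw [isUnit_iff_ne_zero] at h1 ⊢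
        intro h0
        apply h1
        have := RingHom.map_det (algebraMap ℝ ℂ) P
        rw [h0, map_zero] at this
        exact this.symm
      symm
      apply Matrix.inv_eq_right_inv
      rw [hPc, ← Matrix.map_mul, Matrix.mul_nonsing_inv _ hu]
      simp
    rw [h1, hB, Matrix.mul_inv_rev, Matrix.conjTranspose_nonsing_inv]
  -- `P⁻¹ A` is similar to `Z`, and `B⁻¹` carries orthonormal to `P`-orthonormal families
  let Z : Matrix ι ι ℂ := B⁻¹.conjTranspose * Ac * B⁻¹
  obtain ⟨b, hb⟩ := exists_orthonormalBasis_charpoly_roots (Matrix.toEuclideanLin Z)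
  have key : ∀ (M : Matrix ι ι ℂ) (i j),
      star (B⁻¹.mulVec (b i).ofLp) ⬝ᵥ M.mulVec (B⁻¹.mulVec (b j).ofLp) =
        star (b i).ofLp ⬝ᵥ (B⁻¹.conjTranspose * M * B⁻¹).mulVec (b j).ofLp := by
    intro M i j
    rw [Matrix.star_mulVec, ← Matrix.dotProduct_mulVec, Matrix.mulVec_mulVec, Matrix.mulVec_mulVec,
      Matrix.mul_assoc]
  refine ⟨_, fun i => B⁻¹.mulVec (b i).ofLp, ?_, ?_⟩
  · intro i j
    rw [key, hB]
    have e1 : B⁻¹.conjTranspose * (B.conjTranspose * B) * B⁻¹ = 1 := by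
      rw [← Matrix.mul_assoc, ← Matrix.conjTranspose_mul, hBB, Matrix.mul_assoc, hBB]
      simp
    rw [e1, Matrix.one_mulVec, ← orthonormal_iff_ite.1 b.orthonormal i j,
      EuclideanSpace.inner_eq_star_dotProduct, dotProduct_comm]
  · have e2 : complexEigenvalues (P⁻¹ * A) = Z.charpoly.roots := by
      unfold complexEigenvalues
      rw [Matrix.map_mul, hinv, Matrix.mul_assoc, Matrix.charpoly_mul_comm]
    have e3 : (Matrix.toEuclideanLin Z).charpoly = Z.charpoly := by
      rw [Matrix.toEuclideanLin_eq_toLin_orthonormal, ← LinearMap.charpoly_toMatrix _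
        (EuclideanSpace.basisFun ι ℂ).toBasis, LinearMap.toMatrix_toLin]
    rw [e2, ← e3, hb]
    refine Multiset.map_congr rfl fun i _ => ?_
    rw [hform_eq_dotProduct, key, EuclideanSpace.inner_eq_star_dotProduct, dotProduct_comm]
    rfl

/-- Bessel's inequality for a `P`-orthonormal family and a functional bounded in the `P`-norm. -/
theorem sum_norm_sq_le_of_orthonormal {ι : Type} [Fintype ι] (P : Matrix ι ι ℝ) {n : ℕ}
    (q : Fin n → ι → ℂ)
    (hq : ∀ i j, star (q i) ⬝ᵥ (P.map (algebraMap ℝ ℂ)).mulVec (q j) = if i = j then 1 else 0)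
    (ℓ : (ι → ℂ) →ₗ[ℂ] ℂ) (S : ℝ) (hS : 0 ≤ S)
    (hℓ : ∀ x, ‖ℓ x‖ ^ 2 ≤ S * (hform P x).re)
    (F : Finset (Fin n)) : ∑ i ∈ F, ‖ℓ (q i)‖ ^ 2 ≤ S := by
  set s := ∑ i ∈ F, ‖ℓ (q i)‖ ^ 2 with hs
  -- test the functional on the vector that represents it on the span of the family
  set x : ι → ℂ := ∑ i ∈ F, (starRingEnd ℂ) (ℓ (q i)) • q i with hx
  have h1 : ℓ x = (s : ℂ) := by
    rw [hx, map_sum, hs]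
    push_cast
    refine Finset.sum_congr rfl fun i _ => ?_
    rw [map_smul, smul_eq_mul, Complex.conj_mul']
  have h2 : hform P x = (s : ℂ) := by
    rw [hform_eq_dotProduct, hx, star_sum, Matrix.mulVec_sum, sum_dotProduct, hs]
    push_cast
    refine Finset.sum_congr rfl fun i hi => ?_
    rw [dotProduct_sum, Finset.sum_eq_single i]
    · rw [Matrix.mulVec_smul, star_smul, smul_dotProduct, dotProduct_smul, hq, if_pos rfl]
      simp [Complex.mul_conj']
    · intro j _ hj
      rw [Matrix.mulVec_smul, star_smul, smul_dotProduct, dotProduct_smul, hq, if_neg hj.symm]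
      simp
    · exact fun h => absurd hi h
  have h3 := hℓ x
  have hs0 : 0 ≤ s := Finset.sum_nonneg fun i _ => sq_nonneg _
  rw [h1, h2, Complex.norm_real, Complex.ofReal_re, Real.norm_eq_abs, sq_abs] at h3
  rcases hs0.eq_or_lt with h0 | h0
  · exact h0 ▸ hS
  · nlinarith

open Classical in
/-- If the form of `A - P` is controlled by a quadratic quantity `N` that is `P`-small up to
finitely many `P`-bounded functionals, then the number of eigenvalues of `P⁻¹ A` away from `1` is
controlled by the number of functionals: an eigenvalue off the disk contributes at least `ε ^ 2`,
whereas by Bessel's inequality the functionals contribute a bounded amount altogether. -/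
theorem card_eigenvalues_notMem_ball_le {ι : Type} [Fintype ι] [DecidableEq ι]
    (A P : Matrix ι ι ℝ) (hs : P.IsSymm) (hpos : ∀ x : ι → ℂ, x ≠ 0 → 0 < (hform P x).re)
    {β : Type} [Fintype β] (ℓ : β → (ι → ℂ) →ₗ[ℂ] ℂ) (N : (ι → ℂ) → ℝ) {c δ S ε : ℝ}
    (hc : 0 ≤ c) (hS : 0 ≤ S) (hε : 0 < ε) (hδ : c * δ ≤ ε ^ 2 / 2)
    (h1 : ∀ x, ‖hform (A - P) x‖ ^ 2 ≤ c * N x * (hform P x).re)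
    (h2 : ∀ x, N x ≤ δ * (hform P x).re + ∑ b, ‖ℓ b x‖ ^ 2)
    (h3 : ∀ b x, ‖ℓ b x‖ ^ 2 ≤ S * (hform P x).re) :
    (((complexEigenvalues (P⁻¹ * A)).filter fun z => z ∉ Metric.ball (1 : ℂ) ε).card : ℝ) ≤
      2 * c * (Fintype.card β * S) / ε ^ 2 := by
  obtain ⟨n, q, hq, hev⟩ := exists_orthonormal_complexEigenvalues A P hs hpos
  have hq1 : ∀ i, hform P (q i) = 1 := fun i => by rw [hform_eq_dotProduct, hq, if_pos rfl]
  rw [hev, Multiset.filter_map, Multiset.card_map]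
  set F : Finset (Fin n) :=
    Finset.univ.filter fun i => hform A (q i) ∉ Metric.ball (1 : ℂ) ε with hF
  have hcard : (Multiset.filter ((fun z => z ∉ Metric.ball (1 : ℂ) ε) ∘ fun i => hform A (q i))
      (Finset.univ : Finset (Fin n)).val).card = F.card := rfl
  rw [hcard, le_div_iff₀ (by positivity)]
  have hF1 : ∀ i ∈ F, ε ^ 2 ≤ c * N (q i) := by
    intro i hi
    have h4 := h1 (q i)
    rw [hform_sub, hq1, Complex.one_re, mul_one] at h4
    have h5 : ε ≤ ‖hform A (q i) - 1‖ := by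
      have := (Finset.mem_filter.1 hi).2
      rwa [Metric.mem_ball, not_lt, Complex.dist_eq] at this
    nlinarith
  have hF2 : ∑ i ∈ F, ∑ b, ‖ℓ b (q i)‖ ^ 2 ≤ Fintype.card β * S := by
    rw [Finset.sum_comm]
    refine (Finset.sum_le_sum fun b _ =>
      sum_norm_sq_le_of_orthonormal P q hq (ℓ b) S hS (h3 b) F).trans ?_
    simp
  have hF3 : ∑ i ∈ F, ε ^ 2 ≤ ∑ i ∈ F, (c * δ + c * ∑ b, ‖ℓ b (q i)‖ ^ 2) := by
    refine Finset.sum_le_sum fun i hi => (hF1 i hi).trans ?_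
    have h4 := h2 (q i)
    rw [hq1, Complex.one_re, mul_one] at h4
    nlinarith
  rw [Finset.sum_add_distrib] at hF3
  simp only [Finset.sum_const, nsmul_eq_mul] at hF3
  have h6 : (F.card : ℝ) * (c * δ) ≤ F.card * (ε ^ 2 / 2) := by gcongr
  have h7 := mul_le_mul_of_nonneg_left hF2 hc
  rw [Finset.mul_sum] at h7
  linarith

theorem exists_eq_hform_of_mem_complexEigenvalues {ι : Type} [Fintype ι] [DecidableEq ι]
    (A P : Matrix ι ι ℝ) (hs : P.IsSymm) (hpos : ∀ x : ι → ℂ, x ≠ 0 → 0 < (hform P x).re)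
    {z : ℂ} (hz : z ∈ complexEigenvalues (P⁻¹ * A)) :
    ∃ x : ι → ℂ, hform P x = 1 ∧ z = hform A x := by
  obtain ⟨n, q, hq, hev⟩ := exists_orthonormal_complexEigenvalues A P hs hpos
  rw [hev, Multiset.mem_map] at hz
  obtain ⟨i, _, hi⟩ := hz
  exact ⟨q i, by rw [hform_eq_dotProduct, hq, if_pos rfl], hi.symm⟩

theorem card_complexEigenvalues_le {ι : Type} [Fintype ι] [DecidableEq ι] (X : Matrix ι ι ℝ) :
    (complexEigenvalues X).card ≤ Fintype.card ι := by
  unfold complexEigenvalues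
  exact (Polynomial.card_roots' _).trans (Matrix.charpoly_natDegree_eq_dim _).le

/-! ### Lattice functions and assembled matrices -/

/-- The extension by zero of a vector of inner nodal values to the whole lattice. -/
def zeroExt (s : Finset (ℤ × ℤ)) (x : s → ℂ) (p : ℤ × ℤ) : ℂ := if h : p ∈ s then x ⟨p, h⟩ else 0

theorem zeroExt_coe (s : Finset (ℤ × ℤ)) (x : s → ℂ) (p : s) : zeroExt s x p = x p := by
  simp [zeroExt]

theorem zeroExt_of_notMem {s : Finset (ℤ × ℤ)} (x : s → ℂ) {p : ℤ × ℤ} (h : p ∉ s) :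
    zeroExt s x p = 0 := dif_neg h

theorem zeroExt_add (s : Finset (ℤ × ℤ)) (x y : s → ℂ) (p : ℤ × ℤ) :
    zeroExt s (x + y) p = zeroExt s x p + zeroExt s y p := by
  unfold zeroExt; split_ifs <;> simp

theorem zeroExt_smul (s : Finset (ℤ × ℤ)) (c : ℂ) (x : s → ℂ) (p : ℤ × ℤ) :
    zeroExt s (c • x) p = c * zeroExt s x p := by
  unfold zeroExt; split_ifs <;> simp

theorem sum_ite_mul_eq_zeroExt (s : Finset (ℤ × ℤ)) (x : s → ℂ) (p : ℤ × ℤ) :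
    ∑ i : s, (if p = i then x i else 0) = zeroExt s x p := by
  by_cases h : p ∈ s
  · rw [Finset.sum_eq_single ⟨p, h⟩]
    · simp [zeroExt, h]
    · intro i _ hi
      rw [if_neg]
      rintro rfl
      exact hi rfl
    · simp
  · rw [zeroExt_of_notMem x h]
    refine Finset.sum_eq_zero fun i _ => if_neg ?_
    rintro rfl
    exact h i.2

/-- The global matrix on the inner nodes `s`, assembled from the element matrices `c K` of the
triangles `K`. -/
def assemble (s : Finset (ℤ × ℤ)) (cells : Finset Cell) (c : Cell → Fin 3 → Fin 3 → ℝ) :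
    Matrix s s ℝ :=
  Matrix.of fun i j => ∑ K ∈ cells, ∑ k, ∑ l,
    (if K.vertex k = i then 1 else 0) * (if K.vertex l = j then 1 else 0) * c K k l

theorem hform_assemble (s : Finset (ℤ × ℤ)) (cells : Finset Cell) (c : Cell → Fin 3 → Fin 3 → ℝ)
    (x : s → ℂ) : hform (assemble s cells c) x = ∑ K ∈ cells, ∑ k, ∑ l,
      (starRingEnd ℂ) (zeroExt s x (K.vertex k)) * c K k l * zeroExt s x (K.vertex l) := by
  have h1 : ∀ i j : s, (starRingEnd ℂ) (x i) * (assemble s cells c i j : ℂ) * x j =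
      ∑ K ∈ cells, ∑ k, ∑ l, (starRingEnd ℂ) (if K.vertex k = i then x i else 0) * c K k l *
        (if K.vertex l = j then x j else 0) := by
    intro i j
    simp only [assemble, Matrix.of_apply]
    push_cast
    simp only [Finset.mul_sum, Finset.sum_mul]
    refine Finset.sum_congr rfl fun K _ => Finset.sum_congr rfl fun k _ =>
      Finset.sum_congr rfl fun l _ => ?_
    split_ifs <;> simp
  unfold hform
  simp only [h1]
  have h2 : ∀ i : s, ∑ j : s, ∑ K ∈ cells, ∑ k, ∑ l,
      (starRingEnd ℂ) (if K.vertex k = i then x i else 0) * c K k l *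
        (if K.vertex l = j then x j else 0) = ∑ K ∈ cells, ∑ k, ∑ l,
      (starRingEnd ℂ) (if K.vertex k = i then x i else 0) * c K k l *
        zeroExt s x (K.vertex l) := by
    intro i
    rw [Finset.sum_comm]
    refine Finset.sum_congr rfl fun K _ => ?_
    rw [Finset.sum_comm]
    refine Finset.sum_congr rfl fun k _ => ?_
    rw [Finset.sum_comm]
    refine Finset.sum_congr rfl fun l _ => ?_
    rw [← Finset.mul_sum, sum_ite_mul_eq_zeroExt]
  simp only [h2]
  rw [Finset.sum_comm]
  refine Finset.sum_congr rfl fun K _ => ?_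
  rw [Finset.sum_comm]
  refine Finset.sum_congr rfl fun k _ => ?_
  rw [Finset.sum_comm]
  refine Finset.sum_congr rfl fun l _ => ?_
  rw [← Finset.sum_mul, ← Finset.sum_mul, ← map_sum, sum_ite_mul_eq_zeroExt]

/-- The coefficients, with respect to the three vertices, of the difference along the edge in
direction `u` of a triangle of the given type. -/
def edgeU (t : Bool) : Fin 3 → ℝ := if t then ![0, -1, 1] else ![-1, 1, 0]

/-- The coefficients of the difference along the edge in direction `v`. -/
def edgeV (t : Bool) : Fin 3 → ℝ := if t then ![-1, 1, 0] else ![0, -1, 1]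

/-- The difference of a lattice function along the edge in direction `u` of a triangle. -/
def diffU (f : ℤ × ℤ → ℂ) (K : Cell) : ℂ := ∑ k, (edgeU K.2 k : ℂ) * f (K.vertex k)

/-- The difference of a lattice function along the edge in direction `v` of a triangle. -/
def diffV (f : ℤ × ℤ → ℂ) (K : Cell) : ℂ := ∑ k, (edgeV K.2 k : ℂ) * f (K.vertex k)

theorem diffU_false (f : ℤ × ℤ → ℂ) (p : ℤ × ℤ) : diffU f (p, false) = f (p + (1, 0)) - f p := by
  simp [diffU, edgeU, Cell.vertex, Fin.sum_univ_three]; ring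

theorem diffV_true (f : ℤ × ℤ → ℂ) (p : ℤ × ℤ) : diffV f (p, true) = f (p + (0, 1)) - f p := by
  simp [diffV, edgeV, Cell.vertex, Fin.sum_univ_three]; ring

/-- The discrete Dirichlet energy. -/
def gridEnergy (cells : Finset Cell) (f : ℤ × ℤ → ℂ) : ℝ :=
  ∑ K ∈ cells, (‖diffU f K‖ ^ 2 + ‖diffV f K‖ ^ 2)

theorem gridEnergy_nonneg (cells : Finset Cell) (f : ℤ × ℤ → ℂ) : 0 ≤ gridEnergy cells f :=
  Finset.sum_nonneg fun _ _ => by positivity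

/-- The squared Euclidean norm, without the factor `m⁻²` that makes it comparable with the squared
`L²` norm of the finite element function. -/
def normSqSum {ι : Type} [Fintype ι] (x : ι → ℂ) : ℝ := ∑ i, ‖x i‖ ^ 2

theorem normSqSum_nonneg {ι : Type} [Fintype ι] (x : ι → ℂ) : 0 ≤ normSqSum x :=
  Finset.sum_nonneg fun _ _ => by positivity

theorem vertex_injective_of_type {K K' : Cell} (k : Fin 3) (ht : K.2 = K'.2)
    (h : K.vertex k = K'.vertex k) : K = K' := by
  obtain ⟨p, t⟩ := K
  obtain ⟨p', t'⟩ := K'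
  simp only at ht
  subst ht
  have : p = p' := by
    fin_cases k <;> cases t <;> simpa [Cell.vertex] using h
  rw [this]

/-- Every node is the `k`-th vertex of at most one triangle of each of the two types. -/
theorem sum_cells_vertex_le (s : Finset (ℤ × ℤ)) (cells : Finset Cell) (x : s → ℂ) (k : Fin 3) :
    ∑ K ∈ cells, ‖zeroExt s x (K.vertex k)‖ ^ 2 ≤ 2 * normSqSum x := by
  have h1 : ∀ p, ‖zeroExt s x p‖ ^ 2 = ∑ i : s, if p = i then ‖x i‖ ^ 2 else 0 := by
    intro p
    by_cases h : p ∈ s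
    · rw [Finset.sum_eq_single ⟨p, h⟩]
      · simp [zeroExt, h]
      · intro i _ hi
        rw [if_neg]
        rintro rfl
        exact hi rfl
      · simp
    · rw [zeroExt_of_notMem x h, Finset.sum_eq_zero]
      · simp
      · rintro i -
        apply if_neg
        rintro rfl
        exact h i.2
  simp only [h1]
  rw [Finset.sum_comm, normSqSum, Finset.mul_sum]
  refine Finset.sum_le_sum fun i _ => ?_
  rw [← Finset.sum_filter, Finset.sum_const, nsmul_eq_mul]
  have hcard : (cells.filter fun K => K.vertex k = (i : ℤ × ℤ)).card ≤ 2 := by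
    have : (cells.filter fun K => K.vertex k = (i : ℤ × ℤ)).card ≤
        (Finset.univ : Finset Bool).card := by
      refine Finset.card_le_card_of_injOn (fun K => K.2)
        (fun _ _ => Finset.mem_coe.2 (Finset.mem_univ _)) ?_
      intro K hK K' hK' ht
      have e1 := (Finset.mem_filter.1 hK).2
      have e2 := (Finset.mem_filter.1 hK').2
      exact vertex_injective_of_type k ht (e1.trans e2.symm)
    simpa using this
  have hcard' : ((cells.filter fun K => K.vertex k = (i : ℤ × ℤ)).card : ℝ) ≤ 2 := by
    exact_mod_cast hcard
  gcongr

/-! ### Discrete Poincaré inequalities -/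

theorem norm_sub_sq_le_mul_sum (g : ℕ → ℂ) {L i j : ℕ} (hi : i < L) (hj : j < L) :
    ‖g i - g j‖ ^ 2 ≤ L * ∑ k ∈ Finset.range L, ‖g (k + 1) - g k‖ ^ 2 := by
  wlog hij : j ≤ i generalizing i j
  · rw [norm_sub_rev]
    exact this hj hi (by omega)
  have h1 : ‖g i - g j‖ ≤ ∑ k ∈ Finset.range L, ‖g (k + 1) - g k‖ := by
    rw [← Finset.sum_Ico_sub g hij]
    refine (norm_sum_le _ _).trans
      (Finset.sum_le_sum_of_subset_of_nonneg ?_ fun _ _ _ => norm_nonneg _)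
    intro k hk
    have := Finset.mem_Ico.1 hk
    exact Finset.mem_range.2 (by omega)
  calc ‖g i - g j‖ ^ 2 ≤ (∑ k ∈ Finset.range L, ‖g (k + 1) - g k‖) ^ 2 := by gcongr
    _ ≤ (Finset.range L).card * ∑ k ∈ Finset.range L, ‖g (k + 1) - g k‖ ^ 2 :=
      sq_sum_le_card_mul_sum_sq
    _ = _ := by rw [Finset.card_range]

/-- Poincaré's inequality on a square block of side `L`. The block sum is scaled by `1 / L` so that
it is bounded by the Euclidean norm. The differences on the right also reach one layer beyond the
block. -/
theorem sum_block_norm_sq_le (g : ℕ → ℕ → ℂ) {L : ℕ} (hL : 0 < L) :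
    ∑ i ∈ Finset.range L, ∑ j ∈ Finset.range L, ‖g i j‖ ^ 2 ≤
      4 * L ^ 2 * (∑ i ∈ Finset.range L, ∑ j ∈ Finset.range L,
        (‖g (i + 1) j - g i j‖ ^ 2 + ‖g i (j + 1) - g i j‖ ^ 2)) +
      2 * ‖(∑ i ∈ Finset.range L, ∑ j ∈ Finset.range L, g i j) / L‖ ^ 2 := by
  set U : ℕ → ℝ := fun j => ∑ k ∈ Finset.range L, ‖g (k + 1) j - g k j‖ ^ 2 with hU
  set V : ℕ → ℝ := fun i => ∑ k ∈ Finset.range L, ‖g i (k + 1) - g i k‖ ^ 2 with hV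
  set S : ℂ := ∑ i ∈ Finset.range L, ∑ j ∈ Finset.range L, g i j with hS
  set SU : ℝ := ∑ j ∈ Finset.range L, U j with hSU
  set SV : ℝ := ∑ i ∈ Finset.range L, V i with hSV
  have hLr : (0 : ℝ) < L := by exact_mod_cast hL
  -- two points of the block are joined by a path along the row `i` and then the column `p.2`
  have hpt : ∀ i ∈ Finset.range L, ∀ j ∈ Finset.range L,
      ‖(L : ℂ) ^ 2 * g i j - S‖ ^ 2 ≤ 2 * L ^ 3 * (L ^ 2 * V i + L * SU) := by
    intro i hi j hj
    have e1 : (L : ℂ) ^ 2 * g i j - S =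
        ∑ p ∈ Finset.range L ×ˢ Finset.range L, (g i j - g p.1 p.2) := by
      rw [Finset.sum_sub_distrib, Finset.sum_const, Finset.card_product, Finset.card_range,
        Finset.sum_product, nsmul_eq_mul]
      push_cast; ring
    have e2 : ∀ p ∈ Finset.range L ×ˢ Finset.range L,
        ‖g i j - g p.1 p.2‖ ^ 2 ≤ 2 * L * (V i + U p.2) := by
      intro p hp
      obtain ⟨hp1, hp2⟩ := Finset.mem_product.1 hp
      have a1 := norm_sub_sq_le_mul_sum (g i) (Finset.mem_range.1 hj) (Finset.mem_range.1 hp2)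
      have a2 := norm_sub_sq_le_mul_sum (fun k => g k p.2) (Finset.mem_range.1 hi)
        (Finset.mem_range.1 hp1)
      have a3 : ‖g i j - g p.1 p.2‖ ≤ ‖g i j - g i p.2‖ + ‖g i p.2 - g p.1 p.2‖ :=
        norm_sub_le_norm_sub_add_norm_sub _ _ _
      have a4 : ‖g i j - g p.1 p.2‖ ^ 2 ≤ (‖g i j - g i p.2‖ + ‖g i p.2 - g p.1 p.2‖) ^ 2 := by
        gcongr
      change _ ≤ (L : ℝ) * U p.2 at a2
      change _ ≤ (L : ℝ) * V i at a1
      nlinarith [sq_nonneg (‖g i j - g i p.2‖ - ‖g i p.2 - g p.1 p.2‖)]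
    rw [e1]
    calc ‖∑ p ∈ Finset.range L ×ˢ Finset.range L, (g i j - g p.1 p.2)‖ ^ 2
        ≤ (∑ p ∈ Finset.range L ×ˢ Finset.range L, ‖g i j - g p.1 p.2‖) ^ 2 := by
          gcongr; exact norm_sum_le _ _
      _ ≤ (Finset.range L ×ˢ Finset.range L).card *
          ∑ p ∈ Finset.range L ×ˢ Finset.range L, ‖g i j - g p.1 p.2‖ ^ 2 :=
          sq_sum_le_card_mul_sum_sq
      _ ≤ (Finset.range L ×ˢ Finset.range L).card *
          ∑ p ∈ Finset.range L ×ˢ Finset.range L, 2 * L * (V i + U p.2) := by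
          gcongr with p hp; exact e2 p hp
      _ = 2 * L ^ 3 * (L ^ 2 * V i + L * SU) := by
          rw [Finset.card_product, Finset.card_range, ← Finset.mul_sum, Finset.sum_product]
          simp only [Finset.sum_add_distrib, Finset.sum_const, Finset.card_range, nsmul_eq_mul,
            ← hSU]
          push_cast; ring
  have hpt2 : ∀ i ∈ Finset.range L, ∀ j ∈ Finset.range L,
      ‖g i j‖ ^ 2 ≤ 4 / L ^ 1 * (L ^ 2 * V i + L * SU) + 2 / L ^ 2 * ‖S / L‖ ^ 2 := by
    intro i hi j hj
    have h1 := hpt i hi j hj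
    have h2 : ‖(L : ℂ) ^ 2 * g i j‖ ≤ ‖(L : ℂ) ^ 2 * g i j - S‖ + ‖S‖ := by
      have := norm_add_le ((L : ℂ) ^ 2 * g i j - S) S
      rwa [sub_add_cancel] at this
    have h3 : ‖(L : ℂ) ^ 2 * g i j‖ = L ^ 2 * ‖g i j‖ := by simp
    have h4 : (L ^ 2 * ‖g i j‖) ^ 2 ≤ 2 * (2 * L ^ 3 * (L ^ 2 * V i + L * SU)) + 2 * ‖S‖ ^ 2 := by
      rw [← h3]
      have : ‖(L : ℂ) ^ 2 * g i j‖ ^ 2 ≤ (‖(L : ℂ) ^ 2 * g i j - S‖ + ‖S‖) ^ 2 := by gcongr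
      nlinarith [sq_nonneg (‖(L : ℂ) ^ 2 * g i j - S‖ - ‖S‖)]
    have h5 : ‖S / L‖ = ‖S‖ / L := by simp
    rw [h5]
    have h6 : 4 / (L : ℝ) ^ 1 * (L ^ 2 * V i + L * SU) + 2 / L ^ 2 * (‖S‖ / L) ^ 2 =
        (2 * (2 * L ^ 3 * (L ^ 2 * V i + L * SU)) + 2 * ‖S‖ ^ 2) / L ^ 4 := by
      field_simp; ring
    rw [h6, le_div_iff₀ (by positivity)]
    calc ‖g i j‖ ^ 2 * L ^ 4 = (L ^ 2 * ‖g i j‖) ^ 2 := by ring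
      _ ≤ _ := h4
  calc _ ≤ ∑ i ∈ Finset.range L, ∑ j ∈ Finset.range L,
        (4 / (L : ℝ) ^ 1 * (L ^ 2 * V i + L * SU) + 2 / L ^ 2 * ‖S / L‖ ^ 2) :=
        Finset.sum_le_sum fun i hi => Finset.sum_le_sum fun j hj => hpt2 i hi j hj
    _ = 4 * L ^ 2 * (SU + SV) + 2 * ‖S / L‖ ^ 2 := by
        simp only [Finset.sum_const, Finset.card_range, nsmul_eq_mul, mul_add,
          Finset.sum_add_distrib, ← Finset.mul_sum, ← hSV]
        field_simp
        ring
    _ = _ := by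
        congr 2
        rw [hSU, hSV, hU, hV, Finset.sum_comm]
        simp only [← Finset.sum_add_distrib]

/-- The lattice point with the coordinates `i`, `j`, counted from the corner `(-m - 1, -m - 1)` just
outside of the square of radius `m`: lattice functions supported in that square vanish there. -/
def gridPoint (m i j : ℕ) : ℤ × ℤ := (-(m : ℤ) - 1 + i, -(m : ℤ) - 1 + j)

theorem sum_grid_eq (s : Finset (ℤ × ℤ)) {m n : ℕ} (hn : 2 * m + 2 ≤ n)
    (hbox : ∀ p ∈ s, |p.1| ≤ m ∧ |p.2| ≤ m) (F : ℤ × ℤ → ℝ) (hF : ∀ p ∉ s, F p = 0) :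
    ∑ i ∈ Finset.range n, ∑ j ∈ Finset.range n, F (gridPoint m i j) = ∑ p ∈ s, F p := by
  rw [← Finset.sum_product']
  symm
  refine Finset.sum_bij_ne_zero (fun p _ _ => ((p.1 + m + 1).toNat, (p.2 + m + 1).toNat))
    ?_ ?_ ?_ ?_
  · intro p hp _
    obtain ⟨h1, h2⟩ := hbox p hp
    rw [abs_le] at h1 h2
    simp only [Finset.mem_product, Finset.mem_range]
    omega
  · intro p hp _ q hq _ h
    obtain ⟨h1, h2⟩ := hbox p hp
    obtain ⟨h3, h4⟩ := hbox q hq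
    rw [abs_le] at h1 h2 h3 h4
    simp only [Prod.mk.injEq] at h
    ext <;> omega
  · rintro ⟨i, j⟩ _ hne
    have hs : gridPoint m i j ∈ s := by
      by_contra hc
      exact hne (hF _ hc)
    refine ⟨gridPoint m i j, hs, hne, ?_⟩
    simp only [gridPoint, Prod.mk.injEq]
    omega
  · intro p hp _
    obtain ⟨h1, h2⟩ := hbox p hp
    rw [abs_le] at h1 h2
    congr 1
    ext <;> simp only [gridPoint] <;> omega

/-- The sum over the lattice edges is at most the energy: each edge in direction `u` is assigned to
the triangle of type `false` at its initial point, each edge in direction `v` to the one of type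
`true`, and a triangle that is not in `cells` has no inner vertex. -/
theorem sum_grid_edges_le (s : Finset (ℤ × ℤ)) (cells : Finset Cell)
    (hcells : ∀ K : Cell, ∀ k, K.vertex k ∈ s → K ∈ cells) (m n : ℕ)
    (f : ℤ × ℤ → ℂ) (hf : ∀ p ∉ s, f p = 0) :
    ∑ i ∈ Finset.range n, ∑ j ∈ Finset.range n,
      (‖f (gridPoint m (i + 1) j) - f (gridPoint m i j)‖ ^ 2 +
        ‖f (gridPoint m i (j + 1)) - f (gridPoint m i j)‖ ^ 2) ≤ gridEnergy cells f := by
  set H : Cell → ℝ := fun K => if K.2 then ‖diffV f K‖ ^ 2 else ‖diffU f K‖ ^ 2 with hH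
  have hH0 : ∀ K, 0 ≤ H K := fun K => by simp only [hH]; split_ifs <;> positivity
  have hHcells : ∀ K, H K ≠ 0 → K ∈ cells := by
    intro K hK
    by_contra hc
    have : ∀ k, f (K.vertex k) = 0 := fun k => hf _ fun h => hc (hcells K k h)
    apply hK
    simp [hH, diffU, diffV, this]
  have e : ∀ i j, ‖f (gridPoint m (i + 1) j) - f (gridPoint m i j)‖ ^ 2 +
        ‖f (gridPoint m i (j + 1)) - f (gridPoint m i j)‖ ^ 2 =
        ∑ t : Bool, H (gridPoint m i j, t) := by
    intro i j
    have h1 : gridPoint m (i + 1) j = gridPoint m i j + (1, 0) := by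
      simp [gridPoint]; ring
    have h2 : gridPoint m i (j + 1) = gridPoint m i j + (0, 1) := by
      simp [gridPoint]; ring
    simp only [Fintype.sum_bool, hH, if_true, Bool.false_eq_true, if_false, diffU_false,
      diffV_true, h1, h2]
    ring
  simp only [e]
  rw [← Finset.sum_product', ← Finset.sum_product']
  calc ∑ x ∈ (Finset.range n ×ˢ Finset.range n) ×ˢ (Finset.univ : Finset Bool),
        H (gridPoint m x.1.1 x.1.2, x.2)
      = ∑ K ∈ ((Finset.range n ×ˢ Finset.range n) ×ˢ (Finset.univ : Finset Bool)).image
        (fun x => (gridPoint m x.1.1 x.1.2, x.2)), H K := by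
        rw [Finset.sum_image]
        rintro ⟨⟨i, j⟩, t⟩ _ ⟨⟨i', j'⟩, t'⟩ _ h
        simpa [gridPoint] using h
    _ = ∑ K ∈ (((Finset.range n ×ˢ Finset.range n) ×ˢ (Finset.univ : Finset Bool)).image
        (fun x => (gridPoint m x.1.1 x.1.2, x.2))).filter (fun K => H K ≠ 0), H K :=
        (Finset.sum_filter_ne_zero _).symm
    _ ≤ ∑ K ∈ cells, H K := by
        refine Finset.sum_le_sum_of_subset_of_nonneg ?_ fun K _ _ => hH0 K
        intro K hK
        exact hHcells K (Finset.mem_filter.1 hK).2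
    _ ≤ gridEnergy cells f := by
        refine Finset.sum_le_sum fun K _ => ?_
        simp only [hH]
        split_ifs
        · linarith [sq_nonneg ‖diffU f K‖]
        · linarith [sq_nonneg ‖diffV f K‖]

theorem normSqSum_eq_sum_grid (s : Finset (ℤ × ℤ)) {m n : ℕ} (hn : 2 * m + 2 ≤ n)
    (hbox : ∀ p ∈ s, |p.1| ≤ m ∧ |p.2| ≤ m) (x : s → ℂ) :
    ∑ i ∈ Finset.range n, ∑ j ∈ Finset.range n, ‖zeroExt s x (gridPoint m i j)‖ ^ 2 =
      normSqSum x := by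
  rw [sum_grid_eq s hn hbox (fun p => ‖zeroExt s x p‖ ^ 2)
    fun p hp => by simp [zeroExt_of_notMem x hp], ← Finset.sum_coe_sort]
  simp [normSqSum, zeroExt_coe]

/-- The discrete Poincaré–Friedrichs inequality. -/
theorem normSqSum_le_mul_gridEnergy (s : Finset (ℤ × ℤ)) (cells : Finset Cell) {m : ℕ}
    (hbox : ∀ p ∈ s, |p.1| ≤ m ∧ |p.2| ≤ m)
    (hcells : ∀ K : Cell, ∀ k, K.vertex k ∈ s → K ∈ cells) (x : s → ℂ) :
    normSqSum x ≤ (2 * m + 2) ^ 2 * gridEnergy cells (zeroExt s x) := by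
  set f := zeroExt s x with hf
  have h1 := sum_grid_edges_le s cells hcells m (2 * m + 2) f fun p hp => zeroExt_of_notMem x hp
  rw [← normSqSum_eq_sum_grid s le_rfl hbox x]
  have h0 : ∀ j, f (gridPoint m 0 j) = 0 := by
    intro j
    refine zeroExt_of_notMem x fun hs => ?_
    have := (hbox _ hs).1
    rw [abs_le] at this
    simp [gridPoint] at this
  have h2 : ∀ i ∈ Finset.range (2 * m + 2), ∀ j ∈ Finset.range (2 * m + 2),
      ‖f (gridPoint m i j)‖ ^ 2 ≤ (2 * m + 2) * ∑ k ∈ Finset.range (2 * m + 2),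
        ‖f (gridPoint m (k + 1) j) - f (gridPoint m k j)‖ ^ 2 := by
    intro i hi j _
    have := norm_sub_sq_le_mul_sum (fun k => f (gridPoint m k j)) (Finset.mem_range.1 hi)
      (Nat.succ_pos _ : 0 < 2 * m + 2)
    simp only [h0, sub_zero] at this
    exact_mod_cast this
  calc _ ≤ ∑ i ∈ Finset.range (2 * m + 2), ∑ j ∈ Finset.range (2 * m + 2),
        ((2 * m + 2 : ℝ) * ∑ k ∈ Finset.range (2 * m + 2),
        ‖f (gridPoint m (k + 1) j) - f (gridPoint m k j)‖ ^ 2) :=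
        Finset.sum_le_sum fun i hi => Finset.sum_le_sum fun j hj => h2 i hi j hj
    _ = (2 * m + 2) ^ 2 * ∑ i ∈ Finset.range (2 * m + 2), ∑ j ∈ Finset.range (2 * m + 2),
        ‖f (gridPoint m (i + 1) j) - f (gridPoint m i j)‖ ^ 2 := by
        rw [Finset.sum_const, Finset.card_range, nsmul_eq_mul, ← Finset.mul_sum, Finset.sum_comm]
        push_cast; ring
    _ ≤ _ := by
        gcongr
        refine le_trans ?_ h1
        gcongr with i _ j _
        linarith [sq_nonneg ‖f (gridPoint m i (j + 1)) - f (gridPoint m i j)‖]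

/-- The scaled sum of the nodal values in the block `b` of side `L`. -/
def blockFunctional (s : Finset (ℤ × ℤ)) (m L : ℕ) {R : ℕ} (b : Fin R × Fin R) :
    (s → ℂ) →ₗ[ℂ] ℂ where
  toFun x := (∑ i ∈ Finset.range L, ∑ j ∈ Finset.range L,
    zeroExt s x (gridPoint m (i + L * b.1) (j + L * b.2))) / L
  map_add' x y := by
    simp only [zeroExt_add, Finset.sum_add_distrib, add_div]
  map_smul' c x := by
    simp only [zeroExt_smul, ← Finset.mul_sum, RingHom.id_apply, smul_eq_mul, mul_div_assoc]

theorem sum_blocks_eq (L R : ℕ) (F : ℕ → ℕ → ℝ) :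
    ∑ b : Fin R × Fin R, ∑ i ∈ Finset.range L, ∑ j ∈ Finset.range L,
      F (i + L * b.1) (j + L * b.2) =
      ∑ i ∈ Finset.range (R * L), ∑ j ∈ Finset.range (R * L), F i j := by
  have h1 : ∀ G : ℕ → ℝ, ∑ b : Fin R, ∑ i ∈ Finset.range L, G (i + L * b) =
      ∑ i ∈ Finset.range (R * L), G i := by
    intro G
    simp only [Finset.sum_range]
    rw [← Fintype.sum_prod_type', ← Equiv.sum_comp finProdFinEquiv]
    rfl
  rw [Fintype.sum_prod_type, ← h1]
  refine Finset.sum_congr rfl fun b _ => ?_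
  rw [Finset.sum_comm]
  refine Finset.sum_congr rfl fun i _ => ?_
  exact h1 fun j => F (i + L * b) j

theorem norm_blockFunctional_sq_le (s : Finset (ℤ × ℤ)) {m L R : ℕ}
    (hn : 2 * m + 2 ≤ R * L) (hbox : ∀ p ∈ s, |p.1| ≤ m ∧ |p.2| ≤ m) (b : Fin R × Fin R)
    (x : s → ℂ) : ‖blockFunctional s m L b x‖ ^ 2 ≤ normSqSum x := by
  have hL : 0 < L := Nat.pos_of_ne_zero fun h => by simp [h] at hn
  have hLr : (0 : ℝ) < L := by exact_mod_cast hL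
  rw [← normSqSum_eq_sum_grid s hn hbox x, ← sum_blocks_eq]
  refine le_trans ?_ (Finset.single_le_sum (f := fun b : Fin R × Fin R =>
    ∑ i ∈ Finset.range L, ∑ j ∈ Finset.range L,
      ‖zeroExt s x (gridPoint m (i + L * b.1) (j + L * b.2))‖ ^ 2)
    (fun _ _ => by positivity) (Finset.mem_univ b))
  simp only [blockFunctional, LinearMap.coe_mk, AddHom.coe_mk]
  rw [norm_div, div_pow, ← Finset.sum_product', ← Finset.sum_product', Complex.norm_natCast,
    div_le_iff₀ (by positivity)]
  refine (pow_le_pow_left₀ (norm_nonneg _) (norm_sum_le _ _) 2).trans ?_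
  refine sq_sum_le_card_mul_sum_sq.trans ?_
  rw [Finset.card_product, Finset.card_range]
  push_cast
  apply le_of_eq; ring

/-- Poincaré's inequality on a tiling by blocks: up to finitely many functionals, the norm is small
compared with the energy. -/
theorem normSqSum_le_blocks (s : Finset (ℤ × ℤ)) (cells : Finset Cell) {m L R : ℕ}
    (hn : 2 * m + 2 ≤ R * L) (hbox : ∀ p ∈ s, |p.1| ≤ m ∧ |p.2| ≤ m)
    (hcells : ∀ K : Cell, ∀ k, K.vertex k ∈ s → K ∈ cells) (x : s → ℂ) :
    normSqSum x ≤ 4 * L ^ 2 * gridEnergy cells (zeroExt s x) +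
      2 * ∑ b : Fin R × Fin R, ‖blockFunctional s m L b x‖ ^ 2 := by
  have hL : 0 < L := Nat.pos_of_ne_zero fun h => by simp [h] at hn
  set f := zeroExt s x with hf
  have h1 := sum_grid_edges_le s cells hcells m (R * L) f fun p hp => zeroExt_of_notMem x hp
  rw [← normSqSum_eq_sum_grid s hn hbox x, ← sum_blocks_eq]
  rw [← sum_blocks_eq L R fun i j => ‖f (gridPoint m (i + 1) j) - f (gridPoint m i j)‖ ^ 2 +
    ‖f (gridPoint m i (j + 1)) - f (gridPoint m i j)‖ ^ 2] at h1
  calc _ ≤ ∑ b : Fin R × Fin R, (4 * (L : ℝ) ^ 2 * (∑ i ∈ Finset.range L, ∑ j ∈ Finset.range L,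
      (‖f (gridPoint m (i + L * b.1 + 1) (j + L * b.2)) -
          f (gridPoint m (i + L * b.1) (j + L * b.2))‖ ^ 2 +
        ‖f (gridPoint m (i + L * b.1) (j + L * b.2 + 1)) -
          f (gridPoint m (i + L * b.1) (j + L * b.2))‖ ^ 2)) +
      2 * ‖blockFunctional s m L b x‖ ^ 2) := by
        refine Finset.sum_le_sum fun b _ => ?_
        have := sum_block_norm_sq_le
          (fun i j => f (gridPoint m (i + L * b.1) (j + L * b.2))) hL
        simp only [Nat.add_right_comm _ 1] at this
        exact this
    _ ≤ _ := by
        rw [Finset.sum_add_distrib, ← Finset.mul_sum, ← Finset.mul_sum]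
        gcongr

/-! ### Stiffness and convection forms on one mesh -/

/-- The Hermitian form `A |z|² + B |w|² + 2 C Re (z conj w)`; with the Gram coefficients of the two
lattice gradients it is the squared length of the gradient with lattice components `z`, `w`. -/
def edgeForm (A B C : ℝ) (z w : ℂ) : ℝ :=
  A * ‖z‖ ^ 2 + B * ‖w‖ ^ 2 + 2 * C * (z * (starRingEnd ℂ) w).re

theorem abs_edgeForm_le (A B C : ℝ) (z w : ℂ) :
    |edgeForm A B C z w| ≤ (|A| + |B| + |C|) * (‖z‖ ^ 2 + ‖w‖ ^ 2) := by
  have h1 : |(z * (starRingEnd ℂ) w).re| ≤ ‖z‖ * ‖w‖ := by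
    refine (Complex.abs_re_le_norm _).trans ?_
    simp
  have h2 : 2 * |(z * (starRingEnd ℂ) w).re| ≤ ‖z‖ ^ 2 + ‖w‖ ^ 2 := by
    nlinarith [sq_nonneg (‖z‖ - ‖w‖)]
  unfold edgeForm
  calc |A * ‖z‖ ^ 2 + B * ‖w‖ ^ 2 + 2 * C * (z * (starRingEnd ℂ) w).re|
      ≤ |A * ‖z‖ ^ 2| + |B * ‖w‖ ^ 2| + |2 * C * (z * (starRingEnd ℂ) w).re| := abs_add_three _ _ _
    _ = |A| * ‖z‖ ^ 2 + |B| * ‖w‖ ^ 2 + |C| * (2 * |(z * (starRingEnd ℂ) w).re|) := by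
        simp only [abs_mul, abs_pow, abs_norm, abs_two]; ring
    _ ≤ |A| * (‖z‖ ^ 2 + ‖w‖ ^ 2) + |B| * (‖z‖ ^ 2 + ‖w‖ ^ 2) + |C| * (‖z‖ ^ 2 + ‖w‖ ^ 2) := by
        gcongr
        · linarith [sq_nonneg ‖w‖]
        · linarith [sq_nonneg ‖z‖]
    _ = _ := by ring

theorem normSq_eq_re_im (z : ℂ) : ‖z‖ ^ 2 = z.re ^ 2 + z.im ^ 2 := by
  rw [Complex.sq_norm, Complex.normSq_apply]; ring

/-- The smallest eigenvalue of a positive definite matrix of order two is at least the quotient of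
its determinant and its trace. -/
theorem mul_le_edgeForm {A B C : ℝ} (hA : 0 < A) (hB : 0 < B) (z w : ℂ) :
    (A * B - C ^ 2) / (A + B) * (‖z‖ ^ 2 + ‖w‖ ^ 2) ≤ edgeForm A B C z w := by
  rw [div_mul_eq_mul_div, div_le_iff₀ (by positivity)]
  unfold edgeForm
  simp only [normSq_eq_re_im, Complex.mul_re, Complex.conj_re, Complex.conj_im]
  -- the difference is `|A z + C w| ^ 2 + |C z + B w| ^ 2`
  nlinarith [sq_nonneg (A * z.re + C * w.re), sq_nonneg (A * z.im + C * w.im),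
    sq_nonneg (C * z.re + B * w.re), sq_nonneg (C * z.im + B * w.im)]

theorem abs_edgeForm_add_sub_le (A B C : ℝ) (z w e f : ℂ) :
    |edgeForm A B C (z + e) (w + f) - edgeForm A B C z w| ≤
      (|A| + |B| + |C|) * (2 * (‖z‖ + ‖w‖) * (‖e‖ + ‖f‖) + (‖e‖ + ‖f‖) ^ 2) := by
  have hsq : ∀ x y : ℂ, |‖x + y‖ ^ 2 - ‖x‖ ^ 2| ≤ 2 * ‖x‖ * ‖y‖ + ‖y‖ ^ 2 := by
    intro x y
    have h1 : ‖x + y‖ ^ 2 - ‖x‖ ^ 2 = 2 * (x * (starRingEnd ℂ) y).re + ‖y‖ ^ 2 := by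
      simp only [normSq_eq_re_im, Complex.mul_re, Complex.conj_re, Complex.conj_im, Complex.add_re,
        Complex.add_im]
      ring
    have h2 : |(x * (starRingEnd ℂ) y).re| ≤ ‖x‖ * ‖y‖ := by
      refine (Complex.abs_re_le_norm _).trans ?_
      simp
    rw [h1, abs_le]
    obtain ⟨h3, h4⟩ := abs_le.1 h2
    constructor <;> nlinarith [sq_nonneg ‖y‖]
  have hre : |((z + e) * (starRingEnd ℂ) (w + f)).re - (z * (starRingEnd ℂ) w).re| ≤
      ‖z‖ * ‖f‖ + ‖e‖ * ‖w‖ + ‖e‖ * ‖f‖ := by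
    have h1 : ((z + e) * (starRingEnd ℂ) (w + f)).re - (z * (starRingEnd ℂ) w).re =
        (z * (starRingEnd ℂ) f + e * (starRingEnd ℂ) w + e * (starRingEnd ℂ) f).re := by
      simp only [map_add, mul_add, add_mul, Complex.add_re]; ring
    rw [h1]
    refine (Complex.abs_re_le_norm _).trans ((norm_add₃_le).trans ?_)
    simp
  have hz := norm_nonneg z
  have hw := norm_nonneg w
  have he := norm_nonneg e
  have hf := norm_nonneg f
  unfold edgeForm
  calc _ = |A * (‖z + e‖ ^ 2 - ‖z‖ ^ 2) + B * (‖w + f‖ ^ 2 - ‖w‖ ^ 2) +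
        C * (2 * (((z + e) * (starRingEnd ℂ) (w + f)).re - (z * (starRingEnd ℂ) w).re))| := by
        congr 1; ring
    _ ≤ |A| * |‖z + e‖ ^ 2 - ‖z‖ ^ 2| + |B| * |‖w + f‖ ^ 2 - ‖w‖ ^ 2| +
        |C| * (2 * |((z + e) * (starRingEnd ℂ) (w + f)).re - (z * (starRingEnd ℂ) w).re|) := by
        refine (abs_add_three _ _ _).trans (le_of_eq ?_)
        simp only [abs_mul, abs_two]
    _ ≤ |A| * (2 * ‖z‖ * ‖e‖ + ‖e‖ ^ 2) + |B| * (2 * ‖w‖ * ‖f‖ + ‖f‖ ^ 2) +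
        |C| * (2 * (‖z‖ * ‖f‖ + ‖e‖ * ‖w‖ + ‖e‖ * ‖f‖)) := by
        gcongr
        · exact hsq z e
        · exact hsq w f
    _ ≤ |A| * (2 * (‖z‖ + ‖w‖) * (‖e‖ + ‖f‖) + (‖e‖ + ‖f‖) ^ 2) +
        |B| * (2 * (‖z‖ + ‖w‖) * (‖e‖ + ‖f‖) + (‖e‖ + ‖f‖) ^ 2) +
        |C| * (2 * (‖z‖ + ‖w‖) * (‖e‖ + ‖f‖) + (‖e‖ + ‖f‖) ^ 2) := by
        have p1 := mul_nonneg hz he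
        have p2 := mul_nonneg hz hf
        have p3 := mul_nonneg hw he
        have p4 := mul_nonneg hw hf
        have p5 := mul_nonneg he hf
        gcongr |A| * ?_ + |B| * ?_ + |C| * ?_ <;> nlinarith
    _ = _ := by ring

/-- The Gram matrix of the gradients of the three shape functions of a triangle, where `A`, `B`,
`C` are the Gram coefficients of the two lattice gradients. -/
def shapeGram (A B C : ℝ) (t : Bool) (k l : Fin 3) : ℝ :=
  A * (edgeU t k * edgeU t l) + B * (edgeV t k * edgeV t l) +
    C * (edgeU t k * edgeV t l + edgeV t k * edgeU t l)

/-- The stiffness matrix with the coefficient `α K` on the triangle `K`. -/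
def stiffness (s : Finset (ℤ × ℤ)) (cells : Finset Cell) (A B C : ℝ) (α : Cell → ℝ) :
    Matrix s s ℝ :=
  assemble s cells fun K k l => α K * shapeGram A B C K.2 k l

/-- The convection matrix with the moments `ωU K l`, `ωV K l` of the field against the `l`-th shape
function. -/
def convMatrix (s : Finset (ℤ × ℤ)) (cells : Finset Cell) (ωU ωV : Cell → Fin 3 → ℝ) :
    Matrix s s ℝ :=
  assemble s cells fun K k l => edgeU K.2 k * ωU K l + edgeV K.2 k * ωV K l

theorem hform_stiffness (s : Finset (ℤ × ℤ)) (cells : Finset Cell) (A B C : ℝ) (α : Cell → ℝ)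
    (x : s → ℂ) : hform (stiffness s cells A B C α) x =
      ((∑ K ∈ cells, α K *
        edgeForm A B C (diffU (zeroExt s x) K) (diffV (zeroExt s x) K) : ℝ) : ℂ) := by
  rw [stiffness, hform_assemble]
  rw [Complex.ofReal_sum]
  refine Finset.sum_congr rfl fun K _ => ?_
  rw [Complex.ofReal_mul]
  have key : ∀ (a b : Fin 3 → ℝ) (X : Fin 3 → ℂ), ∑ k, ∑ l, (starRingEnd ℂ) (X k) *
      ((α K * (A * (a k * a l) + B * (b k * b l) + C * (a k * b l + b k * a l)) : ℝ) : ℂ) * X l =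
      α K * (edgeForm A B C (∑ k, (a k : ℂ) * X k) (∑ k, (b k : ℂ) * X k) : ℂ) := by
    intro a b X
    have hef : ∀ z w : ℂ, ((edgeForm A B C z w : ℝ) : ℂ) = A * ((starRingEnd ℂ) z * z) +
        B * ((starRingEnd ℂ) w * w) +
        C * ((starRingEnd ℂ) z * w + (starRingEnd ℂ) w * z) := by
      intro z w
      unfold edgeForm
      push_cast
      rw [Complex.conj_mul', Complex.conj_mul', Complex.re_eq_add_conj]
      simp only [map_mul, Complex.conj_conj]
      ring
    rw [hef]
    simp only [Fin.sum_univ_three, map_add, map_mul, Complex.conj_ofReal]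
    push_cast
    ring
  exact key (edgeU K.2) (edgeV K.2) fun k => zeroExt s x (K.vertex k)

theorem hform_convMatrix (s : Finset (ℤ × ℤ)) (cells : Finset Cell) (ωU ωV : Cell → Fin 3 → ℝ)
    (x : s → ℂ) : hform (convMatrix s cells ωU ωV) x = ∑ K ∈ cells,
      ((starRingEnd ℂ) (diffU (zeroExt s x) K) * ∑ l, (ωU K l : ℂ) * zeroExt s x (K.vertex l) +
        (starRingEnd ℂ) (diffV (zeroExt s x) K) *
          ∑ l, (ωV K l : ℂ) * zeroExt s x (K.vertex l)) := by
  rw [convMatrix, hform_assemble]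
  refine Finset.sum_congr rfl fun K _ => ?_
  simp only [diffU, diffV, Fin.sum_univ_three, map_add, map_mul, Complex.conj_ofReal]
  push_cast
  ring

/-- The sum of the moduli of the nodal values of a triangle. -/
def cellSum (f : ℤ × ℤ → ℂ) (K : Cell) : ℝ := ∑ k, ‖f (K.vertex k)‖

theorem sum_cellSum_sq_le (s : Finset (ℤ × ℤ)) (cells : Finset Cell) (x : s → ℂ) :
    ∑ K ∈ cells, cellSum (zeroExt s x) K ^ 2 ≤ 18 * normSqSum x := by
  calc ∑ K ∈ cells, cellSum (zeroExt s x) K ^ 2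
      ≤ ∑ K ∈ cells, 3 * ∑ k, ‖zeroExt s x (K.vertex k)‖ ^ 2 := by
        refine Finset.sum_le_sum fun K _ => ?_
        have := sq_sum_le_card_mul_sum_sq (s := (Finset.univ : Finset (Fin 3)))
          (f := fun k => ‖zeroExt s x (K.vertex k)‖)
        simpa [cellSum] using this
    _ = 3 * ∑ k, ∑ K ∈ cells, ‖zeroExt s x (K.vertex k)‖ ^ 2 := by
        rw [← Finset.mul_sum, Finset.sum_comm]
    _ ≤ 3 * ∑ _k : Fin 3, 2 * normSqSum x := by
        gcongr with k
        exact sum_cells_vertex_le s cells x k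
    _ = 18 * normSqSum x := by simp; ring

theorem sum_diff_mul_cellSum_le (s : Finset (ℤ × ℤ)) (cells : Finset Cell) (x : s → ℂ) :
    ∑ K ∈ cells, (‖diffU (zeroExt s x) K‖ + ‖diffV (zeroExt s x) K‖) * cellSum (zeroExt s x) K ≤
      6 * √(gridEnergy cells (zeroExt s x) * normSqSum x) := by
  refine (Real.sum_mul_le_sqrt_mul_sqrt _ _ _).trans ?_
  rw [← Real.sqrt_mul (Finset.sum_nonneg fun _ _ => sq_nonneg _)]
  have h6 : (6 : ℝ) = √36 := by rw [show (36 : ℝ) = 6 ^ 2 by norm_num]; simp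
  rw [h6, ← Real.sqrt_mul (by norm_num)]
  apply Real.sqrt_le_sqrt
  have h1 : ∑ K ∈ cells, (‖diffU (zeroExt s x) K‖ + ‖diffV (zeroExt s x) K‖) ^ 2 ≤
      2 * gridEnergy cells (zeroExt s x) := by
    rw [gridEnergy, Finset.mul_sum]
    refine Finset.sum_le_sum fun K _ => ?_
    nlinarith [sq_nonneg (‖diffU (zeroExt s x) K‖ - ‖diffV (zeroExt s x) K‖)]
  calc _ ≤ 2 * gridEnergy cells (zeroExt s x) * (18 * normSqSum x) := by
        gcongr
        · exact mul_nonneg (by norm_num) (gridEnergy_nonneg _ _)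
        · exact sum_cellSum_sq_le s cells x
    _ = _ := by ring

theorem norm_hform_convMatrix_le (s : Finset (ℤ × ℤ)) (cells : Finset Cell)
    (ωU ωV : Cell → Fin 3 → ℝ) {w : ℝ} (hU : ∀ K ∈ cells, ∀ l, |ωU K l| ≤ w)
    (hV : ∀ K ∈ cells, ∀ l, |ωV K l| ≤ w) (hw : 0 ≤ w) (x : s → ℂ) :
    ‖hform (convMatrix s cells ωU ωV) x‖ ≤
      6 * w * √(gridEnergy cells (zeroExt s x) * normSqSum x) := by
  rw [hform_convMatrix]
  have hsum : ∀ ω : Cell → Fin 3 → ℝ, (∀ K ∈ cells, ∀ l, |ω K l| ≤ w) → ∀ K ∈ cells,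
      ‖∑ l, (ω K l : ℂ) * zeroExt s x (K.vertex l)‖ ≤ w * cellSum (zeroExt s x) K := by
    intro ω h K hK
    refine (norm_sum_le _ _).trans ?_
    rw [cellSum, Finset.mul_sum]
    refine Finset.sum_le_sum fun l _ => ?_
    rw [norm_mul, Complex.norm_real, Real.norm_eq_abs]
    gcongr
    exact h K hK l
  calc _ ≤ ∑ K ∈ cells, w * ((‖diffU (zeroExt s x) K‖ + ‖diffV (zeroExt s x) K‖) *
        cellSum (zeroExt s x) K) := by
        refine (norm_sum_le _ _).trans (Finset.sum_le_sum fun K hK => ?_)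
        refine (norm_add_le _ _).trans ?_
        rw [norm_mul, norm_mul, RCLike.norm_conj, RCLike.norm_conj]
        calc _ ≤ ‖diffU (zeroExt s x) K‖ * (w * cellSum (zeroExt s x) K) +
              ‖diffV (zeroExt s x) K‖ * (w * cellSum (zeroExt s x) K) := by
              gcongr
              · exact hsum ωU hU K hK
              · exact hsum ωV hV K hK
          _ = _ := by ring
    _ ≤ w * (6 * √(gridEnergy cells (zeroExt s x) * normSqSum x)) := by
        rw [← Finset.mul_sum]
        gcongr
        exact sum_diff_mul_cellSum_le s cells x
    _ = _ := by ring

theorem norm_diffU_le (f : ℤ × ℤ → ℂ) (K : Cell) : ‖diffU f K‖ ≤ cellSum f K := by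
  refine (norm_sum_le _ _).trans (Finset.sum_le_sum fun k _ => ?_)
  rw [norm_mul, Complex.norm_real]
  have : ‖edgeU K.2 k‖ ≤ 1 := by
    unfold edgeU; split_ifs <;> fin_cases k <;> simp
  nlinarith [norm_nonneg (f (K.vertex k))]

theorem norm_diffV_le (f : ℤ × ℤ → ℂ) (K : Cell) : ‖diffV f K‖ ≤ cellSum f K := by
  refine (norm_sum_le _ _).trans (Finset.sum_le_sum fun k _ => ?_)
  rw [norm_mul, Complex.norm_real]
  have : ‖edgeV K.2 k‖ ≤ 1 := by
    unfold edgeV; split_ifs <;> fin_cases k <;> simp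
  nlinarith [norm_nonneg (f (K.vertex k))]

theorem diffU_scale (f g : ℤ × ℤ → ℂ) (r : ℂ) (K : Cell) :
    diffU g K = r * diffU f K + diffU (fun p => g p - r * f p) K := by
  simp only [diffU, Fin.sum_univ_three]; ring

theorem diffV_scale (f g : ℤ × ℤ → ℂ) (r : ℂ) (K : Cell) :
    diffV g K = r * diffV f K + diffV (fun p => g p - r * f p) K := by
  simp only [diffV, Fin.sum_univ_three]; ring

theorem edgeForm_smul (A B C r : ℝ) (z w : ℂ) :
    edgeForm A B C (r * z) (r * w) = r ^ 2 * edgeForm A B C z w := by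
  unfold edgeForm
  simp only [normSq_eq_re_im, Complex.mul_re, Complex.conj_re, Complex.conj_im,
    Complex.ofReal_re, Complex.ofReal_im, Complex.mul_im]
  ring

/-! ### The diagonally scaled preconditioner -/

/-- The inner nodes `s` lie in the lattice square of radius `m`, and all triangles with an inner
vertex are among `cells`. -/
structure IsLatticeMesh (s : Finset (ℤ × ℤ)) (cells : Finset Cell) (m : ℕ) : Prop where
  one_le : 1 ≤ m
  box : ∀ p ∈ s, |p.1| ≤ m ∧ |p.2| ≤ m
  mem_cells : ∀ K : Cell, ∀ k, K.vertex k ∈ s → K ∈ cells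

/-- The coefficients `α K` of the triangles lie in `[a₀, a₁]`, and differ by at most `L / m` on
triangles with a common inner vertex. -/
structure IsCellCoefficient (s : Finset (ℤ × ℤ)) (cells : Finset Cell) (m : ℕ) (α : Cell → ℝ)
    (a₀ a₁ L : ℝ) : Prop where
  lower : ∀ K ∈ cells, a₀ ≤ α K
  upper : ∀ K ∈ cells, α K ≤ a₁
  osc : ∀ K ∈ cells, ∀ K' ∈ cells, ∀ k k', K.vertex k = K'.vertex k' → K.vertex k ∈ s →
    |α K - α K'| ≤ L / m

theorem hform_single {ι : Type} [Fintype ι] [DecidableEq ι] (M : Matrix ι ι ℝ) (i : ι) :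
    hform M (Pi.single i 1) = M i i := by
  unfold hform
  rw [Finset.sum_eq_single i, Finset.sum_eq_single i]
  · simp
  · intro j _ hj; simp [hj]
  · simp
  · intro j _ hj; simp [hj]
  · simp

theorem hform_diagonal_mul_mul_diagonal {ι : Type} [Fintype ι] [DecidableEq ι] (M : Matrix ι ι ℝ)
    (d : ι → ℝ) (x : ι → ℂ) :
    hform (Matrix.diagonal d * M * Matrix.diagonal d) x = hform M fun i => d i * x i := by
  unfold hform
  refine Finset.sum_congr rfl fun i _ => Finset.sum_congr rfl fun j _ => ?_
  rw [Matrix.mul_diagonal, Matrix.diagonal_mul]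
  simp only [map_mul, Complex.conj_ofReal]
  push_cast
  ring

theorem isSymm_stiffness (s : Finset (ℤ × ℤ)) (cells : Finset Cell) (A B C : ℝ) (α : Cell → ℝ) :
    (stiffness s cells A B C α).IsSymm := by
  ext i j
  simp only [stiffness, assemble, Matrix.transpose_apply, Matrix.of_apply]
  refine Finset.sum_congr rfl fun K _ => ?_
  rw [Finset.sum_comm]
  refine Finset.sum_congr rfl fun k _ => Finset.sum_congr rfl fun l _ => ?_
  unfold shapeGram
  ring

theorem isSymm_scaledPrecond {ι : Type} [Fintype ι] [DecidableEq ι] (T T₁ : Matrix ι ι ℝ)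
    (h : T₁.IsSymm) : (scaledPrecond T T₁).IsSymm := by
  unfold scaledPrecond Matrix.IsSymm
  rw [Matrix.transpose_mul, Matrix.transpose_mul, Matrix.diagonal_transpose, h.eq, Matrix.mul_assoc]

section

variable {s : Finset (ℤ × ℤ)} {cells : Finset Cell} {m : ℕ} {A B C : ℝ} {α : Cell → ℝ}
  {a₀ a₁ L : ℝ}

theorem mul_gridEnergy_le_stiffness (hA : 0 < A) (hB : 0 < B) (hC : C ^ 2 < A * B)
    (ha₀ : 0 ≤ a₀) (hα : ∀ K ∈ cells, a₀ ≤ α K) (x : s → ℂ) :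
    a₀ * ((A * B - C ^ 2) / (A + B)) * gridEnergy cells (zeroExt s x) ≤
      (hform (stiffness s cells A B C α) x).re := by
  rw [hform_stiffness, Complex.ofReal_re, gridEnergy, Finset.mul_sum]
  refine Finset.sum_le_sum fun K hK => ?_
  have h1 := mul_le_edgeForm (C := C) hA hB (diffU (zeroExt s x) K) (diffV (zeroExt s x) K)
  have h2 : 0 ≤ (A * B - C ^ 2) / (A + B) * (‖diffU (zeroExt s x) K‖ ^ 2 +
      ‖diffV (zeroExt s x) K‖ ^ 2) :=
    mul_nonneg (div_nonneg (by linarith) (by linarith)) (by positivity)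
  rw [mul_assoc]
  exact mul_le_mul (hα K hK) h1 h2 (ha₀.trans (hα K hK))

theorem norm_stiffness_le (hα : ∀ K ∈ cells, |α K| ≤ a₁) (x : s → ℂ) :
    ‖hform (stiffness s cells A B C α) x‖ ≤
      a₁ * (|A| + |B| + |C|) * gridEnergy cells (zeroExt s x) := by
  rw [hform_stiffness, Complex.norm_real, Real.norm_eq_abs, gridEnergy, Finset.mul_sum]
  refine (Finset.abs_sum_le_sum_abs _ _).trans (Finset.sum_le_sum fun K hK => ?_)
  rw [abs_mul, mul_assoc]
  exact mul_le_mul (hα K hK) (abs_edgeForm_le _ _ _ _ _) (abs_nonneg _)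
    ((abs_nonneg _).trans (hα K hK))

/-- The diagonal ratio at a node is a weighted mean of the coefficients of the triangles around it,
and hence close to each of them. -/
theorem diag_ratio_bounds (hA : 0 < A) (hB : 0 < B) (hC : C ^ 2 < A * B)
    (hmesh : IsLatticeMesh s cells m) (hα : IsCellCoefficient s cells m α a₀ a₁ L) (i : s) :
    a₀ ≤ stiffness s cells A B C α i i / stiffness s cells A B C (fun _ => 1) i i ∧
    stiffness s cells A B C α i i / stiffness s cells A B C (fun _ => 1) i i ≤ a₁ ∧
    ∀ K : Cell, ∀ k, K.vertex k = i →
      |stiffness s cells A B C α i i / stiffness s cells A B C (fun _ => 1) i i - α K| ≤ L / m := by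
  set f := zeroExt s (Pi.single i 1) with hf
  set e : Cell → ℝ := fun K => edgeForm A B C (diffU f K) (diffV f K) with he
  have hdiag : ∀ β : Cell → ℝ, stiffness s cells A B C β i i = ∑ K ∈ cells, β K * e K := by
    intro β
    have h1 := hform_single (stiffness s cells A B C β) i
    rw [hform_stiffness] at h1
    exact_mod_cast h1.symm
  have he0 : ∀ K, 0 ≤ e K := fun K =>
    le_trans (mul_nonneg (div_nonneg (by linarith) (by linarith)) (by positivity))
      (mul_le_edgeForm hA hB _ _)
  have hez : ∀ K, (∀ k, K.vertex k ≠ (i : ℤ × ℤ)) → e K = 0 := by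
    intro K hK
    have h1 : ∀ k, f (K.vertex k) = 0 := by
      intro k
      by_cases h : K.vertex k ∈ s
      · have h2 : (⟨K.vertex k, h⟩ : s) ≠ i := fun h3 => hK k (by rw [← h3])
        simp [hf, zeroExt, h, h2]
      · exact zeroExt_of_notMem _ h
    simp [he, diffU, diffV, h1, edgeForm]
  have hpos : 0 < ∑ K ∈ cells, e K := by
    have h1 := mul_gridEnergy_le_stiffness (α := fun _ => (1 : ℝ)) (s := s) (cells := cells)
      hA hB hC zero_le_one (fun _ _ => le_rfl) (Pi.single i 1)
    rw [hform_single, Complex.ofReal_re, hdiag] at h1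
    simp only [one_mul] at h1
    refine lt_of_lt_of_le (mul_pos (div_pos (by linarith) (by linarith)) ?_) h1
    have h2 := normSqSum_le_mul_gridEnergy s cells hmesh.box hmesh.mem_cells (Pi.single i 1)
    have h3 : normSqSum (Pi.single i (1 : ℂ) : s → ℂ) = 1 := by
      rw [normSqSum, Finset.sum_eq_single i]
      · simp
      · intro j _ hj; simp [hj]
      · simp
    rw [h3] at h2
    by_contra hc
    nlinarith [gridEnergy_nonneg cells (zeroExt s (Pi.single i 1)), sq_nonneg (2 * (m : ℝ) + 2)]
  rw [hdiag, hdiag]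
  simp only [one_mul]
  refine ⟨?_, ?_, ?_⟩
  · rw [le_div_iff₀ hpos, Finset.mul_sum]
    exact Finset.sum_le_sum fun K hK => mul_le_mul_of_nonneg_right (hα.lower K hK) (he0 K)
  · rw [div_le_iff₀ hpos, Finset.mul_sum]
    exact Finset.sum_le_sum fun K hK => mul_le_mul_of_nonneg_right (hα.upper K hK) (he0 K)
  · intro K k hk
    have hKs : K.vertex k ∈ s := hk ▸ i.2
    have h1 : (∑ K' ∈ cells, α K' * e K') / (∑ K' ∈ cells, e K') - α K =
        (∑ K' ∈ cells, (α K' - α K) * e K') / ∑ K' ∈ cells, e K' := by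
      rw [div_sub' hpos.ne', mul_comm, Finset.mul_sum, ← Finset.sum_sub_distrib]
      congr 1
      exact Finset.sum_congr rfl fun _ _ => by ring
    rw [h1, abs_div, abs_of_pos hpos, div_le_iff₀ hpos, Finset.mul_sum]
    refine (Finset.abs_sum_le_sum_abs _ _).trans (Finset.sum_le_sum fun K' hK' => ?_)
    rw [abs_mul, abs_of_nonneg (he0 K')]
    by_cases h2 : ∃ k', K'.vertex k' = (i : ℤ × ℤ)
    · obtain ⟨k', hk'⟩ := h2
      refine mul_le_mul_of_nonneg_right ?_ (he0 K')
      exact hα.osc K' hK' K (hmesh.mem_cells K k hKs) k' k (hk'.trans hk.symm) (hk' ▸ i.2)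
    · push Not at h2
      rw [hez K' h2]; simp

/-- The vector of nodal values scaled by `D ^ (1 / 2)`. -/
def scaleVec (s : Finset (ℤ × ℤ)) (T T₁ : Matrix s s ℝ) (x : s → ℂ) : s → ℂ :=
  fun i => (√(T i i / T₁ i i) : ℝ) * x i

theorem hform_scaledPrecond (T T₁ : Matrix s s ℝ) (x : s → ℂ) :
    hform (scaledPrecond T T₁) x = hform T₁ (scaleVec s T T₁ x) :=
  hform_diagonal_mul_mul_diagonal _ _ _

theorem abs_sqrt_sub_sqrt_le {a b c δ : ℝ} (hc : 0 < c) (ha : c ≤ a) (hb : c ≤ b)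
    (h : |a - b| ≤ δ) : |√a - √b| ≤ δ / √c := by
  have hsc : 0 < √c := Real.sqrt_pos.2 hc
  rw [le_div_iff₀ hsc]
  have h1 : √c ≤ √a := Real.sqrt_le_sqrt ha
  have h2 : 0 ≤ √b := Real.sqrt_nonneg b
  have h3 : |√a - √b| * (√a + √b) = |a - b| := by
    rw [← abs_of_nonneg (by linarith : 0 ≤ √a + √b), ← abs_mul]
    congr 1
    nlinarith [Real.sq_sqrt (hc.le.trans ha), Real.sq_sqrt (hc.le.trans hb)]
  nlinarith [abs_nonneg (√a - √b)]

/-- On a triangle `K`, the scaling acts like the multiplication by the constant `√(α K)`, up to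
`O(m⁻¹)`. -/
theorem cellSum_scaleVec_sub_le (hA : 0 < A) (hB : 0 < B) (hC : C ^ 2 < A * B)
    (hmesh : IsLatticeMesh s cells m) (ha₀ : 0 < a₀) (hα : IsCellCoefficient s cells m α a₀ a₁ L)
    (x : s → ℂ) {K : Cell} (hK : K ∈ cells) :
    cellSum (fun p => zeroExt s (scaleVec s (stiffness s cells A B C α)
      (stiffness s cells A B C fun _ => 1) x) p - (√(α K) : ℝ) * zeroExt s x p) K ≤
      L / √a₀ / m * cellSum (zeroExt s x) K := by
  rw [cellSum, cellSum, Finset.mul_sum]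
  refine Finset.sum_le_sum fun k _ => ?_
  by_cases h : K.vertex k ∈ s
  · obtain ⟨h1, -, h3⟩ := diag_ratio_bounds hA hB hC hmesh hα ⟨_, h⟩
    have h4 := abs_sqrt_sub_sqrt_le ha₀ h1 (hα.lower K hK) (h3 K k rfl)
    simp only [zeroExt, h, dif_pos, scaleVec]
    rw [← sub_mul, norm_mul, ← Complex.ofReal_sub, Complex.norm_real, Real.norm_eq_abs,
      div_right_comm]
    gcongr
  · simp [zeroExt_of_notMem _ h]

theorem normSqSum_le_scaleVec (hA : 0 < A) (hB : 0 < B) (hC : C ^ 2 < A * B)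
    (hmesh : IsLatticeMesh s cells m) (ha₀ : 0 < a₀) (hα : IsCellCoefficient s cells m α a₀ a₁ L)
    (x : s → ℂ) : a₀ * normSqSum x ≤ normSqSum (scaleVec s (stiffness s cells A B C α)
      (stiffness s cells A B C fun _ => 1) x) := by
  rw [normSqSum, normSqSum, Finset.mul_sum]
  refine Finset.sum_le_sum fun i _ => ?_
  obtain ⟨h1, -, -⟩ := diag_ratio_bounds hA hB hC hmesh hα i
  rw [scaleVec, norm_mul, mul_pow, Complex.norm_real, Real.norm_eq_abs, sq_abs,
    Real.sq_sqrt (ha₀.le.trans h1)]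
  gcongr

theorem normSqSum_le_gridEnergy (hmesh : IsLatticeMesh s cells m) (x : s → ℂ) :
    normSqSum x ≤ 16 * m ^ 2 * gridEnergy cells (zeroExt s x) := by
  refine (normSqSum_le_mul_gridEnergy s cells hmesh.box hmesh.mem_cells x).trans ?_
  have h1 : (1 : ℝ) ≤ m := by exact_mod_cast hmesh.one_le
  have := gridEnergy_nonneg cells (zeroExt s x)
  gcongr
  nlinarith

/-- The energies of a vector and of its scaling are equivalent, up to terms of lower order. -/
theorem gridEnergy_scaleVec (hA : 0 < A) (hB : 0 < B) (hC : C ^ 2 < A * B)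
    (hmesh : IsLatticeMesh s cells m) (ha₀ : 0 < a₀) (hα : IsCellCoefficient s cells m α a₀ a₁ L)
    (x : s → ℂ) :
    gridEnergy cells (zeroExt s (scaleVec s (stiffness s cells A B C α)
      (stiffness s cells A B C fun _ => 1) x)) ≤
        2 * a₁ * gridEnergy cells (zeroExt s x) + 72 * (L / √a₀ / m) ^ 2 * normSqSum x ∧
    a₀ * gridEnergy cells (zeroExt s x) ≤ 2 * gridEnergy cells (zeroExt s (scaleVec s
      (stiffness s cells A B C α) (stiffness s cells A B C fun _ => 1) x)) +
        72 * (L / √a₀ / m) ^ 2 * normSqSum x := by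
  set f := zeroExt s x with hf
  set g := zeroExt s (scaleVec s (stiffness s cells A B C α)
      (stiffness s cells A B C fun _ => 1) x) with hg
  set η := L / √a₀ / m with hη
  have key : ∀ K ∈ cells, ‖diffU g K‖ ^ 2 + ‖diffV g K‖ ^ 2 ≤
      2 * a₁ * (‖diffU f K‖ ^ 2 + ‖diffV f K‖ ^ 2) + 4 * η ^ 2 * cellSum f K ^ 2 ∧
      a₀ * (‖diffU f K‖ ^ 2 + ‖diffV f K‖ ^ 2) ≤
      2 * (‖diffU g K‖ ^ 2 + ‖diffV g K‖ ^ 2) + 4 * η ^ 2 * cellSum f K ^ 2 := by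
    intro K hK
    have hc := cellSum_scaleVec_sub_le hA hB hC hmesh ha₀ hα x hK
    have hU := (norm_diffU_le _ K).trans hc
    have hV := (norm_diffV_le _ K).trans hc
    have hUg := diffU_scale f g (√(α K) : ℝ) K
    have hVg := diffV_scale f g (√(α K) : ℝ) K
    have hα0 := hα.lower K hK
    have hα1 := hα.upper K hK
    have gen : ∀ u v e : ℂ, v = (√(α K) : ℝ) * u + e → ‖e‖ ≤ η * cellSum f K →
        ‖v‖ ^ 2 ≤ 2 * a₁ * ‖u‖ ^ 2 + 2 * η ^ 2 * cellSum f K ^ 2 ∧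
        a₀ * ‖u‖ ^ 2 ≤ 2 * ‖v‖ ^ 2 + 2 * η ^ 2 * cellSum f K ^ 2 := by
      intro u v e hv he
      have e1 : ‖((√(α K) : ℝ) : ℂ) * u‖ ^ 2 = α K * ‖u‖ ^ 2 := by
        rw [norm_mul, mul_pow, Complex.norm_real, Real.norm_eq_abs, sq_abs,
          Real.sq_sqrt (ha₀.le.trans hα0)]
      have e2 : ‖e‖ ^ 2 ≤ η ^ 2 * cellSum f K ^ 2 := by
        rw [← mul_pow]; gcongr
      have e3 : ‖v‖ ≤ ‖((√(α K) : ℝ) : ℂ) * u‖ + ‖e‖ := hv ▸ norm_add_le _ _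
      have e4 : ‖((√(α K) : ℝ) : ℂ) * u‖ ≤ ‖v‖ + ‖e‖ := by
        have : ((√(α K) : ℝ) : ℂ) * u = v - e := by rw [hv]; ring
        rw [this]; exact norm_sub_le _ _
      have e5 : ‖v‖ ^ 2 ≤ 2 * ‖((√(α K) : ℝ) : ℂ) * u‖ ^ 2 + 2 * ‖e‖ ^ 2 := by
        have := pow_le_pow_left₀ (norm_nonneg _) e3 2
        nlinarith [sq_nonneg (‖((√(α K) : ℝ) : ℂ) * u‖ - ‖e‖)]
      have e6 : ‖((√(α K) : ℝ) : ℂ) * u‖ ^ 2 ≤ 2 * ‖v‖ ^ 2 + 2 * ‖e‖ ^ 2 := by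
        have := pow_le_pow_left₀ (norm_nonneg _) e4 2
        nlinarith [sq_nonneg (‖v‖ - ‖e‖)]
      rw [e1] at e5 e6
      have e7 : α K * ‖u‖ ^ 2 ≤ a₁ * ‖u‖ ^ 2 := by gcongr
      have e8 : a₀ * ‖u‖ ^ 2 ≤ α K * ‖u‖ ^ 2 := by gcongr
      constructor <;> linarith
    obtain ⟨u1, u2⟩ := gen _ _ _ hUg hU
    obtain ⟨v1, v2⟩ := gen _ _ _ hVg hV
    constructor <;> linarith
  have hsum := sum_cellSum_sq_le s cells x
  have hη2 : 4 * η ^ 2 * ∑ K ∈ cells, cellSum f K ^ 2 ≤ 4 * η ^ 2 * (18 * normSqSum x) := by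
    gcongr
  constructor
  · calc gridEnergy cells g
        ≤ ∑ K ∈ cells, (2 * a₁ * (‖diffU f K‖ ^ 2 + ‖diffV f K‖ ^ 2) +
          4 * η ^ 2 * cellSum f K ^ 2) := Finset.sum_le_sum fun K hK => (key K hK).1
      _ = 2 * a₁ * gridEnergy cells f + 4 * η ^ 2 * ∑ K ∈ cells, cellSum f K ^ 2 := by
          rw [Finset.sum_add_distrib, ← Finset.mul_sum, ← Finset.mul_sum, gridEnergy]
      _ ≤ _ := by linarith
  · calc a₀ * gridEnergy cells f = ∑ K ∈ cells, a₀ * (‖diffU f K‖ ^ 2 + ‖diffV f K‖ ^ 2) := by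
          rw [gridEnergy, Finset.mul_sum]
      _ ≤ ∑ K ∈ cells, (2 * (‖diffU g K‖ ^ 2 + ‖diffV g K‖ ^ 2) +
          4 * η ^ 2 * cellSum f K ^ 2) := Finset.sum_le_sum fun K hK => (key K hK).2
      _ = 2 * gridEnergy cells g + 4 * η ^ 2 * ∑ K ∈ cells, cellSum f K ^ 2 := by
          rw [Finset.sum_add_distrib, ← Finset.mul_sum, ← Finset.mul_sum, gridEnergy]
      _ ≤ _ := by linarith

/-- The stiffness form differs from the form of the scaled preconditioner by terms of lower
order. -/
theorem norm_hform_stiffness_sub_scaledPrecond_le (hA : 0 < A) (hB : 0 < B) (hC : C ^ 2 < A * B)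
    (hmesh : IsLatticeMesh s cells m) (ha₀ : 0 < a₀) (hα : IsCellCoefficient s cells m α a₀ a₁ L)
    (hL : 0 ≤ L) (x : s → ℂ) :
    ‖hform (stiffness s cells A B C α) x - hform (scaledPrecond (stiffness s cells A B C α)
      (stiffness s cells A B C fun _ => 1)) x‖ ≤ (|A| + |B| + |C|) *
        (24 * √a₁ * (L / √a₀ / m) * √(gridEnergy cells (zeroExt s x) * normSqSum x) +
          72 * (L / √a₀ / m) ^ 2 * normSqSum x) := by
  rw [hform_scaledPrecond]
  set y := scaleVec s (stiffness s cells A B C α) (stiffness s cells A B C fun _ => 1) x with hy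
  set f := zeroExt s x with hf
  set g := zeroExt s y with hg
  set η := L / √a₀ / m with hη
  have hη0 : 0 ≤ η := by positivity
  rw [hform_stiffness, hform_stiffness, ← Complex.ofReal_sub, Complex.norm_real, Real.norm_eq_abs,
    ← Finset.sum_sub_distrib]
  have key : ∀ K ∈ cells, |α K * edgeForm A B C (diffU f K) (diffV f K) -
      1 * edgeForm A B C (diffU g K) (diffV g K)| ≤ (|A| + |B| + |C|) *
      (4 * √a₁ * η * ((‖diffU f K‖ + ‖diffV f K‖) * cellSum f K) +
        4 * η ^ 2 * cellSum f K ^ 2) := by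
    intro K hK
    have hc := cellSum_scaleVec_sub_le hA hB hC hmesh ha₀ hα x hK
    have hU := (norm_diffU_le _ K).trans hc
    have hV := (norm_diffV_le _ K).trans hc
    have hα0 := hα.lower K hK
    have h1 := abs_edgeForm_add_sub_le A B C ((√(α K) : ℝ) * diffU f K) ((√(α K) : ℝ) * diffV f K)
      (diffU (fun p => g p - (√(α K) : ℝ) * f p) K) (diffV (fun p => g p - (√(α K) : ℝ) * f p) K)
    rw [← diffU_scale f g, ← diffV_scale f g, edgeForm_smul, Real.sq_sqrt (ha₀.le.trans hα0),
      abs_sub_comm, norm_mul, norm_mul, Complex.norm_real, Real.norm_eq_abs,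
      abs_of_nonneg (Real.sqrt_nonneg _), ← mul_add] at h1
    rw [one_mul]
    refine h1.trans ?_
    have h2 : √(α K) ≤ √a₁ := Real.sqrt_le_sqrt (hα.upper K hK)
    have h3 : ‖diffU (fun p => g p - (√(α K) : ℝ) * f p) K‖ +
        ‖diffV (fun p => g p - (√(α K) : ℝ) * f p) K‖ ≤ 2 * (η * cellSum f K) := by
      linarith
    calc _ ≤ (|A| + |B| + |C|) * (2 * (√a₁ * (‖diffU f K‖ + ‖diffV f K‖)) *
          (2 * (η * cellSum f K)) + (2 * (η * cellSum f K)) ^ 2) := by gcongr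
      _ = _ := by ring
  calc _ ≤ ∑ K ∈ cells, (|A| + |B| + |C|) *
      (4 * √a₁ * η * ((‖diffU f K‖ + ‖diffV f K‖) * cellSum f K) + 4 * η ^ 2 * cellSum f K ^ 2) :=
        (Finset.abs_sum_le_sum_abs _ _).trans (Finset.sum_le_sum key)
    _ = (|A| + |B| + |C|) *
        (4 * √a₁ * η * (∑ K ∈ cells, (‖diffU f K‖ + ‖diffV f K‖) * cellSum f K) +
        4 * η ^ 2 * ∑ K ∈ cells, cellSum f K ^ 2) := by
        rw [← Finset.mul_sum, Finset.sum_add_distrib, ← Finset.mul_sum, ← Finset.mul_sum]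
    _ ≤ (|A| + |B| + |C|) * (4 * √a₁ * η * (6 * √(gridEnergy cells f * normSqSum x)) +
        4 * η ^ 2 * (18 * normSqSum x)) := by
        gcongr
        · exact sum_diff_mul_cellSum_le s cells x
        · exact sum_cellSum_sq_le s cells x
    _ = _ := by ring

end

/-! ### Clusters and bounds for sequences of lattice meshes -/

theorem sqrt_gridEnergy_mul_normSqSum_le {s : Finset (ℤ × ℤ)} {cells : Finset Cell} {m : ℕ}
    (hmesh : IsLatticeMesh s cells m) (x : s → ℂ) :
    √(gridEnergy cells (zeroExt s x) * normSqSum x) ≤ 4 * m * gridEnergy cells (zeroExt s x) := by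
  have hG := gridEnergy_nonneg cells (zeroExt s x)
  rw [Real.sqrt_le_left (by positivity)]
  calc _ ≤ gridEnergy cells (zeroExt s x) * (16 * m ^ 2 * gridEnergy cells (zeroExt s x)) := by
        gcongr; exact normSqSum_le_gridEnergy hmesh x
    _ = _ := by ring

/-- The form of the preconditioner is equivalent to the energy, and the form of the difference
between the full matrix and the preconditioner is of lower order, uniformly in the mesh. -/
theorem exists_form_bounds {A B C a₀ a₁ L w : ℝ} (hA : 0 < A) (hB : 0 < B) (hC : C ^ 2 < A * B)
    (ha₀ : 0 < a₀) (ha₁ : 0 < a₁) (hL : 0 ≤ L) (hw : 0 ≤ w) :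
    ∃ κ μ c : ℝ, 0 < κ ∧ 0 < μ ∧ 0 ≤ c ∧ ∀ (s : Finset (ℤ × ℤ)) (cells : Finset Cell) (m : ℕ)
      (α : Cell → ℝ) (ωU ωV : Cell → Fin 3 → ℝ), IsLatticeMesh s cells m →
      IsCellCoefficient s cells m α a₀ a₁ L → (∀ K ∈ cells, ∀ l, |ωU K l| ≤ w / m) →
      (∀ K ∈ cells, ∀ l, |ωV K l| ≤ w / m) → ∀ x : s → ℂ,
      gridEnergy cells (zeroExt s x) ≤ κ * (hform (scaledPrecond (stiffness s cells A B C α)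
        (stiffness s cells A B C fun _ => 1)) x).re ∧
      (hform (scaledPrecond (stiffness s cells A B C α)
        (stiffness s cells A B C fun _ => 1)) x).re ≤ μ * gridEnergy cells (zeroExt s x) ∧
      ‖hform (stiffness s cells A B C α + convMatrix s cells ωU ωV -
        scaledPrecond (stiffness s cells A B C α) (stiffness s cells A B C fun _ => 1)) x‖ ^ 2 ≤
        c * (normSqSum x / m ^ 2) * (hform (scaledPrecond (stiffness s cells A B C α)
        (stiffness s cells A B C fun _ => 1)) x).re := by
  set c₀ := (A * B - C ^ 2) / (A + B) with hc₀
  have hc₀pos : 0 < c₀ := div_pos (by linarith) (by linarith)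
  set M := |A| + |B| + |C| with hM
  have hMpos : 0 < M := by
    have := abs_pos.2 hA.ne'
    positivity
  set e := L / √a₀ with he
  have he0 : 0 ≤ e := by positivity
  set κ := (2 + 1152 * e ^ 2 / a₀) / (a₀ * c₀) with hκ
  have hκpos : 0 < κ := by positivity
  set b := M * (24 * √a₁ * e + 288 * e ^ 2) + 6 * w with hb
  have hb0 : 0 ≤ b := by positivity
  refine ⟨κ, M * (2 * a₁ + 1152 * e ^ 2), b ^ 2 * κ, hκpos, by positivity, by positivity, ?_⟩
  intro s cells m α ωU ωV hmesh hα hU hV x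
  have hm : (0 : ℝ) < m := by exact_mod_cast hmesh.one_le
  obtain ⟨hE1, hE2⟩ := gridEnergy_scaleVec hA hB hC hmesh ha₀ hα x
  have hdiff := norm_hform_stiffness_sub_scaledPrecond_le hA hB hC hmesh ha₀ hα hL x
  have hconv := norm_hform_convMatrix_le s cells ωU ωV hU hV (by positivity) x
  have hn := normSqSum_le_scaleVec hA hB hC hmesh ha₀ hα x
  rw [hform_sub, hform_add]
  set P := hform (scaledPrecond (stiffness s cells A B C α) (stiffness s cells A B C fun _ => 1)) x
    with hP
  have hPy : P = hform (stiffness s cells A B C fun _ => 1) (scaleVec s (stiffness s cells A B C α)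
    (stiffness s cells A B C fun _ => 1) x) := hform_scaledPrecond _ _ x
  set y := scaleVec s (stiffness s cells A B C α) (stiffness s cells A B C fun _ => 1) x with hy
  set G := gridEnergy cells (zeroExt s x) with hG
  set Gy := gridEnergy cells (zeroExt s y) with hGy
  set n₂ := normSqSum x with hn₂
  have hG0 : 0 ≤ G := gridEnergy_nonneg _ _
  have hGy0 : 0 ≤ Gy := gridEnergy_nonneg _ _
  have hn0 : 0 ≤ n₂ := normSqSum_nonneg _
  have hP1 : c₀ * Gy ≤ P.re := by
    have := mul_gridEnergy_le_stiffness (α := fun _ => (1 : ℝ)) (s := s) (cells := cells) hA hB hC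
      zero_le_one (fun _ _ => le_rfl) y
    rw [one_mul] at this
    rwa [hPy]
  have hP2 : P.re ≤ M * Gy := by
    have := norm_stiffness_le (A := A) (B := B) (C := C) (α := fun _ => (1 : ℝ)) (s := s)
      (cells := cells) (a₁ := 1) (fun _ _ => by simp) y
    rw [one_mul] at this
    rw [hPy]
    exact (Complex.re_le_norm _).trans this
  have hx := normSqSum_le_gridEnergy hmesh x
  have hyn := normSqSum_le_gridEnergy hmesh y
  have hem : ∀ t : ℝ, 0 ≤ t → ∀ g : ℝ, t ≤ 16 * m ^ 2 * g →
      72 * (e / m) ^ 2 * t ≤ 1152 * e ^ 2 * g := by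
    intro t ht g h
    calc 72 * (e / m) ^ 2 * t ≤ 72 * (e / m) ^ 2 * (16 * m ^ 2 * g) := by gcongr
      _ = _ := by field_simp; ring
  have hGP : G ≤ κ * P.re := by
    -- the lower order term is bounded by the energy of the scaled vector, not by `G` itself
    have h1 : n₂ ≤ 16 * m ^ 2 * (Gy / a₀) := by
      rw [mul_div_assoc', le_div_iff₀ ha₀]
      linarith
    have h2 := hem n₂ hn0 _ h1
    have h3 : a₀ * G ≤ (2 + 1152 * e ^ 2 / a₀) * Gy := by
      calc _ ≤ _ := hE2
        _ ≤ 2 * Gy + 1152 * e ^ 2 * (Gy / a₀) := by gcongr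
        _ = _ := by field_simp
    calc G = (a₀ * G) / a₀ := by field_simp
      _ ≤ ((2 + 1152 * e ^ 2 / a₀) * Gy) / a₀ := by gcongr
      _ = κ * (c₀ * Gy) := by rw [hκ]; field_simp
      _ ≤ κ * P.re := by gcongr
  refine ⟨hGP, ?_, ?_⟩
  · calc P.re ≤ M * Gy := hP2
      _ ≤ M * (2 * a₁ * G + 1152 * e ^ 2 * G) := by
        gcongr
        exact hE1.trans (add_le_add le_rfl (hem n₂ hn0 G hx))
      _ = _ := by ring
  · have h1 : (m : ℝ)⁻¹ * n₂ ≤ 4 * √(G * n₂) := by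
      rw [inv_mul_le_iff₀ hm]
      have h3 : n₂ ≤ √((4 * m) ^ 2 * (G * n₂)) := Real.le_sqrt_of_sq_le (by nlinarith)
      rw [Real.sqrt_mul (by positivity), Real.sqrt_sq (by positivity)] at h3
      linarith
    have h4 : ‖hform (stiffness s cells A B C α) x + hform (convMatrix s cells ωU ωV) x - P‖ ≤
        b / m * √(G * n₂) := by
      calc _ = ‖(hform (stiffness s cells A B C α) x - P) +
              hform (convMatrix s cells ωU ωV) x‖ := by
            congr 1; ring
        _ ≤ M * (24 * √a₁ * (e / m) * √(G * n₂) + 72 * (e / m) ^ 2 * n₂) +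
            6 * (w / m) * √(G * n₂) := (norm_add_le _ _).trans (add_le_add hdiff hconv)
        _ = M * (24 * √a₁ * (e / m) * √(G * n₂) + 72 * (e ^ 2 / m) * ((m : ℝ)⁻¹ * n₂)) +
            6 * (w / m) * √(G * n₂) := by field_simp
        _ ≤ M * (24 * √a₁ * (e / m) * √(G * n₂) + 72 * (e ^ 2 / m) * (4 * √(G * n₂))) +
            6 * (w / m) * √(G * n₂) := by gcongr
        _ = _ := by rw [hb]; field_simp; ring
    calc _ ≤ (b / m * √(G * n₂)) ^ 2 := by gcongr
      _ = b ^ 2 * (n₂ / m ^ 2) * G := by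
          rw [mul_pow, Real.sq_sqrt (by positivity)]; field_simp
      _ ≤ b ^ 2 * (n₂ / m ^ 2) * (κ * P.re) := by gcongr
      _ = _ := by ring

theorem hform_re_pos_of_gridEnergy_le {s : Finset (ℤ × ℤ)} {cells : Finset Cell} {m : ℕ}
    (hmesh : IsLatticeMesh s cells m) {P : Matrix s s ℝ} {κ : ℝ} (hκ : 0 < κ)
    (h : ∀ x, gridEnergy cells (zeroExt s x) ≤ κ * (hform P x).re) (x : s → ℂ) (hx : x ≠ 0) :
    0 < (hform P x).re := by
  have h1 : 0 < normSqSum x := by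
    obtain ⟨i, hi⟩ := Function.ne_iff.1 hx
    exact Finset.sum_pos' (fun _ _ => sq_nonneg _)
      ⟨i, Finset.mem_univ _, by have : 0 < ‖x i‖ := norm_pos_iff.2 hi
                                positivity⟩
  have h2 := normSqSum_le_gridEnergy hmesh x
  have hm : (0 : ℝ) < m := by exact_mod_cast hmesh.one_le
  have h3 : 0 < gridEnergy cells (zeroExt s x) := by
    by_contra hc
    nlinarith [gridEnergy_nonneg cells (zeroExt s x), sq_nonneg (m : ℝ)]
  have h4 := h x
  by_contra hc
  nlinarith

/-- Clustering for matrices whose difference from the preconditioner is a form of lower order. The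
finitely many meshes coarser than the block size are absorbed in the constant. -/
theorem properlyClustered_of_form_bounds {s : ℕ → Finset (ℤ × ℤ)} {cells : ℕ → Finset Cell}
    {X A P : ∀ m, Matrix (s m) (s m) ℝ} {κ c : ℝ} (hκ : 0 < κ) (hc : 0 ≤ c) (m₀ : ℕ)
    (hmesh : ∀ m ≥ m₀, IsLatticeMesh (s m) (cells m) m) (hX : ∀ m ≥ m₀, X m = (P m)⁻¹ * A m)
    (hs : ∀ m ≥ m₀, (P m).IsSymm)
    (hP : ∀ m ≥ m₀, ∀ x, gridEnergy (cells m) (zeroExt (s m) x) ≤ κ * (hform (P m) x).re)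
    (hA : ∀ m ≥ m₀, ∀ x, ‖hform (A m - P m) x‖ ^ 2 ≤
      c * (normSqSum x / m ^ 2) * (hform (P m) x).re) :
    ProperlyClustered X 1 := by
  classical
  intro ε hε
  -- with `R` blocks in each direction, the gradient term of Poincaré's inequality contributes at
  -- most half of the `ε ^ 2` that an eigenvalue outside of the disk requires
  obtain ⟨R, hR⟩ := exists_nat_gt (max 1 (200 * c * κ / ε ^ 2))
  have hR1 : (1 : ℝ) < R := (le_max_left _ _).trans_lt hR
  have hR0 : 0 < R := by
    have : (0 : ℝ) < R := by linarith
    exact_mod_cast this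
  set bound : ℝ := 2 * c * (Fintype.card (Fin R × Fin R) * (32 * κ)) / ε ^ 2 with hbound
  refine ⟨(∑ k ∈ Finset.range (m₀ + R), (s k).card) + ⌈bound⌉₊, fun m => ?_⟩
  by_cases hm : m < m₀ + R
  · refine (Multiset.card_le_card (by apply Multiset.filter_le)).trans ?_
    refine (card_complexEigenvalues_le _).trans ?_
    rw [Fintype.card_coe]
    refine le_trans ?_ (Nat.le_add_right _ _)
    exact Finset.single_le_sum (f := fun k => (s k).card) (fun _ _ => Nat.zero_le _)
      (Finset.mem_range.2 hm)
  · have hmm₀ : m ≥ m₀ := by omega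
    have hmR : R ≤ m := by omega
    have hmesh' := hmesh m hmm₀
    have hmpos : (0 : ℝ) < m := by exact_mod_cast hmesh'.one_le
    -- the side of the blocks
    set b : ℕ := (2 * m + 2) / R + 1 with hb
    have hRb : 2 * m + 2 ≤ R * b := by
      have := Nat.lt_mul_div_succ (2 * m + 2) hR0
      rw [hb]; omega
    have hbm : (b : ℝ) ≤ 5 * m / R := by
      have h1 : (((2 * m + 2) / R : ℕ) : ℝ) ≤ ((2 * m + 2 : ℕ) : ℝ) / R := Nat.cast_div_le
      have h2 : (R : ℝ) ≤ m := by exact_mod_cast hmR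
      rw [hb]
      push_cast at h1 ⊢
      have h3 : (2 * (m : ℝ) + 2) / R + 1 = (2 * m + 2 + R) / R := by field_simp
      have h4 : (1 : ℝ) ≤ m := by exact_mod_cast hmesh'.one_le
      calc _ ≤ (2 * (m : ℝ) + 2) / R + 1 := by linarith
        _ = (2 * m + 2 + R) / R := h3
        _ ≤ _ := by gcongr; linarith
    have hcount := card_eigenvalues_notMem_ball_le (A m) (P m) (hs m hmm₀)
      (hform_re_pos_of_gridEnergy_le hmesh' hκ (hP m hmm₀))
      (fun b' : Fin R × Fin R => ((√2 / m : ℝ) : ℂ) • blockFunctional (s m) m b b')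
      (fun x => normSqSum x / m ^ 2) (c := c) (δ := 100 * κ / R ^ 2) (S := 32 * κ) (ε := ε)
      hc (by positivity) hε ?_ (hA m hmm₀) ?_ ?_
    · rw [hX m hmm₀]
      have h1 := hcount.trans (Nat.le_ceil bound)
      have h2 := Nat.cast_le.1 h1
      refine le_trans ?_ (Nat.le_add_left _ _)
      convert h2
    · have h1 : 200 * c * κ / ε ^ 2 < R := (le_max_right _ _).trans_lt hR
      have h2 : (R : ℝ) ≤ R ^ 2 := by nlinarith
      rw [div_lt_iff₀ (by positivity)] at h1
      rw [mul_div_assoc', div_le_iff₀ (by positivity)]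
      nlinarith [sq_nonneg ε]
    · intro x
      have h1 := normSqSum_le_blocks (s m) (cells m) hRb hmesh'.box hmesh'.mem_cells x
      have h2 := hP m hmm₀ x
      have h3 : ∀ b' : Fin R × Fin R, ‖(((√2 / m : ℝ) : ℂ) • blockFunctional (s m) m b b') x‖ ^ 2 =
          2 / m ^ 2 * ‖blockFunctional (s m) m b b' x‖ ^ 2 := by
        intro b'
        rw [LinearMap.smul_apply, norm_smul, mul_pow, Complex.norm_real, Real.norm_eq_abs, sq_abs,
          div_pow, Real.sq_sqrt (by norm_num)]
      simp only [h3]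
      rw [← Finset.mul_sum, div_le_iff₀ (by positivity)]
      refine h1.trans ?_
      have h5 : 4 * (b : ℝ) ^ 2 * gridEnergy (cells m) (zeroExt (s m) x) ≤
          4 * (5 * m / R) ^ 2 * (κ * (hform (P m) x).re) := by
        gcongr
        exact gridEnergy_nonneg _ _
      refine (add_le_add_left h5 _).trans (le_of_eq ?_)
      have : (R : ℝ) ≠ 0 := by positivity
      field_simp
      ring
    · intro b' x
      have h1 := norm_blockFunctional_sq_le (s m) hRb hmesh'.box b' x
      have h2 := normSqSum_le_gridEnergy hmesh' x
      rw [LinearMap.smul_apply, norm_smul, mul_pow, Complex.norm_real, Real.norm_eq_abs, sq_abs,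
          div_pow, Real.sq_sqrt (by norm_num)]
      calc _ ≤ 2 / (m : ℝ) ^ 2 * (16 * m ^ 2 * gridEnergy (cells m) (zeroExt (s m) x)) := by
            gcongr; exact h1.trans h2
        _ = 32 * gridEnergy (cells m) (zeroExt (s m) x) := by field_simp; ring
        _ ≤ 32 * (κ * (hform (P m) x).re) := by gcongr; exact hP m hmm₀ x
        _ = _ := by ring

/-- The abstract result: coefficients per triangle and convection moments with the natural
bounds yield the cluster, and the rectangle on those meshes where the real part of the convection
form is not too negative. -/
theorem cluster_and_rectangle {A B C a₀ a₁ L w : ℝ} (hA : 0 < A) (hB : 0 < B) (hC : C ^ 2 < A * B)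
    (ha₀ : 0 < a₀) (ha₁ : 0 < a₁) (hL : 0 ≤ L) (hw : 0 ≤ w)
    {s : ℕ → Finset (ℤ × ℤ)} {cells : ℕ → Finset Cell} {X : ∀ m, Matrix (s m) (s m) ℝ}
    {α : ℕ → Cell → ℝ} {ωU ωV : ℕ → Cell → Fin 3 → ℝ} (m₀ : ℕ)
    (hmesh : ∀ m ≥ m₀, IsLatticeMesh (s m) (cells m) m)
    (hα : ∀ m ≥ m₀, IsCellCoefficient (s m) (cells m) m (α m) a₀ a₁ L)
    (hU : ∀ m ≥ m₀, ∀ K ∈ cells m, ∀ l, |ωU m K l| ≤ w / m)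
    (hV : ∀ m ≥ m₀, ∀ K ∈ cells m, ∀ l, |ωV m K l| ≤ w / m)
    (hX : ∀ m ≥ m₀, X m = (scaledPrecond (stiffness (s m) (cells m) A B C (α m))
      (stiffness (s m) (cells m) A B C fun _ => 1))⁻¹ *
      (stiffness (s m) (cells m) A B C (α m) + convMatrix (s m) (cells m) (ωU m) (ωV m))) :
    ProperlyClustered X 1 ∧ ∃ d D δ : ℝ, 0 < d ∧ ∀ m ≥ m₀,
      (∀ x, -(a₀ * ((A * B - C ^ 2) / (A + B)) / 2) * gridEnergy (cells m) (zeroExt (s m) x) ≤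
        (hform (convMatrix (s m) (cells m) (ωU m) (ωV m)) x).re) →
      ∀ z ∈ complexEigenvalues (X m), d ≤ z.re ∧ z.re ≤ D ∧ |z.im| ≤ δ := by
  obtain ⟨κ, μ, c, hκ, hμ, hc, hb⟩ := exists_form_bounds hA hB hC ha₀ ha₁ hL hw
  constructor
  · exact properlyClustered_of_form_bounds hκ hc m₀ hmesh hX
      (fun m _ => isSymm_scaledPrecond _ _ (isSymm_stiffness _ _ _ _ _ _))
      (fun m hm x => (hb _ _ m _ _ _ (hmesh m hm) (hα m hm) (hU m hm) (hV m hm) x).1)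
      (fun m hm x => (hb _ _ m _ _ _ (hmesh m hm) (hα m hm) (hU m hm) (hV m hm) x).2.2)
  · set c₀ := (A * B - C ^ 2) / (A + B) with hc₀
    have hc₀pos : 0 < c₀ := div_pos (by linarith) (by linarith)
    set D := (a₁ * (|A| + |B| + |C|) + 24 * w) * κ with hD
    refine ⟨a₀ * c₀ / 2 / μ, D, D, by positivity, fun m hm hre z hz => ?_⟩
    have hbm := hb _ _ m _ _ _ (hmesh m hm) (hα m hm) (hU m hm) (hV m hm)
    rw [hX m hm] at hz
    obtain ⟨x, hx1, rfl⟩ := exists_eq_hform_of_mem_complexEigenvalues _ _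
      (isSymm_scaledPrecond _ _ (isSymm_stiffness _ _ _ _ _ _))
      (hform_re_pos_of_gridEnergy_le (hmesh m hm) hκ fun x => (hbm x).1) hz
    obtain ⟨h1, h2, -⟩ := hbm x
    rw [hx1, Complex.one_re] at h1 h2
    have hT := mul_gridEnergy_le_stiffness hA hB hC ha₀.le (hα m hm).lower x
    have hT2 := norm_stiffness_le (A := A) (B := B) (C := C) (a₁ := a₁) (fun K hK =>
      abs_le.2 ⟨by linarith [(hα m hm).lower K hK], (hα m hm).upper K hK⟩) x
    have hmpos : (0 : ℝ) < m := by exact_mod_cast (hmesh m hm).one_le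
    have hΨ : ‖hform (convMatrix (s m) (cells m) (ωU m) (ωV m)) x‖ ≤
        24 * w * gridEnergy (cells m) (zeroExt (s m) x) := by
      refine (norm_hform_convMatrix_le _ _ _ _ (hU m hm) (hV m hm) (by positivity) x).trans ?_
      calc _ ≤ 6 * (w / m) * (4 * m * gridEnergy (cells m) (zeroExt (s m) x)) := by
            gcongr; exact sqrt_gridEnergy_mul_normSqSum_le (hmesh m hm) x
        _ = _ := by field_simp; ring
    have hnorm : ‖hform (stiffness (s m) (cells m) A B C (α m) +
        convMatrix (s m) (cells m) (ωU m) (ωV m)) x‖ ≤ D := by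
      rw [hform_add]
      refine (norm_add_le _ _).trans ?_
      calc _ ≤ (a₁ * (|A| + |B| + |C|) + 24 * w) * gridEnergy (cells m) (zeroExt (s m) x) := by
            linarith
        _ ≤ (a₁ * (|A| + |B| + |C|) + 24 * w) * (κ * 1) := by gcongr
        _ = D := by rw [mul_one]
    refine ⟨?_, (Complex.re_le_norm _).trans hnorm, (Complex.abs_im_le_norm _).trans hnorm⟩
    rw [hform_add, Complex.add_re, div_le_iff₀ hμ]
    have h3 := hre x
    have h4 : a₀ * c₀ / 2 ≤ a₀ * c₀ / 2 * (μ * gridEnergy (cells m) (zeroExt (s m) x)) :=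
      le_mul_of_one_le_right (by positivity) h2
    nlinarith

/-! ### Shape functions and geometry of the triangles -/

namespace GridMesh

variable (M : GridMesh)

/-- The gradient of the first lattice coordinate. -/
def gradS : Plane := !₂[M.v 1 / cross M.u M.v, -M.v 0 / cross M.u M.v]

/-- The gradient of the second lattice coordinate. -/
def gradT : Plane := !₂[-M.u 1 / cross M.u M.v, M.u 0 / cross M.u M.v]

theorem plane_inner (x y : Plane) : ⟪x, y⟫_ℝ = x 0 * y 0 + x 1 * y 1 := by
  simp [PiLp.inner_apply, Fin.sum_univ_two, mul_comm]

theorem coordS_sub (x y : Plane) : M.coordS x - M.coordS y = ⟪M.gradS, x - y⟫_ℝ := by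
  simp [plane_inner, coordS, gradS, cross]; ring

theorem coordT_sub (x y : Plane) : M.coordT x - M.coordT y = ⟪M.gradT, x - y⟫_ℝ := by
  simp [plane_inner, coordT, gradT, cross]; ring

/-- The barycentric coordinate of a triangle that belongs to its `k`-th vertex. -/
def shape (K : Cell) (k : Fin 3) (x : Plane) : ℝ :=
  if K.2 then ![1 - (M.coordT x - K.1.2), (M.coordT x - K.1.2) - (M.coordS x - K.1.1),
      M.coordS x - K.1.1] k
    else ![1 - (M.coordS x - K.1.1), (M.coordS x - K.1.1) - (M.coordT x - K.1.2),
      M.coordT x - K.1.2] k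

/-- The gradient of a barycentric coordinate. -/
def shapeGrad (t : Bool) (k : Fin 3) : Plane := edgeU t k • M.gradS + edgeV t k • M.gradT

theorem shape_eq_add_inner (K : Cell) (k : Fin 3) (x y : Plane) :
    M.shape K k x = M.shape K k y + ⟪M.shapeGrad K.2 k, x - y⟫_ℝ := by
  have hS := M.coordS_sub x y
  have hT := M.coordT_sub x y
  unfold shapeGrad
  rw [inner_add_left, inner_smul_left, inner_smul_left, ← hS, ← hT]
  obtain ⟨p, t⟩ := K
  cases t <;> fin_cases k <;> simp [shape, edgeU, edgeV] <;> ring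

theorem sum_shape (K : Cell) (x : Plane) : ∑ k, M.shape K k x = 1 := by
  obtain ⟨p, t⟩ := K
  cases t <;> simp [shape, Fin.sum_univ_three]

theorem hasGradientAt_shape (K : Cell) (k : Fin 3) (x : Plane) :
    HasGradientAt (M.shape K k) (M.shapeGrad K.2 k) x := by
  have h1 : M.shape K k = fun y => M.shape K k 0 + ⟪M.shapeGrad K.2 k, y⟫_ℝ := by
    funext y
    rw [M.shape_eq_add_inner K k y 0, sub_zero]
  rw [h1, hasGradientAt_iff_hasFDerivAt]
  exact (InnerProductSpace.toDual ℝ Plane (M.shapeGrad K.2 k)).hasFDerivAt.const_add _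

theorem continuous_shape (K : Cell) (k : Fin 3) : Continuous (M.shape K k) :=
  continuous_iff_continuousAt.2 fun x => (M.hasGradientAt_shape K k x).continuousAt

/-- The open triangle `K`. -/
def openTriangle (K : Cell) : Set Plane := {x | ∀ k, 0 < M.shape K k x}

theorem isOpen_openTriangle (K : Cell) : IsOpen (M.openTriangle K) := by
  have : M.openTriangle K = ⋂ k, {x | 0 < M.shape K k x} := by ext; simp [openTriangle]
  rw [this]
  exact isOpen_iInter_of_finite fun k => isOpen_lt continuous_const (M.continuous_shape K k)

theorem shape_node (h : cross M.u M.v ≠ 0) (K : Cell) (k l : Fin 3) :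
    M.shape K k (M.node (K.vertex l)) = if k = l then 1 else 0 := by
  obtain ⟨p, t⟩ := K
  unfold shape
  rw [M.coordS_node h, M.coordT_node h]
  cases t <;> fin_cases k <;> fin_cases l <;> simp [Cell.vertex]

theorem sum_shape_smul_node (h : cross M.u M.v ≠ 0) (K : Cell) (x : Plane) :
    ∑ k, M.shape K k x • M.node (K.vertex k) = x := by
  conv_rhs => rw [M.coords_eq h x]
  obtain ⟨p, t⟩ := K
  ext i
  cases t <;> simp [shape, Fin.sum_univ_three, node, Cell.vertex] <;> ring

theorem mem_triangle_iff (h : cross M.u M.v ≠ 0) (K : Cell) (x : Plane) :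
    x ∈ M.triangle K ↔ ∀ k, 0 ≤ M.shape K k x := by
  constructor
  · intro hx
    have := M.coords_of_mem_triangle h K x hx
    obtain ⟨p, t⟩ := K
    cases t
    · simp only [Bool.false_eq_true, if_false] at this
      intro k
      fin_cases k <;> simp [shape] <;> linarith
    · simp only [if_true] at this
      intro k
      fin_cases k <;> simp [shape] <;> linarith
  · intro hx
    rw [← M.sum_shape_smul_node h K x]
    exact (convex_convexHull ℝ _).sum_mem (fun k _ => hx k) (M.sum_shape K x)
      fun k _ => subset_convexHull ℝ _ (mem_range_self k)

theorem node_mem_triangle (K : Cell) (k : Fin 3) : M.node (K.vertex k) ∈ M.triangle K :=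
  subset_convexHull ℝ _ (mem_range_self k)

theorem isCompact_triangle (K : Cell) : IsCompact (M.triangle K) :=
  (finite_range _).isCompact_convexHull ℝ

theorem openTriangle_subset_triangle (h : cross M.u M.v ≠ 0) (K : Cell) :
    M.openTriangle K ⊆ M.triangle K :=
  fun x hx => (M.mem_triangle_iff h K x).2 fun k => (hx k).le

theorem shape_mem_Icc (h : cross M.u M.v ≠ 0) (K : Cell) (k : Fin 3) {x : Plane}
    (hx : x ∈ M.triangle K) : 0 ≤ M.shape K k x ∧ M.shape K k x ≤ 1 := by
  rw [M.mem_triangle_iff h] at hx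
  refine ⟨hx k, ?_⟩
  rw [← M.sum_shape K x]
  exact Finset.single_le_sum (fun l _ => hx l) (Finset.mem_univ k)

theorem barycenter_mem_openTriangle (h : cross M.u M.v ≠ 0) (K : Cell) :
    M.barycenter K ∈ M.openTriangle K := by
  intro k
  have h1 : ∀ l, M.shape K k (M.barycenter K) = M.shape K k (M.node (K.vertex l)) +
      ⟪M.shapeGrad K.2 k, M.barycenter K - M.node (K.vertex l)⟫_ℝ :=
    fun l => M.shape_eq_add_inner K k _ _
  have h2 : ∑ l, (M.barycenter K - M.node (K.vertex l)) = 0 := by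
    rw [Finset.sum_sub_distrib, Finset.sum_const, Finset.card_univ, Fintype.card_fin, barycenter,
      ← Nat.cast_smul_eq_nsmul ℝ, smul_smul]
    norm_num
  have h3 : ∑ _l : Fin 3, M.shape K k (M.barycenter K) = 1 := by
    rw [Finset.sum_congr rfl fun l _ => h1 l, Finset.sum_add_distrib, ← inner_sum, h2]
    simp [M.shape_node h]
  simp only [Finset.sum_const, Finset.card_univ, Fintype.card_fin, nsmul_eq_mul] at h3
  push_cast at h3
  linarith

theorem triangle_subset_closure_openTriangle (h : cross M.u M.v ≠ 0) (K : Cell) :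
    M.triangle K ⊆ closure (M.openTriangle K) := by
  intro x hx
  set y := M.barycenter K with hy
  have hyo := M.barycenter_mem_openTriangle h K
  have h1 : Tendsto (fun t : ℝ => x + t • (y - x)) (𝓝[>] 0) (𝓝 x) := by
    have : Continuous fun t : ℝ => x + t • (y - x) := by fun_prop
    have h2 := (this.tendsto 0).mono_left (nhdsWithin_le_nhds (s := Ioi 0))
    simpa using h2
  refine mem_closure_of_tendsto h1 ?_
  filter_upwards [Ioo_mem_nhdsGT (zero_lt_one : (0 : ℝ) < 1)] with t ht k
  have h3 := M.shape_eq_add_inner K k (x + t • (y - x)) x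
  have h4 := M.shape_eq_add_inner K k y x
  rw [add_sub_cancel_left, inner_smul_right] at h3
  have h5 := (M.mem_triangle_iff h K x).1 hx k
  have h6 := hyo k
  rw [h3]
  have h7 : ⟪M.shapeGrad K.2 k, y - x⟫_ℝ = M.shape K k y - M.shape K k x := by linarith
  rw [h7]
  nlinarith [ht.1, ht.2, mul_pos ht.1 h6, mul_nonneg (sub_nonneg.2 ht.2.le) h5]

/-! ### Hat functions on a triangle -/

/-- The hat function on the lower triangle of a lattice cell, in the coordinates of that cell. -/
theorem hat_lattice_eq (a b : ℤ) {S T : ℝ} (h0 : 0 ≤ T) (h1 : T ≤ S) (h2 : S ≤ 1) :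
    max 0 (1 - max |S - a| (max |T - b| |(S - a) - (T - b)|)) =
      (if a = 0 ∧ b = 0 then 1 - S else 0) + (if a = 1 ∧ b = 0 then S - T else 0) +
        (if a = 1 ∧ b = 1 then T else 0) := by
  by_cases ha : a = 0 ∧ b = 0
  · obtain ⟨rfl, rfl⟩ := ha
    simp only [Int.cast_zero, sub_zero]
    rw [abs_of_nonneg (h0.trans h1), abs_of_nonneg h0, abs_of_nonneg (sub_nonneg.2 h1),
      max_eq_left (max_le h1 (by linarith)), max_eq_right (by linarith)]
    simp
  by_cases hb : a = 1 ∧ b = 0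
  · obtain ⟨rfl, rfl⟩ := hb
    simp only [Int.cast_zero, Int.cast_one, sub_zero]
    rw [abs_of_nonpos (by linarith : S - 1 ≤ 0), abs_of_nonneg h0,
      abs_of_nonpos (by linarith : S - 1 - T ≤ 0),
      max_eq_right (le_max_of_le_right (by linarith)),
      max_eq_right (by linarith : T ≤ -(S - 1 - T)), max_eq_right (by linarith)]
    simp
    ring
  by_cases hc : a = 1 ∧ b = 1
  · obtain ⟨rfl, rfl⟩ := hc
    simp only [Int.cast_one]
    rw [abs_of_nonpos (by linarith : S - 1 ≤ 0), abs_of_nonpos (by linarith : T - 1 ≤ 0),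
      abs_of_nonneg (by linarith : 0 ≤ S - 1 - (T - 1)),
      max_eq_right (le_max_of_le_left (by linarith)),
      max_eq_left (by linarith : S - 1 - (T - 1) ≤ -(T - 1)), max_eq_right (by linarith)]
    simp
  rw [if_neg ha, if_neg hb, if_neg hc, max_eq_left]
  · simp
  rw [sub_nonpos]
  simp only [le_max_iff]
  have hcases : a ≤ -1 ∨ 2 ≤ a ∨ b ≤ -1 ∨ 2 ≤ b ∨ a - b ≤ -1 := by omega
  rcases hcases with h | h | h | h | h
  · have h' : (a : ℝ) ≤ -1 := by exact_mod_cast h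
    left; rw [le_abs]; left; linarith
  · have h' : (2 : ℝ) ≤ a := by exact_mod_cast h
    left; rw [le_abs]; right; linarith
  · have h' : (b : ℝ) ≤ -1 := by exact_mod_cast h
    right; left; rw [le_abs]; left; linarith
  · have h' : (2 : ℝ) ≤ b := by exact_mod_cast h
    right; left; rw [le_abs]; right; linarith
  · have h' : (a : ℝ) - b ≤ -1 := by exact_mod_cast h
    right; right; rw [le_abs]; left; linarith

theorem hat_eq_sum_shape (h : cross M.u M.v ≠ 0) (p : ℤ × ℤ) (K : Cell) {x : Plane}
    (hx : x ∈ M.triangle K) :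
    M.hat p x = ∑ k, if K.vertex k = p then M.shape K k x else 0 := by
  have hc := M.coords_of_mem_triangle h K x hx
  obtain ⟨⟨q1, q2⟩, t⟩ := K
  obtain ⟨p1, p2⟩ := p
  cases t
  · simp only [Bool.false_eq_true, if_false] at hc
    have := hat_lattice_eq (p1 - q1) (p2 - q2) hc.1 hc.2.1 hc.2.2
    push_cast at this
    simp only [sub_sub_sub_cancel_right] at this
    rw [hat, this]
    have e1 : (p1 - q1 = 0 ∧ p2 - q2 = 0) ↔ ((q1, q2) : ℤ × ℤ) = (p1, p2) := by
      rw [Prod.mk.injEq]; omega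
    have e2 : (p1 - q1 = 1 ∧ p2 - q2 = 0) ↔ ((q1, q2) + (1, 0) : ℤ × ℤ) = (p1, p2) := by
      rw [Prod.mk_add_mk, Prod.mk.injEq]; omega
    have e3 : (p1 - q1 = 1 ∧ p2 - q2 = 1) ↔ ((q1, q2) + (1, 1) : ℤ × ℤ) = (p1, p2) := by
      rw [Prod.mk_add_mk, Prod.mk.injEq]; omega
    simp only [e1, e2, e3]
    simp [Fin.sum_univ_three, Cell.vertex, shape]
  · simp only [if_true] at hc
    have := hat_lattice_eq (p2 - q2) (p1 - q1) hc.1 hc.2.1 hc.2.2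
    push_cast at this
    simp only [sub_sub_sub_cancel_right] at this
    rw [hat, max_left_comm, abs_sub_comm (M.coordS x - p1), this]
    have e1 : (p2 - q2 = 0 ∧ p1 - q1 = 0) ↔ ((q1, q2) : ℤ × ℤ) = (p1, p2) := by
      rw [Prod.mk.injEq]; omega
    have e2 : (p2 - q2 = 1 ∧ p1 - q1 = 0) ↔ ((q1, q2) + (0, 1) : ℤ × ℤ) = (p1, p2) := by
      rw [Prod.mk_add_mk, Prod.mk.injEq]; omega
    have e3 : (p2 - q2 = 1 ∧ p1 - q1 = 1) ↔ ((q1, q2) + (1, 1) : ℤ × ℤ) = (p1, p2) := by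
      rw [Prod.mk_add_mk, Prod.mk.injEq]; omega
    simp only [e1, e2, e3]
    simp [Fin.sum_univ_three, Cell.vertex, shape]

/-- The constant gradient of the hat function of `p` on the triangle `K`, expressed by the
barycentric coordinates. -/
def hatGrad (K : Cell) (p : ℤ × ℤ) : Plane :=
  ∑ k, if K.vertex k = p then M.shapeGrad K.2 k else 0

theorem hasGradientAt_hat (h : cross M.u M.v ≠ 0) (p : ℤ × ℤ) (K : Cell) {x : Plane}
    (hx : x ∈ M.openTriangle K) : HasGradientAt (M.hat p) (M.hatGrad K p) x := by
  have h1 : HasGradientAt (fun y => ∑ k, if K.vertex k = p then M.shape K k y else 0)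
      (M.hatGrad K p) x := by
    rw [hasGradientAt_iff_hasFDerivAt, hatGrad, map_sum]
    refine HasFDerivAt.fun_sum fun k _ => ?_
    split_ifs
    · exact (M.hasGradientAt_shape K k x).hasFDerivAt
    · rw [map_zero]; exact hasFDerivAt_const _ _
  refine h1.congr_of_eventuallyEq ?_
  filter_upwards [(M.isOpen_openTriangle K).mem_nhds hx] with y hy
  exact M.hat_eq_sum_shape h p K (M.openTriangle_subset_triangle h K hy)

theorem gradient_hat (h : cross M.u M.v ≠ 0) (p : ℤ × ℤ) (K : Cell) {x : Plane}
    (hx : x ∈ M.openTriangle K) : ∇ (M.hat p) x = M.hatGrad K p :=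
  (M.hasGradientAt_hat h p K hx).gradient

theorem gradOn_eq (h : cross M.u M.v ≠ 0) (K : Cell) (p : ℤ × ℤ) :
    M.gradOn K p = M.hatGrad K p :=
  M.gradient_hat h p K (M.barycenter_mem_openTriangle h K)

/-! ### Integration over the mesh -/

theorem volume_level_set {g : Plane} (hg : g ≠ 0) (c : ℝ) :
    volume {x : Plane | ⟪g, x⟫_ℝ = c} = 0 := by
  rcases eq_empty_or_nonempty {x : Plane | ⟪g, x⟫_ℝ = c} with he | ⟨p, hp⟩
  · rw [he, measure_empty]
  · have hp' : ⟪g, p⟫_ℝ = c := hp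
    have h1 : {x : Plane | ⟪g, x⟫_ℝ = c} = (AffineSubspace.mk' p (ℝ ∙ g)ᗮ : Set Plane) := by
      ext x
      simp only [mem_ofPred_eq, SetLike.mem_coe, AffineSubspace.mem_mk', vsub_eq_sub,
        Submodule.mem_orthogonal_singleton_iff_inner_right, inner_sub_right, hp', sub_eq_zero]
    rw [h1]
    apply Measure.addHaar_affineSubspace
    intro htop
    have h2 : p + g ∈ AffineSubspace.mk' p (ℝ ∙ g)ᗮ := by rw [htop]; exact AffineSubspace.mem_top ..
    rw [AffineSubspace.mem_mk', vsub_eq_sub, add_sub_cancel_left,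
      Submodule.mem_orthogonal_singleton_iff_inner_right] at h2
    exact hg (inner_self_eq_zero.1 h2)

theorem gradS_gradT_indep (h : cross M.u M.v ≠ 0) {a b : ℝ} (hab : a ≠ 0 ∨ b ≠ 0) :
    a • M.gradS + b • M.gradT ≠ 0 := by
  intro h0
  have e0 := congrArg (fun x : Plane => x 0) h0
  have e1 := congrArg (fun x : Plane => x 1) h0
  simp [gradS, gradT] at e0 e1
  field_simp at e0 e1
  have h3 : a * cross M.u M.v = 0 := by
    simp only [cross]
    linear_combination M.u 0 * e0 + M.u 1 * e1
  have h4 : b * cross M.u M.v = 0 := by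
    simp only [cross]
    linear_combination M.v 0 * e0 + M.v 1 * e1
  rcases hab with ha | hb
  · exact (mul_ne_zero ha h) h3
  · exact (mul_ne_zero hb h) h4

theorem shapeGrad_ne_zero (h : cross M.u M.v ≠ 0) (t : Bool) (k : Fin 3) : M.shapeGrad t k ≠ 0 := by
  apply M.gradS_gradT_indep h
  cases t <;> fin_cases k <;> simp [edgeU, edgeV]

theorem ae_coord_ne_int (h : cross M.u M.v ≠ 0) (a b : ℝ) (hab : a ≠ 0 ∨ b ≠ 0) :
    ∀ᵐ x : Plane, ∀ n : ℤ, a * M.coordS x + b * M.coordT x ≠ n := by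
  rw [ae_all_iff]
  intro n
  have h1 : {x : Plane | ¬ (a * M.coordS x + b * M.coordT x ≠ n)} =
      {x | ⟪a • M.gradS + b • M.gradT, x⟫_ℝ = n - a * M.coordS 0 - b * M.coordT 0} := by
    ext x
    have hS := M.coordS_sub x 0
    have hT := M.coordT_sub x 0
    rw [sub_zero] at hS hT
    simp only [mem_ofPred_eq, not_not, inner_add_left, inner_smul_left, ← hS, ← hT]
    simp only [conj_trivial]
    constructor <;> intro h <;> linarith
  rw [ae_iff, h1]
  exact volume_level_set (M.gradS_gradT_indep h hab) _

theorem triangle_ae_eq_openTriangle (h : cross M.u M.v ≠ 0) (K : Cell) :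
    M.triangle K =ᵐ[volume] M.openTriangle K := by
  have h1 : ∀ᵐ x : Plane, ∀ k, M.shape K k x ≠ 0 := by
    rw [ae_all_iff]
    intro k
    have : {x : Plane | ¬ (M.shape K k x ≠ 0)} =
        {x | ⟪M.shapeGrad K.2 k, x⟫_ℝ = - M.shape K k 0} := by
      ext x
      have := M.shape_eq_add_inner K k x 0
      rw [sub_zero] at this
      simp only [mem_ofPred_eq, not_not]
      constructor <;> intro h <;> linarith
    rw [ae_iff, this]
    exact volume_level_set (M.shapeGrad_ne_zero h _ _) _
  rw [eventuallyEq_set]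
  filter_upwards [h1] with x hx
  rw [M.mem_triangle_iff h]
  exact ⟨fun h2 k => lt_of_le_of_ne (h2 k) (hx k).symm, fun h2 k => (h2 k).le⟩

theorem ae_exists_mem_openTriangle (h : cross M.u M.v ≠ 0) :
    ∀ᵐ x : Plane, ∃ K, x ∈ M.openTriangle K := by
  filter_upwards [M.ae_coord_ne_int h 1 0 (by simp), M.ae_coord_ne_int h 0 1 (by simp),
    M.ae_coord_ne_int h 1 (-1) (by simp)] with x hS hT hST
  simp only [one_mul, zero_mul, add_zero, zero_add, neg_mul] at hS hT hST
  have hS0 : 0 < M.coordS x - ⌊M.coordS x⌋ :=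
    lt_of_le_of_ne (sub_nonneg.2 (Int.floor_le _)) fun h => hS ⌊M.coordS x⌋ (by linarith)
  have hT0 : 0 < M.coordT x - ⌊M.coordT x⌋ :=
    lt_of_le_of_ne (sub_nonneg.2 (Int.floor_le _)) fun h => hT ⌊M.coordT x⌋ (by linarith)
  have hS1 := Int.lt_floor_add_one (M.coordS x)
  have hT1 := Int.lt_floor_add_one (M.coordT x)
  rcases lt_trichotomy (M.coordS x - ⌊M.coordS x⌋) (M.coordT x - ⌊M.coordT x⌋) with hlt | heq | hlt
  · refine ⟨((⌊M.coordS x⌋, ⌊M.coordT x⌋), true), fun k => ?_⟩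
    fin_cases k <;> simp [shape, -Int.self_sub_floor] <;> linarith
  · refine absurd ?_ (hST (⌊M.coordS x⌋ - ⌊M.coordT x⌋))
    push_cast
    linarith
  · refine ⟨((⌊M.coordS x⌋, ⌊M.coordT x⌋), false), fun k => ?_⟩
    fin_cases k <;> simp [shape, -Int.self_sub_floor] <;> linarith

theorem openTriangle_bounds {K : Cell} {x : Plane} (hx : x ∈ M.openTriangle K) :
    0 < M.coordS x - K.1.1 ∧ M.coordS x - K.1.1 < 1 ∧ 0 < M.coordT x - K.1.2 ∧
      M.coordT x - K.1.2 < 1 ∧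
      if K.2 then M.coordS x - K.1.1 < M.coordT x - K.1.2
        else M.coordT x - K.1.2 < M.coordS x - K.1.1 := by
  obtain ⟨p, t⟩ := K
  have h0 := hx 0
  have h1 := hx 1
  have h2 := hx 2
  cases t <;> simp [shape] at h0 h1 h2 ⊢ <;> refine ⟨?_, ?_, ?_, ?_, ?_⟩ <;> linarith

theorem eq_of_mem_openTriangle {K K' : Cell} {x : Plane} (hx : x ∈ M.openTriangle K)
    (hx' : x ∈ M.openTriangle K') : K = K' := by
  obtain ⟨a1, a2, a3, a4, a5⟩ := M.openTriangle_bounds hx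
  obtain ⟨b1, b2, b3, b4, b5⟩ := M.openTriangle_bounds hx'
  have int_eq : ∀ (y : ℝ) (i j : ℤ), 0 < y - i → y - i < 1 → 0 < y - j → y - j < 1 → i = j := by
    intro y i j h1 h2 h3 h4
    have h5 : (i : ℝ) < j + 1 := by linarith
    have h6 : (j : ℝ) < i + 1 := by linarith
    have h7 : i < j + 1 := by exact_mod_cast h5
    have h8 : j < i + 1 := by exact_mod_cast h6
    omega
  obtain ⟨⟨p1, p2⟩, t⟩ := K
  obtain ⟨⟨q1, q2⟩, t'⟩ := K'
  obtain rfl : p1 = q1 := int_eq _ _ _ a1 a2 b1 b2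
  obtain rfl : p2 = q2 := int_eq _ _ _ a3 a4 b3 b4
  cases t <;> cases t' <;> simp at a5 b5 ⊢ <;> linarith

theorem setIntegral_eq_sum_triangles (h : cross M.u M.v ≠ 0) {Ω : Set Plane} {cells : Finset Cell}
    (hΩ : ∀ K, ∀ x ∈ M.openTriangle K, x ∈ Ω ↔ K ∈ cells) (f : Plane → ℝ)
    (hf : ∀ K ∈ cells, IntegrableOn f (M.triangle K)) :
    ∫ x in Ω, f x = ∑ K ∈ cells, ∫ x in M.triangle K, f x := by
  have h1 : Ω =ᵐ[volume] ⋃ K ∈ cells, M.openTriangle K := by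
    rw [eventuallyEq_set]
    filter_upwards [M.ae_exists_mem_openTriangle h] with x hx
    obtain ⟨K, hK⟩ := hx
    rw [hΩ K x hK]
    simp only [mem_iUnion, exists_prop]
    exact ⟨fun hc => ⟨K, hc, hK⟩, fun ⟨K', hc, hK'⟩ => M.eq_of_mem_openTriangle hK' hK ▸ hc⟩
  rw [setIntegral_congr_set h1, integral_biUnion_finset]
  · exact Finset.sum_congr rfl fun K _ =>
      (setIntegral_congr_set (M.triangle_ae_eq_openTriangle h K)).symm
  · exact fun K _ => (M.isOpen_openTriangle K).measurableSet
  · intro K _ K' _ hne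
    rw [Function.onFun, Set.disjoint_left]
    exact fun x hx hx' => hne (M.eq_of_mem_openTriangle hx hx')
  · exact fun K hK => (hf K hK).mono_set (M.openTriangle_subset_triangle h K)

end GridMesh

/-! ### Scaling in the mesh parameter -/

/-- The unscaled lattice with the basis `u`, `v`. -/
def refLattice (u v : Plane) : GridMesh where
  origin := 0
  u := u
  v := v
  dom := ∅
  inner := ∅
  cells := ∅

/-- The area of the triangles of the unscaled lattice. -/
def refArea (u v : Plane) : ℝ := volume.real ((refLattice u v).triangle ((0, 0), false))

/-- `M` is the mesh of `Ω` with the lattice directions `u / m` and `v / m`: its triangles are those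
lattice triangles whose interior lies in `Ω`, and the hat functions of its inner nodes vanish
outside of `Ω`. -/
structure IsUniformMesh (Ω : Set Plane) (u v : Plane) (M : GridMesh) (m : ℕ) : Prop where
  lattice : IsLatticeMesh M.inner M.cells m
  u_eq : M.u = (1 / (m : ℝ)) • u
  v_eq : M.v = (1 / (m : ℝ)) • v
  cross_ne : cross u v ≠ 0
  dom_eq : M.dom = Ω
  mem_dom_iff : ∀ K, ∀ x ∈ M.openTriangle K, x ∈ Ω ↔ K ∈ M.cells
  hat_eq_zero : ∀ p ∈ M.inner, ∀ x ∉ Ω, M.hat p x = 0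

namespace IsUniformMesh

open GridMesh

variable {Ω : Set Plane} {u v : Plane} {M : GridMesh} {m : ℕ} (H : IsUniformMesh Ω u v M m)
include H

theorem m_pos : (0 : ℝ) < m := by exact_mod_cast H.lattice.one_le

theorem cross_eq : cross M.u M.v = cross u v / m ^ 2 := by
  rw [H.u_eq, H.v_eq]
  simp [cross]
  field_simp

theorem cross_ne' : cross M.u M.v ≠ 0 := by
  rw [H.cross_eq]
  exact div_ne_zero H.cross_ne (pow_ne_zero _ H.m_pos.ne')

theorem gradS_eq : M.gradS = (m : ℝ) • (refLattice u v).gradS := by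
  have hm := H.m_pos.ne'
  have hc := H.cross_ne
  ext i
  simp only [gradS, H.cross_eq]
  fin_cases i <;> simp [refLattice, H.v_eq] <;> field_simp

theorem gradT_eq : M.gradT = (m : ℝ) • (refLattice u v).gradT := by
  have hm := H.m_pos.ne'
  have hc := H.cross_ne
  ext i
  simp only [gradT, H.cross_eq]
  fin_cases i <;> simp [refLattice, H.u_eq] <;> field_simp

theorem coordS_sub_node (p : ℤ × ℤ) (x : Plane) :
    M.coordS x - p.1 = (refLattice u v).coordS ((m : ℝ) • (x - M.node p)) := by
  have h1 := M.coordS_sub x (M.node p)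
  have h2 := (refLattice u v).coordS_sub ((m : ℝ) • (x - M.node p)) 0
  have h3 : (refLattice u v).coordS 0 = 0 := by simp [coordS, refLattice, cross]
  rw [M.coordS_node H.cross_ne'] at h1
  rw [h1, H.gradS_eq, inner_smul_left]
  rw [h3, sub_zero, sub_zero, inner_smul_right] at h2
  rw [h2]
  simp

theorem coordT_sub_node (p : ℤ × ℤ) (x : Plane) :
    M.coordT x - p.2 = (refLattice u v).coordT ((m : ℝ) • (x - M.node p)) := by
  have h1 := M.coordT_sub x (M.node p)
  have h2 := (refLattice u v).coordT_sub ((m : ℝ) • (x - M.node p)) 0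
  have h3 : (refLattice u v).coordT 0 = 0 := by simp [coordT, refLattice, cross]
  rw [M.coordT_node H.cross_ne'] at h1
  rw [h1, H.gradT_eq, inner_smul_left]
  rw [h3, sub_zero, sub_zero, inner_smul_right] at h2
  rw [h2]
  simp

theorem volume_triangle (K : Cell) : volume (M.triangle K) = ENNReal.ofReal (1 / m ^ 2) *
    volume ((refLattice u v).triangle ((0, 0), false)) := by
  have hm := H.m_pos
  have href : cross (refLattice u v).u (refLattice u v).v ≠ 0 := H.cross_ne
  -- every triangle is the preimage of the reference triangle under a map `x ↦ r • (x - q)`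
  have key : ∃ (r : ℝ) (q : Plane), |r| = m ∧ M.triangle K =
      (fun x => x + -q) ⁻¹' ((fun x => r • x) ⁻¹' ((refLattice u v).triangle ((0, 0), false))) := by
    obtain ⟨p, t⟩ := K
    cases t
    · refine ⟨m, M.node p, abs_of_pos hm, ?_⟩
      ext x
      have hS := H.coordS_sub_node p x
      have hT := H.coordT_sub_node p x
      rw [M.mem_triangle_iff H.cross_ne', mem_preimage, mem_preimage,
        mem_triangle_iff _ href, ← sub_eq_add_neg]
      simp only [shape, hS, hT, Int.cast_zero, sub_zero, Bool.false_eq_true, if_false]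
    · refine ⟨-m, M.node (p + (1, 1)), by rw [abs_neg, abs_of_pos hm], ?_⟩
      ext x
      have hS := H.coordS_sub_node (p + (1, 1)) x
      have hT := H.coordT_sub_node (p + (1, 1)) x
      have hS' := (refLattice u v).coordS_sub ((-(m : ℝ)) • (x - M.node (p + (1, 1)))) 0
      have hT' := (refLattice u v).coordT_sub ((-(m : ℝ)) • (x - M.node (p + (1, 1)))) 0
      have hS'' := (refLattice u v).coordS_sub (((m : ℝ)) • (x - M.node (p + (1, 1)))) 0
      have hT'' := (refLattice u v).coordT_sub (((m : ℝ)) • (x - M.node (p + (1, 1)))) 0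
      have hS0 : (refLattice u v).coordS 0 = 0 := by simp [coordS, refLattice, cross]
      have hT0 : (refLattice u v).coordT 0 = 0 := by simp [coordT, refLattice, cross]
      rw [sub_zero, neg_smul, inner_neg_right, hS0, sub_zero] at hS'
      rw [sub_zero, neg_smul, inner_neg_right, hT0, sub_zero] at hT'
      rw [sub_zero, hS0, sub_zero] at hS''
      rw [sub_zero, hT0, sub_zero] at hT''
      rw [M.mem_triangle_iff H.cross_ne', mem_preimage, mem_preimage,
        mem_triangle_iff _ href, ← sub_eq_add_neg]
      rw [hS''] at hS
      rw [hT''] at hT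
      simp only [Prod.fst_add, Prod.snd_add] at hS hT
      push_cast at hS hT
      simp only [shape, neg_smul, hS', hT', ← hS, ← hT, Fin.forall_fin_succ]
      simp
      constructor <;> rintro ⟨h1, h2, h3⟩ <;> refine ⟨?_, ?_, ?_⟩ <;> linarith
  obtain ⟨r, q, hr, hK⟩ := key
  have hr0 : r ≠ 0 := by
    rintro rfl
    simp at hr
    exact hm.ne hr
  rw [hK, measure_preimage_add_right, Measure.addHaar_preimage_smul _ hr0,
    finrank_euclideanSpace_fin, abs_inv, abs_pow, hr, one_div]

theorem volume_real_triangle (K : Cell) : volume.real (M.triangle K) = refArea u v / m ^ 2 := by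
  rw [Measure.real, H.volume_triangle, ENNReal.toReal_mul, ENNReal.toReal_ofReal (by positivity),
    refArea, Measure.real]
  ring

omit H in
theorem _root_.refArea_pos (hc : cross u v ≠ 0) : 0 < refArea u v := by
  have h1 := (refLattice u v).isOpen_openTriangle ((0, 0), false)
  have h2 : ((refLattice u v).openTriangle ((0, 0), false)).Nonempty :=
    ⟨_, (refLattice u v).barycenter_mem_openTriangle hc _⟩
  have h3 := h1.measure_pos volume h2
  exact ENNReal.toReal_pos
    (h3.trans_le (measure_mono ((refLattice u v).openTriangle_subset_triangle hc _))).ne'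
    ((refLattice u v).isCompact_triangle _).measure_lt_top.ne

theorem volume_real_triangle_pos (K : Cell) : 0 < volume.real (M.triangle K) := by
  rw [H.volume_real_triangle]
  exact div_pos (refArea_pos H.cross_ne) (pow_pos H.m_pos 2)

theorem diam_triangle_le (K : Cell) : Metric.diam (M.triangle K) ≤ (‖u‖ + ‖v‖) / m := by
  have hm := H.m_pos
  unfold triangle
  rw [convexHull_diam]
  refine Metric.diam_le_of_forall_dist_le (by positivity) ?_
  have key : ∀ k, ∃ a b : ℝ, 0 ≤ a ∧ a ≤ 1 ∧ 0 ≤ b ∧ b ≤ 1 ∧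
      M.node (K.vertex k) = M.node K.1 + a • M.u + b • M.v := by
    intro k
    have h00 : M.node K.1 = M.node K.1 + (0 : ℝ) • M.u + (0 : ℝ) • M.v := by simp
    have h10 : M.node (K.1 + (1, 0)) = M.node K.1 + (1 : ℝ) • M.u + (0 : ℝ) • M.v := by
      simp [node, add_smul]; abel
    have h01 : M.node (K.1 + (0, 1)) = M.node K.1 + (0 : ℝ) • M.u + (1 : ℝ) • M.v := by
      simp [node, add_smul]; abel
    have h11 : M.node (K.1 + (1, 1)) = M.node K.1 + (1 : ℝ) • M.u + (1 : ℝ) • M.v := by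
      simp [node, add_smul]; abel
    fin_cases k
    · exact ⟨0, 0, le_rfl, zero_le_one, le_rfl, zero_le_one, h00⟩
    · by_cases ht : K.2
      · exact ⟨0, 1, le_rfl, zero_le_one, zero_le_one, le_rfl, by simpa [Cell.vertex, ht] using h01⟩
      · exact ⟨1, 0, zero_le_one, le_rfl, le_rfl, zero_le_one, by simpa [Cell.vertex, ht] using h10⟩
    · exact ⟨1, 1, zero_le_one, le_rfl, zero_le_one, le_rfl, h11⟩
  rintro _ ⟨k, rfl⟩ _ ⟨l, rfl⟩
  obtain ⟨a, b, a0, a1, b0, b1, h1⟩ := key k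
  obtain ⟨a', b', a0', a1', b0', b1', h2⟩ := key l
  simp only
  rw [dist_eq_norm, h1, h2, H.u_eq, H.v_eq]
  have e : M.node K.1 + a • (1 / (m : ℝ)) • u + b • (1 / (m : ℝ)) • v -
      (M.node K.1 + a' • (1 / (m : ℝ)) • u + b' • (1 / (m : ℝ)) • v) =
      ((a - a') / m) • u + ((b - b') / m) • v := by
    module
  rw [e]
  refine (norm_add_le _ _).trans ?_
  rw [norm_smul, norm_smul, Real.norm_eq_abs, Real.norm_eq_abs, abs_div, abs_div, abs_of_pos hm,
    add_div, div_mul_eq_mul_div, div_mul_eq_mul_div]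
  have ha : |a - a'| ≤ 1 := abs_le.2 ⟨by linarith, by linarith⟩
  have hb : |b - b'| ≤ 1 := abs_le.2 ⟨by linarith, by linarith⟩
  gcongr
  · exact mul_le_of_le_one_left (norm_nonneg _) ha
  · exact mul_le_of_le_one_left (norm_nonneg _) hb

theorem norm_sub_le_of_mem_triangle {K : Cell} {x y : Plane} (hx : x ∈ M.triangle K)
    (hy : y ∈ M.triangle K) : ‖x - y‖ ≤ (‖u‖ + ‖v‖) / m := by
  rw [← dist_eq_norm]
  exact (Metric.dist_le_diam_of_mem (M.isCompact_triangle K).isBounded hx hy).trans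
    (H.diam_triangle_le K)

theorem triangle_subset_closure {K : Cell} (hK : K ∈ M.cells) : M.triangle K ⊆ closure Ω := by
  refine (M.triangle_subset_closure_openTriangle H.cross_ne' K).trans (closure_mono ?_)
  exact fun x hx => (H.mem_dom_iff K x hx).2 hK

end IsUniformMesh

/-- The Gram coefficient of the first lattice gradient with itself, times the area of a triangle.
In dimension two this product does not depend on the mesh parameter. -/
def gramUU (u v : Plane) : ℝ :=
  refArea u v * ⟪(refLattice u v).gradS, (refLattice u v).gradS⟫_ℝ

/-- The Gram coefficient of the second lattice gradient with itself; see `gramUU`. -/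
def gramVV (u v : Plane) : ℝ :=
  refArea u v * ⟪(refLattice u v).gradT, (refLattice u v).gradT⟫_ℝ

/-- The mixed Gram coefficient of the lattice gradients; see `gramUU`. -/
def gramUV (u v : Plane) : ℝ :=
  refArea u v * ⟪(refLattice u v).gradS, (refLattice u v).gradT⟫_ℝ

theorem gramUU_pos {u v : Plane} (hc : cross u v ≠ 0) : 0 < gramUU u v := by
  have h1 := (refLattice u v).gradS_gradT_indep hc (a := 1) (b := 0) (by simp)
  simp only [one_smul, zero_smul, add_zero] at h1
  exact mul_pos (refArea_pos hc) (real_inner_self_pos.2 h1)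

theorem gramVV_pos {u v : Plane} (hc : cross u v ≠ 0) : 0 < gramVV u v := by
  have h1 := (refLattice u v).gradS_gradT_indep hc (a := 0) (b := 1) (by simp)
  simp only [one_smul, zero_smul, zero_add] at h1
  exact mul_pos (refArea_pos hc) (real_inner_self_pos.2 h1)

theorem gramUV_sq_lt {u v : Plane} (hc : cross u v ≠ 0) :
    gramUV u v ^ 2 < gramUU u v * gramVV u v := by
  set σ := (refLattice u v).gradS with hσ
  set τ := (refLattice u v).gradT with hτ
  have hpos := refArea_pos hc
  have h1 : 0 < cross σ τ ^ 2 := by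
    have : cross σ τ * cross u v = 1 := by
      have e : cross σ τ = v 1 / cross u v * (u 0 / cross u v) -
          -v 0 / cross u v * (-u 1 / cross u v) := rfl
      have hd : cross u v = u 0 * v 1 - u 1 * v 0 := rfl
      rw [e]
      generalize cross u v = c at hc hd
      field_simp
      linarith
    have h2 : cross σ τ ≠ 0 := by
      intro h0; rw [h0, zero_mul] at this; exact zero_ne_one this
    positivity
  -- Lagrange's identity
  have h2 : ⟪σ, σ⟫_ℝ * ⟪τ, τ⟫_ℝ - ⟪σ, τ⟫_ℝ ^ 2 = cross σ τ ^ 2 := by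
    simp only [GridMesh.plane_inner, cross]; ring
  unfold gramUU gramVV gramUV
  rw [← hσ, ← hτ]
  have h3 : 0 < refArea u v ^ 2 * cross σ τ ^ 2 := by positivity
  rw [← h2] at h3
  nlinarith

/-! ### Exact integration and quadrature as element rules -/

/-- A linear functional `J K` for each triangle `K`, stable with constant `W`, that integrates
constants and barycentric coordinates up to the relative error `C / m`. Both the integral and a
quadrature formula of order two are of this kind. -/
structure IsElementRule (M : GridMesh) (m : ℕ) (J : Cell → (Plane → ℝ) → ℝ) (W C : ℝ) : Prop where
  W_nonneg : 0 ≤ W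
  C_nonneg : 0 ≤ C
  congr : ∀ K ∈ M.cells, ∀ f g, EqOn f g (M.triangle K) → J K f = J K g
  add : ∀ K ∈ M.cells, ∀ f g, ContinuousOn f (M.triangle K) → ContinuousOn g (M.triangle K) →
    J K (fun x => f x + g x) = J K f + J K g
  smul : ∀ K ∈ M.cells, ∀ (c : ℝ) f, J K (fun x => c * f x) = c * J K f
  bound : ∀ K ∈ M.cells, ∀ f B, ContinuousOn f (M.triangle K) → (∀ x ∈ M.triangle K, |f x| ≤ B) →
    |J K f| ≤ W * volume.real (M.triangle K) * B
  const : ∀ K ∈ M.cells, |J K (fun _ => 1) - volume.real (M.triangle K)| ≤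
    C / m * volume.real (M.triangle K)
  shape : ∀ K ∈ M.cells, ∀ l, |J K (M.shape K l) - ∫ x in M.triangle K, M.shape K l x| ≤
    C / m * volume.real (M.triangle K)

namespace IsElementRule

variable {M : GridMesh} {m : ℕ} {J : Cell → (Plane → ℝ) → ℝ} {W C : ℝ}

theorem sum (hJ : IsElementRule M m J W C) {K : Cell} (hK : K ∈ M.cells) {ι : Type} (s : Finset ι)
    (c : ι → ℝ) (f : ι → Plane → ℝ) (hf : ∀ i, ContinuousOn (f i) (M.triangle K)) :
    J K (fun x => ∑ i ∈ s, c i * f i x) = ∑ i ∈ s, c i * J K (f i) := by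
  classical
  induction s using Finset.induction_on with
  | empty =>
    have := hJ.smul K hK 0 (fun _ => 0)
    simpa using this
  | insert i s hi ih =>
    simp only [Finset.sum_insert hi]
    rw [hJ.add K hK (fun x => c i * f i x) (fun x => ∑ j ∈ s, c j * f j x), ih, hJ.smul K hK]
    · exact continuousOn_const.mul (hf i)
    · exact continuousOn_finsetSum _ fun j _ => continuousOn_const.mul (hf j)

end IsElementRule

/-- Integration over the triangles. -/
def triangleIntegral (M : GridMesh) (K : Cell) (f : Plane → ℝ) : ℝ := ∫ x in M.triangle K, f x

theorem isElementRule_triangleIntegral (M : GridMesh) (m : ℕ) :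
    IsElementRule M m (triangleIntegral M) 1 0 where
  W_nonneg := zero_le_one
  C_nonneg := le_rfl
  congr K _ f g h := setIntegral_congr_fun (M.isCompact_triangle K).measurableSet h
  add K _ f g hf hg := integral_add (hf.integrableOn_compact (M.isCompact_triangle K))
    (hg.integrableOn_compact (M.isCompact_triangle K))
  smul K _ c f := integral_const_mul c f
  bound K _ f B hf hB := by
    have := norm_setIntegral_le_of_norm_le_const (μ := volume) (s := M.triangle K) (f := f) (C := B)
      (M.isCompact_triangle K).measure_lt_top hB
    rw [one_mul, mul_comm]
    exact this
  const K _ := by simp [triangleIntegral]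
  shape K _ l := by simp [triangleIntegral]

theorem quadApply_add (w : Plane →₀ ℝ) (f g : Plane → ℝ) :
    quadApply w (fun x => f x + g x) = quadApply w f + quadApply w g := by
  simp [quadApply, Finsupp.sum, mul_add, Finset.sum_add_distrib]

theorem quadApply_smul (w : Plane →₀ ℝ) (c : ℝ) (f : Plane → ℝ) :
    quadApply w (fun x => c * f x) = c * quadApply w f := by
  simp only [quadApply, Finsupp.sum, Finset.mul_sum]
  exact Finset.sum_congr rfl fun _ _ => by ring

theorem iteratedFDeriv_two_shape (M : GridMesh) (K : Cell) (l : Fin 3) (x : Plane) :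
    ‖iteratedFDeriv ℝ 2 (M.shape K l) x‖ = 0 := by
  have h1 : fderiv ℝ (M.shape K l) =
      fun _ => InnerProductSpace.toDual ℝ Plane (M.shapeGrad K.2 l) := by
    funext y
    exact (M.hasGradientAt_shape K l y).hasFDerivAt.fderiv
  rw [← norm_iteratedFDeriv_fderiv, h1, iteratedFDeriv_const_of_ne one_ne_zero]
  simp

theorem contDiff_shape (M : GridMesh) (K : Cell) (l : Fin 3) : ContDiff ℝ 2 (M.shape K l) := by
  have h1 : M.shape K l = fun y => M.shape K l 0 + ⟪M.shapeGrad K.2 l, y⟫_ℝ := by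
    funext y
    rw [M.shape_eq_add_inner K l y 0, sub_zero]
  rw [h1]
  exact contDiff_const.add (contDiff_const.inner ℝ contDiff_id)

theorem IsUniformMesh.norm_shapeGrad_le {Ω : Set Plane} {u v : Plane} {M : GridMesh} {m : ℕ}
    (H : IsUniformMesh Ω u v M m) (t : Bool) (l : Fin 3) : ‖M.shapeGrad t l‖ ≤
      m * (‖(refLattice u v).gradS‖ + ‖(refLattice u v).gradT‖) := by
  have hU : |edgeU t l| ≤ 1 := by unfold edgeU; split_ifs <;> fin_cases l <;> simp
  have hV : |edgeV t l| ≤ 1 := by unfold edgeV; split_ifs <;> fin_cases l <;> simp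
  unfold GridMesh.shapeGrad
  refine (norm_add_le _ _).trans ?_
  rw [H.gradS_eq, H.gradT_eq, norm_smul, norm_smul, norm_smul, norm_smul, mul_add]
  simp only [Real.norm_eq_abs, Nat.abs_cast]
  exact add_le_add (mul_le_of_le_one_left (by positivity) hU)
    (mul_le_of_le_one_left (by positivity) hV)

/-- The barycentric coordinates have first derivatives of size `m` and no second derivatives, so an
error of order `m⁻²` relative to the `C²` norm is one of order `m⁻¹` for them. -/
theorem IsQuadratureOrderTwo.exists_isElementRule {mesh : ℕ → GridMesh} {Q : ℕ → Cell → Plane →₀ ℝ}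
    (hQ : IsQuadratureOrderTwo mesh Q) {Ω : Set Plane} {u v : Plane}
    (H : ∀ m ≥ 1, IsUniformMesh Ω u v (mesh m) m) :
    ∃ W C : ℝ, ∀ m ≥ 1, IsElementRule (mesh m) m (fun K => quadApply (Q m K)) W C := by
  obtain ⟨W, hW⟩ := hQ.stable
  obtain ⟨E, hE⟩ := hQ.error
  set ρ := ‖u‖ + ‖v‖ with hρ
  set g := ‖(refLattice u v).gradS‖ + ‖(refLattice u v).gradT‖ with hg
  refine ⟨|W|, |E| * ρ ^ 2 * (1 + g), fun m hm => ?_⟩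
  have Hm := H m hm
  have hmpos := Hm.m_pos
  have hm1 : (1 : ℝ) ≤ m := by exact_mod_cast hm
  have herr : ∀ K ∈ (mesh m).cells, ∀ f : Plane → ℝ, ContDiff ℝ 2 f →
      (∀ x ∈ (mesh m).triangle K, |f x| ≤ m * (1 + g) ∧ ‖fderiv ℝ f x‖ ≤ m * (1 + g) ∧
        ‖iteratedFDeriv ℝ 2 f x‖ ≤ m * (1 + g)) →
      |quadApply (Q m K) f - ∫ x in (mesh m).triangle K, f x| ≤
        |E| * ρ ^ 2 * (1 + g) / m * volume.real ((mesh m).triangle K) := by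
    intro K hK f hf hB
    refine (hE m K hK f hf _ hB).trans ?_
    have hd := Hm.diam_triangle_le K
    have hd0 : 0 ≤ Metric.diam ((mesh m).triangle K) := Metric.diam_nonneg
    calc _ ≤ |E| * (ρ / m) ^ 2 * volume.real ((mesh m).triangle K) * (m * (1 + g)) := by
          gcongr
          exact le_abs_self E
      _ = _ := by field_simp
  refine ⟨abs_nonneg _, by positivity, ?_, ?_, ?_, ?_, ?_, ?_⟩
  · intro K hK f f' h
    exact Finset.sum_congr rfl fun x hx => by
      change _ * f x = _ * f' x
      rw [h (hQ.mem_triangle m K hK x hx)]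
  · intro K _ f f' _ _
    exact quadApply_add _ _ _
  · intro K _ c f
    exact quadApply_smul _ _ _
  · intro K hK f B _ hB
    have hne : 0 ≤ B := (abs_nonneg _).trans (hB _ ((mesh m).node_mem_triangle K 0))
    calc |quadApply (Q m K) f| ≤ ∑ x ∈ (Q m K).support, |(Q m K) x * f x| :=
          Finset.abs_sum_le_sum_abs _ _
      _ ≤ ∑ x ∈ (Q m K).support, |(Q m K) x| * B := by
          refine Finset.sum_le_sum fun x hx => ?_
          rw [abs_mul]
          gcongr
          exact hB x (hQ.mem_triangle m K hK x hx)
      _ = ((Q m K).sum fun _ c => |c|) * B := by rw [← Finset.sum_mul]; rfl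
      _ ≤ |W| * volume.real ((mesh m).triangle K) * B := by
          gcongr
          refine (hW m K hK).trans ?_
          gcongr
          exact le_abs_self W
  · intro K hK
    have h1 := herr K hK (fun _ => 1) contDiff_const ?_
    · simpa using h1
    · intro x _
      have h2 : (1 : ℝ) ≤ m * (1 + g) := by
        have : 0 ≤ g := by positivity
        nlinarith
      refine ⟨by simpa using h2, by simp; linarith, ?_⟩
      rw [iteratedFDeriv_const_of_ne two_ne_zero]
      simp; linarith
  · intro K hK l
    refine herr K hK _ (contDiff_shape _ K l) fun x hx => ?_
    obtain ⟨h1, h2⟩ := (mesh m).shape_mem_Icc Hm.cross_ne' K l hx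
    have h3 : 0 ≤ (m : ℝ) * g := by positivity
    refine ⟨?_, ?_, ?_⟩
    · rw [abs_of_nonneg h1]; linarith
    · rw [((mesh m).hasGradientAt_shape K l x).hasFDerivAt.fderiv, LinearIsometryEquiv.norm_map]
      refine (Hm.norm_shapeGrad_le _ _).trans ?_
      linarith
    · rw [iteratedFDeriv_two_shape]; positivity

/-! ### The finite element matrices as assembled matrices -/

/-- The mean value of a coefficient on a triangle, computed with a rule. -/
def cellCoeff (M : GridMesh) (J : Cell → (Plane → ℝ) → ℝ) (a : Plane → ℝ) (K : Cell) : ℝ :=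
  J K a / volume.real (M.triangle K)

/-- The moment of the component along `g` of a field against a barycentric coordinate, with the
minus sign of the convection matrix. -/
def convMoment (M : GridMesh) (J : Cell → (Plane → ℝ) → ℝ) (b : Plane → Plane) (g : Plane)
    (K : Cell) (l : Fin 3) : ℝ :=
  -J K fun x => ⟪b x, g⟫_ℝ * M.shape K l x

section

variable {Ω : Set Plane} {u v : Plane} {M : GridMesh} {m : ℕ} {J : Cell → (Plane → ℝ) → ℝ}
  {W C : ℝ} {a : Plane → ℝ} {b : Plane → Plane}

theorem IsUniformMesh.volume_mul_inner_shapeGrad (H : IsUniformMesh Ω u v M m) (K : Cell)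
    (k l : Fin 3) : volume.real (M.triangle K) * ⟪M.shapeGrad K.2 l, M.shapeGrad K.2 k⟫_ℝ =
      shapeGram (gramUU u v) (gramVV u v) (gramUV u v) K.2 k l := by
  have hm := H.m_pos
  unfold GridMesh.shapeGrad shapeGram gramUU gramVV gramUV
  rw [H.volume_real_triangle, H.gradS_eq, H.gradT_eq]
  simp only [inner_add_left, inner_add_right, real_inner_smul_left, real_inner_smul_right]
  rw [real_inner_comm (refLattice u v).gradS (refLattice u v).gradT]
  field_simp
  ring

/-- The diffusion matrix of a rule is assembled from the mean values of the coefficient: the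
gradients are constant on the triangles. -/
theorem of_rule_eq_stiffness (H : IsUniformMesh Ω u v M m) (hJ : IsElementRule M m J W C) :
    (Matrix.of fun i j : M.inner => ∑ K ∈ M.cells,
      J K fun x => a x * ⟪M.hatGrad K j, M.hatGrad K i⟫_ℝ) =
    stiffness M.inner M.cells (gramUU u v) (gramVV u v) (gramUV u v) (cellCoeff M J a) := by
  ext i j
  simp only [Matrix.of_apply, stiffness, assemble]
  refine Finset.sum_congr rfl fun K hK => ?_
  have h1 : (fun x => a x * ⟪M.hatGrad K j, M.hatGrad K i⟫_ℝ) =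
      fun x => ⟪M.hatGrad K j, M.hatGrad K i⟫_ℝ * a x := by funext x; ring
  have hpos := H.volume_real_triangle_pos K
  rw [h1, hJ.smul K hK, GridMesh.hatGrad, GridMesh.hatGrad, inner_sum, Finset.sum_mul]
  refine Finset.sum_congr rfl fun k _ => ?_
  rw [sum_inner, Finset.sum_mul]
  refine Finset.sum_congr rfl fun l _ => ?_
  rw [← H.volume_mul_inner_shapeGrad, cellCoeff]
  split_ifs
  · field_simp
  all_goals simp

/-- The convection matrix of a rule is assembled from the moments of the field. -/
theorem of_rule_eq_convMatrix (H : IsUniformMesh Ω u v M m) (hJ : IsElementRule M m J W C)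
    (hb : ContinuousOn b (closure Ω)) :
    (Matrix.of fun i j : M.inner => -∑ K ∈ M.cells,
      J K fun x => ⟪b x, M.hatGrad K i⟫_ℝ * M.hat j x) =
    convMatrix M.inner M.cells (convMoment M J b M.gradS) (convMoment M J b M.gradT) := by
  ext i j
  simp only [Matrix.of_apply, convMatrix, assemble]
  rw [← Finset.sum_neg_distrib]
  refine Finset.sum_congr rfl fun K hK => ?_
  have hbK : ContinuousOn b (M.triangle K) := hb.mono (H.triangle_subset_closure hK)
  have hcont : ∀ (g : Plane) (l : Fin 3),
      ContinuousOn (fun x => ⟪b x, g⟫_ℝ * M.shape K l x) (M.triangle K) := fun g l =>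
    (hbK.inner continuousOn_const).mul (M.continuous_shape K l).continuousOn
  let c : (ℝ) → Fin 3 × Fin 3 → ℝ := fun e p =>
    (if K.vertex p.1 = i then 1 else 0) * (if K.vertex p.2 = j then 1 else 0) * e
  have h1 : EqOn (fun x => ⟪b x, M.hatGrad K i⟫_ℝ * M.hat j x)
      (fun x => (∑ p : Fin 3 × Fin 3, c (edgeU K.2 p.1) p * (⟪b x, M.gradS⟫_ℝ * M.shape K p.2 x)) +
        ∑ p : Fin 3 × Fin 3, c (edgeV K.2 p.1) p * (⟪b x, M.gradT⟫_ℝ * M.shape K p.2 x))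
      (M.triangle K) := by
    intro x hx
    simp only
    rw [M.hat_eq_sum_shape H.cross_ne' j K hx, GridMesh.hatGrad, inner_sum, Finset.sum_mul_sum,
      ← Finset.sum_add_distrib, Fintype.sum_prod_type]
    refine Finset.sum_congr rfl fun k _ => Finset.sum_congr rfl fun l _ => ?_
    simp only [c, GridMesh.shapeGrad]
    split_ifs
    · rw [inner_add_right, real_inner_smul_right, real_inner_smul_right]; ring
    all_goals simp
  rw [hJ.congr K hK _ _ h1, hJ.add K hK,
    hJ.sum hK Finset.univ (fun p : Fin 3 × Fin 3 => c (edgeU K.2 p.1) p)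
      (fun p x => ⟪b x, M.gradS⟫_ℝ * M.shape K p.2 x) fun p => hcont _ _,
    hJ.sum hK Finset.univ (fun p : Fin 3 × Fin 3 => c (edgeV K.2 p.1) p)
      (fun p x => ⟪b x, M.gradT⟫_ℝ * M.shape K p.2 x) fun p => hcont _ _,
    ← Finset.sum_add_distrib, Fintype.sum_prod_type, ← Finset.sum_neg_distrib]
  · refine Finset.sum_congr rfl fun k _ => ?_
    rw [← Finset.sum_neg_distrib]
    refine Finset.sum_congr rfl fun l _ => ?_
    simp only [c, convMoment]
    ring
  · exact continuousOn_finsetSum _ fun p _ => continuousOn_const.mul (hcont _ _)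
  · exact continuousOn_finsetSum _ fun p _ => continuousOn_const.mul (hcont _ _)

theorem diffusion_eq_stiffness (H : IsUniformMesh Ω u v M m) (ha : ContinuousOn a (closure Ω)) :
    M.diffusion a = stiffness M.inner M.cells (gramUU u v) (gramVV u v) (gramUV u v)
      (cellCoeff M (triangleIntegral M) a) := by
  rw [← of_rule_eq_stiffness H (isElementRule_triangleIntegral M m)]
  ext i j
  simp only [GridMesh.diffusion, Matrix.of_apply]
  have hae : ∀ K ∈ M.cells, (fun x => a x * ⟪M.hatGrad K j, M.hatGrad K i⟫_ℝ) =ᵐ[volume.restrict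
      (M.triangle K)] fun x => a x * ⟪∇ (M.hat j) x, ∇ (M.hat i) x⟫_ℝ := by
    intro K _
    rw [Measure.restrict_congr_set (M.triangle_ae_eq_openTriangle H.cross_ne' K)]
    filter_upwards [self_mem_ae_restrict (M.isOpen_openTriangle K).measurableSet] with x hx
    rw [M.gradient_hat H.cross_ne' _ K hx, M.gradient_hat H.cross_ne' _ K hx]
  rw [H.dom_eq, M.setIntegral_eq_sum_triangles H.cross_ne' H.mem_dom_iff]
  · exact Finset.sum_congr rfl fun K hK => (integral_congr_ae (hae K hK)).symm
  · intro K hK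
    have h1 : IntegrableOn (fun x => a x * ⟪M.hatGrad K j, M.hatGrad K i⟫_ℝ) (M.triangle K) :=
      ((ha.mono (H.triangle_subset_closure hK)).mul continuousOn_const).integrableOn_compact
        (M.isCompact_triangle K)
    exact h1.congr (hae K hK)

theorem convection_eq_convMatrix (H : IsUniformMesh Ω u v M m) (hb : ContinuousOn b (closure Ω)) :
    M.convection b = convMatrix M.inner M.cells (convMoment M (triangleIntegral M) b M.gradS)
      (convMoment M (triangleIntegral M) b M.gradT) := by
  rw [← of_rule_eq_convMatrix H (isElementRule_triangleIntegral M m) hb]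
  ext i j
  simp only [GridMesh.convection, Matrix.of_apply]
  have hae : ∀ K ∈ M.cells, (fun x => ⟪b x, M.hatGrad K i⟫_ℝ * M.hat j x) =ᵐ[volume.restrict
      (M.triangle K)] fun x => ⟪b x, ∇ (M.hat i) x⟫_ℝ * M.hat j x := by
    intro K _
    rw [Measure.restrict_congr_set (M.triangle_ae_eq_openTriangle H.cross_ne' K)]
    filter_upwards [self_mem_ae_restrict (M.isOpen_openTriangle K).measurableSet] with x hx
    rw [M.gradient_hat H.cross_ne' _ K hx]
  rw [H.dom_eq, M.setIntegral_eq_sum_triangles H.cross_ne' H.mem_dom_iff]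
  · exact congrArg Neg.neg
      (Finset.sum_congr rfl fun K hK => (integral_congr_ae (hae K hK)).symm)
  · intro K hK
    have h1 : IntegrableOn (fun x => ⟪b x, M.hatGrad K i⟫_ℝ * M.hat j x) (M.triangle K) :=
      (((hb.mono (H.triangle_subset_closure hK)).inner continuousOn_const).mul
        (M.continuous_hat j).continuousOn).integrableOn_compact (M.isCompact_triangle K)
    exact h1.congr (hae K hK)

theorem diffusion_one_eq_stiffness (H : IsUniformMesh Ω u v M m) :
    M.diffusion (fun _ => 1) = stiffness M.inner M.cells (gramUU u v) (gramVV u v) (gramUV u v)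
      fun _ => 1 := by
  rw [diffusion_eq_stiffness H continuousOn_const]
  congr 1
  funext K
  have := H.volume_real_triangle_pos K
  simp [cellCoeff, triangleIntegral, this.ne']

theorem diffusionQuad_eq_stiffness (H : IsUniformMesh Ω u v M m) {Q : Cell → Plane →₀ ℝ}
    (hJ : IsElementRule M m (fun K => quadApply (Q K)) W C) :
    M.diffusionQuad Q a = stiffness M.inner M.cells (gramUU u v) (gramVV u v) (gramUV u v)
      (cellCoeff M (fun K => quadApply (Q K)) a) := by
  rw [← of_rule_eq_stiffness H hJ]
  ext i j
  simp only [GridMesh.diffusionQuad, Matrix.of_apply, M.gradOn_eq H.cross_ne']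

theorem convectionQuad_eq_convMatrix (H : IsUniformMesh Ω u v M m) {Q : Cell → Plane →₀ ℝ}
    (hJ : IsElementRule M m (fun K => quadApply (Q K)) W C) (hb : ContinuousOn b (closure Ω)) :
    M.convectionQuad Q b = convMatrix M.inner M.cells
      (convMoment M (fun K => quadApply (Q K)) b M.gradS)
      (convMoment M (fun K => quadApply (Q K)) b M.gradT) := by
  rw [← of_rule_eq_convMatrix H hJ hb]
  ext i j
  simp only [GridMesh.convectionQuad, Matrix.of_apply, M.gradOn_eq H.cross_ne']

/-! ### Bounds for the element quantities -/

/-- The computed mean value of a Lipschitz coefficient is close to each of its values on the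
triangle. -/
theorem abs_cellCoeff_sub_le (H : IsUniformMesh Ω u v M m) (hJ : IsElementRule M m J W C)
    {La Ba : ℝ} (hLa : 0 ≤ La) (ha : ContinuousOn a (closure Ω))
    (hlip : ∀ x ∈ closure Ω, ∀ y ∈ closure Ω, |a x - a y| ≤ La * ‖x - y‖)
    (hBa : ∀ x ∈ closure Ω, |a x| ≤ Ba) {K : Cell} (hK : K ∈ M.cells) {y : Plane}
    (hy : y ∈ M.triangle K) :
    |cellCoeff M J a K - a y| ≤ (W * (La * (‖u‖ + ‖v‖)) + C * Ba) / m := by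
  have hsub := H.triangle_subset_closure hK
  have hpos := H.volume_real_triangle_pos K
  have hm := H.m_pos
  have h1 : J K a = J K (fun x => a x - a y) + a y * J K (fun _ => 1) := by
    rw [← hJ.smul K hK, ← hJ.add K hK]
    · simp
    · exact (ha.mono hsub).sub continuousOn_const
    · exact continuousOn_const
  have h2 : |J K (fun x => a x - a y)| ≤
      W * volume.real (M.triangle K) * (La * ((‖u‖ + ‖v‖) / m)) := by
    refine hJ.bound K hK _ _ ((ha.mono hsub).sub continuousOn_const) fun x hx => ?_
    refine (hlip x (hsub hx) y (hsub hy)).trans ?_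
    gcongr
    exact H.norm_sub_le_of_mem_triangle hx hy
  have h3 := hJ.const K hK
  have h4 := hBa y (hsub hy)
  have h5 : cellCoeff M J a K - a y =
      (J K (fun x => a x - a y) + a y * (J K (fun _ => 1) - volume.real (M.triangle K))) /
        volume.real (M.triangle K) := by
    rw [cellCoeff, h1]; field_simp; ring
  have hC := hJ.C_nonneg
  have hB0 : 0 ≤ Ba := (abs_nonneg _).trans h4
  rw [h5, abs_div, abs_of_pos hpos, div_le_iff₀ hpos]
  refine (abs_add_le _ _).trans ?_
  rw [abs_mul]
  calc _ ≤ W * volume.real (M.triangle K) * (La * ((‖u‖ + ‖v‖) / m)) +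
        Ba * (C / m * volume.real (M.triangle K)) := by gcongr
    _ = _ := by field_simp

theorem abs_convMoment_le (H : IsUniformMesh Ω u v M m) (hJ : IsElementRule M m J W C)
    {Bb : ℝ} (hb : ContinuousOn b (closure Ω)) (hBb : ∀ x ∈ closure Ω, ‖b x‖ ≤ Bb) (g : Plane)
    {K : Cell} (hK : K ∈ M.cells) (l : Fin 3) :
    |convMoment M J b ((m : ℝ) • g) K l| ≤ W * refArea u v * Bb * ‖g‖ / m := by
  have hsub := H.triangle_subset_closure hK
  have hm := H.m_pos
  rw [convMoment, abs_neg]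
  refine (hJ.bound K hK _ (Bb * (m * ‖g‖)) ?_ fun x hx => ?_).trans (le_of_eq ?_)
  · exact ((hb.mono hsub).inner continuousOn_const).mul (M.continuous_shape K l).continuousOn
  · obtain ⟨h1, h2⟩ := M.shape_mem_Icc H.cross_ne' K l hx
    rw [abs_mul, abs_of_nonneg h1]
    refine (mul_le_of_le_one_right (abs_nonneg _) h2).trans ?_
    refine (abs_real_inner_le_norm _ _).trans ?_
    rw [norm_smul, Real.norm_eq_abs, Nat.abs_cast]
    gcongr
    exact hBb x (hsub hx)
  · rw [H.volume_real_triangle]; field_simp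

/-- The convection moments of a rule and of exact integration differ by a quantity of second
order: the field is replaced by a constant, and the barycentric coordinates are integrated well. -/
theorem abs_convMoment_sub_le (H : IsUniformMesh Ω u v M m) (hJ : IsElementRule M m J W C)
    {Lb Bb : ℝ} (hLb : 0 ≤ Lb) (hb : ContinuousOn b (closure Ω))
    (hlip : ∀ x ∈ closure Ω, ∀ y ∈ closure Ω, ‖b x - b y‖ ≤ Lb * ‖x - y‖)
    (hBb : ∀ x ∈ closure Ω, ‖b x‖ ≤ Bb) (g : Plane) {K : Cell} (hK : K ∈ M.cells) (l : Fin 3) :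
    |convMoment M J b ((m : ℝ) • g) K l - convMoment M (triangleIntegral M) b ((m : ℝ) • g) K l| ≤
      (Bb * C + (W + 1) * Lb * (‖u‖ + ‖v‖)) * refArea u v * ‖g‖ / m / m := by
  have hsub := H.triangle_subset_closure hK
  have hm := H.m_pos
  have hI := isElementRule_triangleIntegral M m
  set y := M.node (K.vertex 0) with hy
  have hyK : y ∈ M.triangle K := M.node_mem_triangle K 0
  have hbK := hb.mono hsub
  have hc0 : ContinuousOn (M.shape K l) (M.triangle K) := (M.continuous_shape K l).continuousOn
  have hc1 : ContinuousOn (fun x => ⟪b x - b y, (m : ℝ) • g⟫_ℝ * M.shape K l x) (M.triangle K) :=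
    ((hbK.sub continuousOn_const).inner continuousOn_const).mul hc0
  have hsplit : ∀ J' : Cell → (Plane → ℝ) → ℝ, ∀ W' C' : ℝ, IsElementRule M m J' W' C' →
      J' K (fun x => ⟪b x, (m : ℝ) • g⟫_ℝ * M.shape K l x) =
      ⟪b y, (m : ℝ) • g⟫_ℝ * J' K (M.shape K l) +
        J' K (fun x => ⟪b x - b y, (m : ℝ) • g⟫_ℝ * M.shape K l x) := by
    intro J' W' C' hJ'
    rw [← hJ'.smul K hK, ← hJ'.add K hK
      (fun x => ⟪b y, (m : ℝ) • g⟫_ℝ * M.shape K l x)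
      (fun x => ⟪b x - b y, (m : ℝ) • g⟫_ℝ * M.shape K l x) (continuousOn_const.mul hc0) hc1]
    congr 1
    funext x
    rw [inner_sub_left]; ring
  have hrem : ∀ x ∈ M.triangle K, |⟪b x - b y, (m : ℝ) • g⟫_ℝ * M.shape K l x| ≤
      Lb * ((‖u‖ + ‖v‖) / m) * (m * ‖g‖) := by
    intro x hx
    obtain ⟨h1, h2⟩ := M.shape_mem_Icc H.cross_ne' K l hx
    rw [abs_mul, abs_of_nonneg h1]
    refine (mul_le_of_le_one_right (abs_nonneg _) h2).trans ?_
    refine (abs_real_inner_le_norm _ _).trans ?_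
    rw [norm_smul, Real.norm_eq_abs, Nat.abs_cast]
    gcongr
    refine (hlip x (hsub hx) y (hsub hyK)).trans ?_
    gcongr
    exact H.norm_sub_le_of_mem_triangle hx hyK
  have hin : |⟪b y, (m : ℝ) • g⟫_ℝ| ≤ Bb * (m * ‖g‖) := by
    refine (abs_real_inner_le_norm _ _).trans ?_
    rw [norm_smul, Real.norm_eq_abs, Nat.abs_cast]
    gcongr
    exact hBb y (hsub hyK)
  have r1 := hJ.bound K hK _ _ hc1 hrem
  have r2 := hI.bound K hK _ _ hc1 hrem
  have r3 := hJ.shape K hK l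
  have hBb0 : 0 ≤ Bb := (norm_nonneg _).trans (hBb y (hsub hyK))
  have e : convMoment M J b ((m : ℝ) • g) K l -
      convMoment M (triangleIntegral M) b ((m : ℝ) • g) K l =
      -(⟪b y, (m : ℝ) • g⟫_ℝ * (J K (M.shape K l) - ∫ x in M.triangle K, M.shape K l x)) +
      (-J K (fun x => ⟪b x - b y, (m : ℝ) • g⟫_ℝ * M.shape K l x) +
        triangleIntegral M K (fun x => ⟪b x - b y, (m : ℝ) • g⟫_ℝ * M.shape K l x)) := by
    rw [convMoment, convMoment, hsplit J W C hJ, hsplit _ 1 0 hI]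
    simp only [triangleIntegral]
    ring
  rw [e]
  calc _ ≤ |⟪b y, (m : ℝ) • g⟫_ℝ| * |J K (M.shape K l) - ∫ x in M.triangle K, M.shape K l x| +
        (|J K (fun x => ⟪b x - b y, (m : ℝ) • g⟫_ℝ * M.shape K l x)| +
        |triangleIntegral M K (fun x => ⟪b x - b y, (m : ℝ) • g⟫_ℝ * M.shape K l x)|) := by
        refine (abs_add_le _ _).trans ?_
        rw [abs_neg, abs_mul]
        gcongr
        refine (abs_add_le _ _).trans ?_
        rw [abs_neg]
    _ ≤ Bb * (m * ‖g‖) * (C / m * volume.real (M.triangle K)) +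
        (W * volume.real (M.triangle K) * (Lb * ((‖u‖ + ‖v‖) / m) * (m * ‖g‖)) +
        1 * volume.real (M.triangle K) * (Lb * ((‖u‖ + ‖v‖) / m) * (m * ‖g‖))) := by
        gcongr
    _ = _ := by
        rw [H.volume_real_triangle]; field_simp

end

/-! ### The two model meshes -/

theorem squareMesh_coordT (flip : Bool) {m : ℕ} (hm : m ≠ 0) (x : Plane) :
    (squareMesh flip m).coordT x = m * x 1 := by
  have hm' : (m : ℝ) ≠ 0 := by exact_mod_cast hm
  cases flip <;> simp [GridMesh.coordT, cross, squareMesh] <;> field_simp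

theorem squareMesh_coordS (flip : Bool) {m : ℕ} (hm : m ≠ 0) (x : Plane) :
    (squareMesh flip m).coordS x = if flip then m * (1 - x 0) else m * x 0 := by
  have hm' : (m : ℝ) ≠ 0 := by exact_mod_cast hm
  cases flip <;> simp [GridMesh.coordS, cross, squareMesh] <;> field_simp
  ring

theorem mem_unitSquare_iff (flip : Bool) {m : ℕ} (hm : m ≠ 0) (x : Plane) :
    x ∈ unitSquare ↔ (0 < (squareMesh flip m).coordS x ∧ (squareMesh flip m).coordS x < m) ∧
      0 < (squareMesh flip m).coordT x ∧ (squareMesh flip m).coordT x < m := by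
  have hm' : (0 : ℝ) < m := by positivity
  have h1 : ∀ y : ℝ, 0 < m * y ↔ 0 < y := fun y => mul_pos_iff_of_pos_left hm'
  have h2 : ∀ y : ℝ, m * y < m ↔ y < 1 := fun y => mul_lt_iff_lt_one_right hm'
  have h3 : x ∈ unitSquare ↔ (0 < x 0 ∧ x 0 < 1) ∧ 0 < x 1 ∧ x 1 < 1 := by
    simp [unitSquare, Fin.forall_fin_two]
  rw [squareMesh_coordT flip hm, squareMesh_coordS flip hm, h3]
  cases flip
  · simp only [Bool.false_eq_true, if_false, h1, h2]
  · simp only [if_true, h1, h2, sub_pos, sub_lt_self_iff]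
    tauto

theorem squareMesh_isUniformMesh (flip : Bool) {m : ℕ} (hm : 1 ≤ m) :
    IsUniformMesh unitSquare (if flip then !₂[-1, 0] else !₂[1, 0]) !₂[0, 1]
      (squareMesh flip m) m where
  lattice := by
    refine ⟨hm, fun p hp => ?_, fun K k hk => ?_⟩
    · simp only [squareMesh, Finset.mem_product, Finset.mem_Ioo] at hp
      rw [abs_of_pos hp.1.1, abs_of_pos hp.2.1]
      exact ⟨hp.1.2.le, hp.2.2.le⟩
    · obtain ⟨⟨i, j⟩, t⟩ := K
      simp only [squareMesh, Finset.mem_product, Finset.mem_Ioo, Finset.mem_Ico, Finset.mem_univ,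
        and_true] at hk ⊢
      cases t <;> fin_cases k <;> simp [Cell.vertex] at hk <;> omega
  u_eq := by
    ext k
    cases flip <;> fin_cases k <;> simp [squareMesh]
  v_eq := by
    ext k
    fin_cases k <;> simp [squareMesh]
  cross_ne := by cases flip <;> simp [cross]
  dom_eq := rfl
  mem_dom_iff := by
    intro K x hx
    obtain ⟨h1, h2, h3, h4, -⟩ := GridMesh.openTriangle_bounds _ hx
    obtain ⟨⟨i, j⟩, t⟩ := K
    have hm0 : m ≠ 0 := by omega
    rw [mem_unitSquare_iff flip hm0]
    simp only at h1 h2 h3 h4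
    generalize (squareMesh flip m).coordS x = S at *
    generalize (squareMesh flip m).coordT x = T at *
    simp only [squareMesh, Finset.mem_product, Finset.mem_Ico, Finset.mem_univ, and_true]
    have key : ∀ (S : ℝ) (i : ℤ), 0 < S - i → S - i < 1 → ((0 < S ∧ S < m) ↔ 0 ≤ i ∧ i < m) := by
      intro S i h1 h2
      constructor
      · rintro ⟨h3, h4⟩
        have h5 : (-1 : ℝ) < i := by linarith
        have h6 : (i : ℝ) < m := by linarith
        have h5' : (-1 : ℤ) < i := by exact_mod_cast h5
        have h6' : i < (m : ℤ) := by exact_mod_cast h6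
        omega
      · rintro ⟨h3, h4⟩
        have h3' : (0 : ℝ) ≤ i := by exact_mod_cast h3
        have h4' : (i : ℝ) + 1 ≤ m := by exact_mod_cast h4
        constructor <;> linarith
    rw [key S i h1 h2, key T j h3 h4]
  hat_eq_zero := by
    intro p hp x hx
    apply GridMesh.hat_eq_zero
    have hm0 : m ≠ 0 := by omega
    rw [mem_unitSquare_iff flip hm0] at hx
    generalize (squareMesh flip m).coordS x = S at *
    generalize (squareMesh flip m).coordT x = T at *
    simp only [squareMesh, Finset.mem_product, Finset.mem_Ioo] at hp
    obtain ⟨⟨h1, h2⟩, h3, h4⟩ := hp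
    have h1' : (1 : ℝ) ≤ p.1 := by exact_mod_cast h1
    have h2' : (p.1 : ℝ) + 1 ≤ m := by exact_mod_cast h2
    have h3' : (1 : ℝ) ≤ p.2 := by exact_mod_cast h3
    have h4' : (p.2 : ℝ) + 1 ≤ m := by exact_mod_cast h4
    by_contra! hc
    obtain ⟨a1, a2, -⟩ := hc
    rw [abs_lt] at a1 a2
    exact hx ⟨⟨by linarith, by linarith⟩, by linarith, by linarith⟩

theorem convex_unitSquare : Convex ℝ unitSquare := by
  have : unitSquare = ⋂ k : Fin 2, {x : Plane | x k ∈ Ioo (0 : ℝ) 1} := by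
    ext x; simp [unitSquare]
  rw [this]
  exact convex_iInter fun k =>
    (convex_Ioo 0 1).is_linear_preimage ⟨fun x y => rfl, fun c x => rfl⟩

theorem isBounded_unitSquare : Bornology.IsBounded unitSquare := by
  refine isBounded_iff_forall_norm_le.2 ⟨2, fun x hx => ?_⟩
  rw [EuclideanSpace.norm_eq, Real.sqrt_le_left (by norm_num), Fin.sum_univ_two]
  have h0 := hx 0
  have h1 := hx 1
  rw [Real.norm_eq_abs, Real.norm_eq_abs, sq_abs, sq_abs]
  nlinarith

theorem hexagonMesh_coordS_coordT (c v : Plane) (hv : v ≠ 0) {m : ℕ} (hm : m ≠ 0) (x : Plane) :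
    (hexagonMesh c v m).coordS x = m * (hexagonMesh c v 1).coordS x ∧
      (hexagonMesh c v m).coordT x = m * (hexagonMesh c v 1).coordT x := by
  have hm' : (m : ℝ) ≠ 0 := by exact_mod_cast hm
  have hc := (cross_rot120 v hv).ne'
  have hcr : cross (hexagonMesh c v m).u (hexagonMesh c v m).v =
      (1 / (m : ℝ)) ^ 2 * cross v (rot120 v) := by
    simp [cross, hexagonMesh]; ring
  have hcr1 : cross (hexagonMesh c v 1).u (hexagonMesh c v 1).v = cross v (rot120 v) := by
    simp [cross, hexagonMesh]
  constructor
  · unfold GridMesh.coordS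
    rw [hcr, hcr1]
    field_simp
    simp [cross, hexagonMesh]
    field_simp
  · unfold GridMesh.coordT
    rw [hcr, hcr1]
    field_simp
    simp [cross, hexagonMesh]
    field_simp

theorem mem_hexagon_iff (c v : Plane) (hv : v ≠ 0) {m : ℕ} (hm : m ≠ 0) (x : Plane) :
    x ∈ hexagon c v ↔ |(hexagonMesh c v m).coordS x| < m ∧ |(hexagonMesh c v m).coordT x| < m ∧
      |(hexagonMesh c v m).coordS x - (hexagonMesh c v m).coordT x| < m := by
  have hm' : (0 : ℝ) < m := by positivity
  have h2 : ∀ y : ℝ, |m * y| < m ↔ |y| < 1 := fun y => by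
    rw [abs_mul, abs_of_pos hm', mul_lt_iff_lt_one_right hm']
  obtain ⟨hS, hT⟩ := hexagonMesh_coordS_coordT c v hv hm x
  rw [hexagon_eq c v hv, mem_ofPred_eq, hS, hT, ← mul_sub, h2, h2, h2]

theorem hexagonMesh_isUniformMesh (c v : Plane) (hv : v ≠ 0) {m : ℕ} (hm : 1 ≤ m) :
    IsUniformMesh (hexagon c v) v (rot120 v) (hexagonMesh c v m) m where
  lattice := by
    refine ⟨hm, fun p hp => ?_, fun K k hk => ?_⟩
    · have hp' := (Finset.mem_filter.1 hp).2
      exact ⟨hp'.1.le, hp'.2.1.le⟩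
    · obtain ⟨⟨i, j⟩, t⟩ := K
      simp only [hexagonMesh, Finset.mem_filter, Finset.mem_product, Finset.mem_Icc,
        Finset.mem_univ, and_true, inHex, abs_lt, abs_le] at hk ⊢
      cases t <;> fin_cases k <;> simp [Cell.vertex, Fin.forall_fin_succ] at hk ⊢ <;> omega
  u_eq := rfl
  v_eq := rfl
  cross_ne := (cross_rot120 v hv).ne'
  dom_eq := rfl
  mem_dom_iff := by
    intro K x hx
    obtain ⟨h1, h2, h3, h4, h5⟩ := GridMesh.openTriangle_bounds _ hx
    obtain ⟨⟨i, j⟩, t⟩ := K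
    rw [mem_hexagon_iff c v hv (by omega : m ≠ 0)]
    simp only at h1 h2 h3 h4 h5
    generalize (hexagonMesh c v m).coordS x = S at *
    generalize (hexagonMesh c v m).coordT x = T at *
    simp only [hexagonMesh, Finset.mem_filter, Finset.mem_product, Finset.mem_Icc,
      Finset.mem_univ, and_true, inHex, abs_lt, abs_le]
    have low : ∀ (n : ℤ) (y : ℝ), -(m : ℝ) < y → y < n + 1 → -(m : ℤ) ≤ n := by
      intro n y h h'
      have : -(m : ℝ) < n + 1 := h.trans h'
      have : -(m : ℤ) < n + 1 := by exact_mod_cast this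
      omega
    have upp : ∀ (n : ℤ) (y : ℝ), y < m → n < y → n + 1 ≤ (m : ℤ) := by
      intro n y h h'
      have : (n : ℝ) < m := h'.trans h
      exact_mod_cast this
    cases t
    · simp only [Bool.false_eq_true, if_false] at h5
      constructor
      · rintro ⟨⟨a1, a2⟩, ⟨a3, a4⟩, a5, a6⟩
        have b1 := low i S a1 (by linarith)
        have b2 := upp i S a2 (by linarith)
        have b3 := low j T a3 (by linarith)
        have b4 := upp j T a4 (by linarith)
        have b5 := low (i - j) (S - T) a5 (by push_cast; linarith)
        have b6 := upp (i - j) (S - T) a6 (by push_cast; linarith)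
        simp [Cell.vertex, Fin.forall_fin_succ]
        omega
      · rintro ⟨-, hK⟩
        have k0 := hK 0
        have k1 := hK 1
        have k2 := hK 2
        simp [Cell.vertex, -Order.add_one_le_iff, -Order.lt_add_one_iff] at k0 k1 k2
        rify at k0 k1 k2
        refine ⟨⟨?_, ?_⟩, ⟨?_, ?_⟩, ?_, ?_⟩ <;> linarith
    · simp only [if_true] at h5
      constructor
      · rintro ⟨⟨a1, a2⟩, ⟨a3, a4⟩, a5, a6⟩
        have b1 := low i S a1 (by linarith)
        have b2 := upp i S a2 (by linarith)
        have b3 := low j T a3 (by linarith)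
        have b4 := upp j T a4 (by linarith)
        have b5 := low (i - j - 1) (S - T) a5 (by push_cast; linarith)
        have b6 := upp (i - j - 1) (S - T) a6 (by push_cast; linarith)
        simp [Cell.vertex, Fin.forall_fin_succ]
        omega
      · rintro ⟨-, hK⟩
        have k0 := hK 0
        have k1 := hK 1
        have k2 := hK 2
        simp [Cell.vertex, -Order.add_one_le_iff, -Order.lt_add_one_iff] at k0 k1 k2
        rify at k0 k1 k2
        refine ⟨⟨?_, ?_⟩, ⟨?_, ?_⟩, ?_, ?_⟩ <;> linarith
  hat_eq_zero := by
    intro p hp x hx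
    apply GridMesh.hat_eq_zero
    rw [mem_hexagon_iff c v hv (by omega : m ≠ 0)] at hx
    generalize (hexagonMesh c v m).coordS x = S at *
    generalize (hexagonMesh c v m).coordT x = T at *
    obtain ⟨h1, h2, h3⟩ := (Finset.mem_filter.1 hp).2
    have h1' : |(p.1 : ℝ)| + 1 ≤ m := by exact_mod_cast h1
    have h2' : |(p.2 : ℝ)| + 1 ≤ m := by exact_mod_cast h2
    have h3' : |(p.1 : ℝ) - p.2| + 1 ≤ m := by exact_mod_cast h3
    by_contra! hc
    obtain ⟨a1, a2, a3⟩ := hc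
    have tri : ∀ y q : ℝ, |y - q| < 1 → |q| + 1 ≤ m → |y| < m := by
      intro y q hy hq
      have := abs_sub_abs_le_abs_sub y q
      linarith
    refine hx ⟨tri _ _ a1 h1', tri _ _ a2 h2', tri _ _ ?_ h3'⟩
    rwa [show S - T - ((p.1 : ℝ) - p.2) = S - p.1 - (T - p.2) by ring]

theorem convex_hexagon (c v : Plane) : Convex ℝ (hexagon c v) := by
  have hI : Convex ℝ {y : ℝ | |y| < 1} := by
    have : {y : ℝ | |y| < 1} = Ioo (-1) 1 := by ext; simp [abs_lt]
    rw [this]; exact convex_Ioo _ _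
  rintro _ ⟨s, t, h1, h2, h3, rfl⟩ _ ⟨s', t', h1', h2', h3', rfl⟩ α β hα hβ hαβ
  refine ⟨α * s + β * s', α * t + β * t', hI h1 h1' hα hβ hαβ, hI h2 h2' hα hβ hαβ, ?_, ?_⟩
  · have := hI h3 h3' hα hβ hαβ
    simp only [smul_eq_mul, mem_ofPred_eq] at this
    rwa [show α * s + β * s' - (α * t + β * t') = α * (s - t) + β * (s' - t') by ring]
  · obtain rfl : β = 1 - α := by linarith
    module

theorem isBounded_hexagon (c v : Plane) : Bornology.IsBounded (hexagon c v) := by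
  refine isBounded_iff_forall_norm_le.2 ⟨‖c‖ + ‖v‖ + ‖rot120 v‖, ?_⟩
  rintro _ ⟨s, t, h1, h2, -, rfl⟩
  refine (norm_add₃_le).trans ?_
  rw [norm_smul, norm_smul, Real.norm_eq_abs, Real.norm_eq_abs]
  gcongr
  · exact mul_le_of_le_one_left (norm_nonneg _) h1.le
  · exact mul_le_of_le_one_left (norm_nonneg _) h2.le

theorem IsModelMesh.exists_isUniformMesh {Ω : Set Plane} {mesh : ℕ → GridMesh}
    (h : IsModelMesh Ω mesh) : ∃ u v : Plane, cross u v ≠ 0 ∧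
      ∀ m ≥ 1, IsUniformMesh Ω u v (mesh m) m := by
  rcases h with ⟨c, v, hv, rfl, rfl⟩ | ⟨rfl, flip, rfl⟩
  · exact ⟨v, rot120 v, (cross_rot120 v hv).ne', fun m hm => hexagonMesh_isUniformMesh c v hv hm⟩
  · exact ⟨_, _, (squareMesh_isUniformMesh flip le_rfl).cross_ne,
      fun m hm => squareMesh_isUniformMesh flip hm⟩

theorem IsModelMesh.isOpen_convex_isBounded {Ω : Set Plane} {mesh : ℕ → GridMesh}
    (h : IsModelMesh Ω mesh) : IsOpen Ω ∧ Convex ℝ Ω ∧ Bornology.IsBounded Ω := by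
  rcases h with ⟨c, v, hv, rfl, rfl⟩ | ⟨rfl, flip, rfl⟩
  · exact ⟨isOpen_hexagon c v hv, convex_hexagon c v, isBounded_hexagon c v⟩
  · exact ⟨isOpen_unitSquare, convex_unitSquare, isBounded_unitSquare⟩

theorem IsModelMesh.inner_zero {Ω : Set Plane} {mesh : ℕ → GridMesh}
    (h : IsModelMesh Ω mesh) : (mesh 0).inner = ∅ := by
  rcases h with ⟨c, v, hv, rfl, rfl⟩ | ⟨rfl, flip, rfl⟩
  · refine Finset.filter_eq_empty_iff.2 fun p _ hp => ?_
    exact (abs_nonneg p.1).not_gt (by simpa using hp.1)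
  · simp [squareMesh]

/-! ### The sign of the convection form -/

namespace GridMesh

variable (M : GridMesh)

theorem exists_lipschitzWith_hat (p : ℤ × ℤ) : ∃ C, LipschitzWith C (M.hat p) := by
  have hS : LipschitzWith ‖M.gradS‖₊ fun x => M.coordS x - p.1 :=
    LipschitzWith.of_dist_le_mul fun x y => by
      rw [Real.dist_eq, sub_sub_sub_cancel_right, M.coordS_sub, dist_eq_norm]
      exact abs_real_inner_le_norm _ _
  have hT : LipschitzWith ‖M.gradT‖₊ fun x => M.coordT x - p.2 :=
    LipschitzWith.of_dist_le_mul fun x y => by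
      rw [Real.dist_eq, sub_sub_sub_cancel_right, M.coordT_sub, dist_eq_norm]
      exact abs_real_inner_le_norm _ _
  have habs : ∀ {D} {f : Plane → ℝ}, LipschitzWith D f → LipschitzWith (1 * D) fun x => |f x| :=
    fun h => lipschitzWith_one_norm.comp h
  have h1 := (habs hS).max ((habs hT).max (habs (hS.sub hT)))
  exact ⟨_, ((LipschitzWith.const (1 : ℝ)).sub h1).const_max 0⟩

theorem abs_hat_le_one (p : ℤ × ℤ) (x : Plane) : |M.hat p x| ≤ 1 := by
  unfold hat
  rw [abs_of_nonneg (le_max_left _ _), max_le_iff]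
  exact ⟨zero_le_one, sub_le_self _ (le_max_of_le_left (abs_nonneg _))⟩

/-- The finite element function with the nodal values `y`. -/
def feFun (y : M.inner → ℝ) (x : Plane) : ℝ := ∑ i, y i * M.hat i x

theorem exists_lipschitzWith_feFun (y : M.inner → ℝ) : ∃ C, LipschitzWith C (M.feFun y) := by
  choose C hC using fun i : M.inner => M.exists_lipschitzWith_hat i
  refine ⟨∑ i, ‖y i‖₊ * C i, LipschitzWith.of_dist_le_mul fun x z => ?_⟩
  unfold feFun
  rw [Real.dist_eq, ← Finset.sum_sub_distrib, NNReal.coe_sum, Finset.sum_mul]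
  refine (Finset.abs_sum_le_sum_abs _ _).trans (Finset.sum_le_sum fun i _ => ?_)
  rw [← mul_sub, abs_mul, NNReal.coe_mul, mul_assoc]
  exact mul_le_mul_of_nonneg_left ((hC i).dist_le_mul x z) (abs_nonneg _)

theorem abs_feFun_le (y : M.inner → ℝ) (x : Plane) : |M.feFun y x| ≤ ∑ i, |y i| := by
  refine (Finset.abs_sum_le_sum_abs _ _).trans (Finset.sum_le_sum fun i _ => ?_)
  rw [abs_mul]
  exact mul_le_of_le_one_right (abs_nonneg _) (M.abs_hat_le_one i x)

theorem exists_lipschitzWith_feFun_sq (y : M.inner → ℝ) :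
    ∃ C, LipschitzWith C fun x => M.feFun y x ^ 2 := by
  obtain ⟨C, hC⟩ := M.exists_lipschitzWith_feFun y
  have hB0 : 0 ≤ ∑ i, |y i| := Finset.sum_nonneg fun _ _ => abs_nonneg _
  refine ⟨(2 * (∑ i, |y i|)).toNNReal * C, LipschitzWith.of_dist_le_mul fun x z => ?_⟩
  have h1 : |M.feFun y x + M.feFun y z| ≤ 2 * ∑ i, |y i| :=
    (abs_add_le _ _).trans (by linarith [M.abs_feFun_le y x, M.abs_feFun_le y z])
  rw [Real.dist_eq, sq_sub_sq, abs_mul, NNReal.coe_mul, Real.coe_toNNReal _ (by positivity),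
    mul_assoc]
  exact mul_le_mul h1 (hC.dist_le_mul x z) (abs_nonneg _) (by positivity)

/-- The gradient of `feFun` on a triangle. -/
def feGrad (y : M.inner → ℝ) (K : Cell) : Plane := ∑ i, y i • M.hatGrad K i

theorem hasGradientAt_feFun (h : cross M.u M.v ≠ 0) (y : M.inner → ℝ) (K : Cell) {x : Plane}
    (hx : x ∈ M.openTriangle K) : HasGradientAt (M.feFun y) (M.feGrad y K) x := by
  rw [hasGradientAt_iff_hasFDerivAt, feGrad, map_sum]
  refine HasFDerivAt.fun_sum fun i _ => ?_
  rw [map_smul]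
  exact (M.hasGradientAt_hat h i K hx).hasFDerivAt.const_mul (y i)

theorem lineDeriv_feFun_sq (h : cross M.u M.v ≠ 0) (y : M.inner → ℝ) (K : Cell) {x : Plane}
    (hx : x ∈ M.openTriangle K) (w : Plane) :
    lineDeriv ℝ (fun x => M.feFun y x ^ 2) x w = 2 * (M.feFun y x * ⟪M.feGrad y K, w⟫_ℝ) := by
  have h1 := (M.hasGradientAt_feFun h y K hx).hasFDerivAt.pow 2
  rw [(h1.hasLineDerivAt w).lineDeriv]
  simp
  ring

end GridMesh

/-- The convection form of a rule on one triangle. -/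
theorem IsElementRule.sum_sum_mul {M : GridMesh} {m : ℕ} {J : Cell → (Plane → ℝ) → ℝ} {W C : ℝ}
    (hJ : IsElementRule M m J W C) {K : Cell} (hK : K ∈ M.cells) {b : Plane → Plane}
    (hb : ContinuousOn b (M.triangle K)) (y : M.inner → ℝ) :
    ∑ i, ∑ j, y i * y j * J K (fun x => ⟪b x, M.hatGrad K i⟫_ℝ * M.hat j x) =
      J K fun x => ⟪b x, M.feGrad y K⟫_ℝ * M.feFun y x := by
  have h1 : (fun x => ⟪b x, M.feGrad y K⟫_ℝ * M.feFun y x) = fun x => ∑ p : M.inner × M.inner,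
      y p.1 * y p.2 * (⟪b x, M.hatGrad K p.1⟫_ℝ * M.hat p.2 x) := by
    funext x
    rw [GridMesh.feGrad, GridMesh.feFun, inner_sum, Finset.sum_mul_sum, Fintype.sum_prod_type]
    refine Finset.sum_congr rfl fun i _ => Finset.sum_congr rfl fun j _ => ?_
    rw [real_inner_smul_right]
    ring
  rw [h1, hJ.sum hK Finset.univ (fun p : M.inner × M.inner => y p.1 * y p.2)
    (fun p x => ⟪b x, M.hatGrad K p.1⟫_ℝ * M.hat p.2 x), Fintype.sum_prod_type]
  exact fun p => (hb.inner continuousOn_const).mul (M.continuous_hat _).continuousOn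

section

variable {Ω : Set Plane} {u v : Plane} {M : GridMesh} {m : ℕ} {b : Plane → Plane}

/-- The quadratic form of the convection matrix, as a sum over the triangles. -/
theorem sum_sum_convection (H : IsUniformMesh Ω u v M m) (hb : ContinuousOn b (closure Ω))
    (y : M.inner → ℝ) : ∑ i, ∑ j, y i * y j * M.convection b i j =
      -∑ K ∈ M.cells, ∫ x in M.triangle K, ⟪b x, M.feGrad y K⟫_ℝ * M.feFun y x := by
  have hI := isElementRule_triangleIntegral M m
  rw [convection_eq_convMatrix H hb, ← of_rule_eq_convMatrix H hI hb]
  simp only [Matrix.of_apply, mul_neg, Finset.sum_neg_distrib, Finset.mul_sum]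
  congr 1
  rw [Finset.sum_congr rfl fun i _ => Finset.sum_comm, Finset.sum_comm]
  exact Finset.sum_congr rfl fun K hK =>
    hI.sum_sum_mul hK (hb.mono (H.triangle_subset_closure hK)) y

/-- A nonnegative function has a minimum where it vanishes. Where it is not differentiable, the line
derivative is `0` by convention. -/
theorem lineDeriv_eq_zero_of_nonneg {f : Plane → ℝ} (hf : ∀ x, 0 ≤ f x) {x : Plane} (hx : f x = 0)
    (w : Plane) : lineDeriv ℝ f x w = 0 := by
  have h1 : IsLocalMin (fun t : ℝ => f (x + t • w)) 0 :=
    Eventually.of_forall fun t => by simpa [hx] using hf _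
  exact h1.deriv_eq_zero

/-- Integration by parts, one coordinate at a time. -/
theorem setIntegral_lineDeriv_mul_feFun_sq (H : IsUniformMesh Ω u v M m)
    (hbd : Bornology.IsBounded Ω) {f : Plane → ℝ} {C : NNReal} (hf : LipschitzWith C f)
    (y : M.inner → ℝ) (e : Plane) :
    ∫ x in Ω, lineDeriv ℝ f x e * M.feFun y x ^ 2 =
      -2 * ∑ K ∈ M.cells, ∫ x in M.triangle K, f x * ⟪M.feGrad y K, e⟫_ℝ * M.feFun y x := by
  have hzero : ∀ x ∉ Ω, M.feFun y x ^ 2 = 0 := fun x hx => by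
    rw [GridMesh.feFun, Finset.sum_eq_zero, zero_pow two_ne_zero]
    intro i _
    rw [H.hat_eq_zero i i.2 x hx, mul_zero]
  obtain ⟨D, hD⟩ := M.exists_lipschitzWith_feFun_sq y
  obtain ⟨D', hD'⟩ := M.exists_lipschitzWith_feFun y
  have hcs : HasCompactSupport fun x => M.feFun y x ^ 2 :=
    HasCompactSupport.intro hbd.isCompact_closure fun x hx => hzero x fun h => hx (subset_closure h)
  have hcont : ∀ K, IntegrableOn
      (fun x => -2 * (f x * ⟪M.feGrad y K, e⟫_ℝ * M.feFun y x)) (M.triangle K) := fun K =>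
    (continuous_const.mul ((hf.continuous.mul continuous_const).mul
      hD'.continuous)).continuousOn.integrableOn_compact (M.isCompact_triangle K)
  have hae : ∀ K, (fun x => -2 * (f x * ⟪M.feGrad y K, e⟫_ℝ * M.feFun y x)) =ᵐ[volume.restrict
      (M.triangle K)] fun x => lineDeriv ℝ (fun x => M.feFun y x ^ 2) x (-e) * f x := by
    intro K
    rw [Measure.restrict_congr_set (M.triangle_ae_eq_openTriangle H.cross_ne' K)]
    filter_upwards [self_mem_ae_restrict (M.isOpen_openTriangle K).measurableSet] with x hx
    rw [M.lineDeriv_feFun_sq H.cross_ne' y K hx, inner_neg_right]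
    ring
  rw [setIntegral_eq_integral_of_forall_compl_eq_zero fun x hx => by rw [hzero x hx, mul_zero],
    hf.integral_lineDeriv_mul_eq hD hcs e,
    ← setIntegral_eq_integral_of_forall_compl_eq_zero (s := Ω) fun x hx => by
      rw [lineDeriv_eq_zero_of_nonneg (fun x => sq_nonneg _) (hzero x hx), zero_mul],
    M.setIntegral_eq_sum_triangles H.cross_ne' H.mem_dom_iff _ fun K _ => (hcont K).congr (hae K),
    Finset.mul_sum]
  refine Finset.sum_congr rfl fun K _ => ?_
  rw [← integral_congr_ae (hae K), integral_const_mul]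

/-- The quadratic form of the convection matrix is `½ ∫ (div b) v²`, hence nonnegative. -/
theorem sum_sum_convection_nonneg (H : IsUniformMesh Ω u v M m) (hΩ : IsOpen Ω)
    (hbd : Bornology.IsBounded Ω) {L : NNReal} (hb : LipschitzOnWith L b (closure Ω))
    (hdiff : ∀ x ∈ Ω, DifferentiableAt ℝ b x) (hdiv : ∀ x ∈ Ω, 0 ≤ planeDiv b x)
    (y : M.inner → ℝ) : 0 ≤ ∑ i, ∑ j, y i * y j * M.convection b i j := by
  -- the integration by parts formula needs functions that are Lipschitz on the whole plane
  have hext : ∀ k : Fin 2, ∃ g : Plane → ℝ, LipschitzWith L g ∧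
      EqOn (fun x => b x k) g (closure Ω) := fun k =>
    LipschitzOnWith.extend_real <| LipschitzOnWith.of_dist_le_mul fun x hx z hz => by
      refine le_trans ?_ (hb.dist_le_mul x hx z hz)
      rw [Real.dist_eq, dist_eq_norm, ← Real.norm_eq_abs]
      exact PiLp.norm_apply_le (b x - b z) k
  choose g hg hgb using hext
  let e : Fin 2 → Plane := fun k => EuclideanSpace.single k 1
  obtain ⟨D, hD⟩ := M.exists_lipschitzWith_feFun_sq y
  have hcs : HasCompactSupport fun x => M.feFun y x ^ 2 := by
    refine HasCompactSupport.intro hbd.isCompact_closure fun x hx => ?_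
    rw [GridMesh.feFun, Finset.sum_eq_zero, zero_pow two_ne_zero]
    intro i _
    rw [H.hat_eq_zero i i.2 x fun h => hx (subset_closure h), mul_zero]
  have hint : ∀ k, IntegrableOn (fun x => lineDeriv ℝ (g k) x (e k) * M.feFun y x ^ 2) Ω :=
    fun k => ((hD.continuous.integrable_of_hasCompactSupport hcs).mul_of_top_right
      ((hg k).memLp_lineDeriv (e k))).integrableOn
  have hline : ∀ k, ∀ x ∈ Ω, lineDeriv ℝ (g k) x (e k) = (fderiv ℝ b x (e k)) k := by
    intro k x hx
    have h1 : HasFDerivAt (fun z => b z k)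
        ((EuclideanSpace.proj k : Plane →L[ℝ] ℝ).comp (fderiv ℝ b x)) x :=
      (EuclideanSpace.proj k : Plane →L[ℝ] ℝ).hasFDerivAt.comp x (hdiff x hx).hasFDerivAt
    have h2 : HasFDerivAt (g k)
        ((EuclideanSpace.proj k : Plane →L[ℝ] ℝ).comp (fderiv ℝ b x)) x := by
      refine h1.congr_of_eventuallyEq ?_
      filter_upwards [hΩ.mem_nhds hx] with z hz
      exact (hgb k (subset_closure hz)).symm
    rw [(h2.hasLineDerivAt (e k)).lineDeriv]
    rfl
  have h0 : 0 ≤ ∑ k, ∫ x in Ω, lineDeriv ℝ (g k) x (e k) * M.feFun y x ^ 2 := by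
    rw [← integral_finsetSum _ fun k _ => hint k]
    refine setIntegral_nonneg hΩ.measurableSet fun x hx => ?_
    rw [← Finset.sum_mul]
    refine mul_nonneg ?_ (sq_nonneg _)
    rw [Finset.sum_congr rfl fun k _ => hline k x hx]
    exact hdiv x hx
  have h1 : ∑ k, ∫ x in Ω, lineDeriv ℝ (g k) x (e k) * M.feFun y x ^ 2 =
      -2 * ∑ K ∈ M.cells, ∫ x in M.triangle K, ⟪b x, M.feGrad y K⟫_ℝ * M.feFun y x := by
    simp_rw [fun k => setIntegral_lineDeriv_mul_feFun_sq H hbd (hg k) y (e k)]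
    rw [← Finset.mul_sum, Finset.sum_comm]
    congr 1
    refine Finset.sum_congr rfl fun K hK => ?_
    obtain ⟨D', hD'⟩ := M.exists_lipschitzWith_feFun y
    have hi : ∀ k, IntegrableOn (fun x => g k x * ⟪M.feGrad y K, e k⟫_ℝ * M.feFun y x)
        (M.triangle K) := fun k =>
      (((hg k).continuous.mul continuous_const).mul
        hD'.continuous).continuousOn.integrableOn_compact (M.isCompact_triangle K)
    rw [← integral_finsetSum _ fun k _ => hi k]
    refine setIntegral_congr_fun (M.isCompact_triangle K).measurableSet fun x hx => ?_
    have hx' := H.triangle_subset_closure hK hx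
    have e0 : b x 0 = g 0 x := hgb 0 hx'
    have e1 : b x 1 = g 1 x := hgb 1 hx'
    simp only [Fin.sum_univ_two, GridMesh.plane_inner, e0, e1, e]
    simp
    ring
  rw [h1] at h0
  rw [sum_sum_convection H hb.continuousOn]
  linarith

/-- The real part of the form of a real matrix splits into the real and the imaginary part of the
vector. -/
theorem re_hform {ι : Type} [Fintype ι] (A : Matrix ι ι ℝ) (x : ι → ℂ) : (hform A x).re =
    ∑ i, ∑ j, (x i).re * (x j).re * A i j + ∑ i, ∑ j, (x i).im * (x j).im * A i j := by
  simp only [hform, Complex.re_sum, ← Finset.sum_add_distrib]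
  refine Finset.sum_congr rfl fun i _ => Finset.sum_congr rfl fun j _ => ?_
  simp
  ring

theorem re_hform_convection_nonneg (H : IsUniformMesh Ω u v M m) (hΩ : IsOpen Ω)
    (hbd : Bornology.IsBounded Ω) {L : NNReal} (hb : LipschitzOnWith L b (closure Ω))
    (hdiff : ∀ x ∈ Ω, DifferentiableAt ℝ b x) (hdiv : ∀ x ∈ Ω, 0 ≤ planeDiv b x)
    (x : M.inner → ℂ) : 0 ≤ (hform (M.convection b) x).re := by
  rw [re_hform]
  exact add_nonneg (sum_sum_convection_nonneg H hΩ hbd hb hdiff hdiv fun i => (x i).re)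
    (sum_sum_convection_nonneg H hΩ hbd hb hdiff hdiv fun i => (x i).im)

end

/-! ### Bounds that are uniform in the mesh parameter -/

theorem convMatrix_sub (s : Finset (ℤ × ℤ)) (cells : Finset Cell)
    (ωU ωV ωU' ωV' : Cell → Fin 3 → ℝ) :
    convMatrix s cells (fun K l => ωU K l - ωU' K l) (fun K l => ωV K l - ωV' K l) =
      convMatrix s cells ωU ωV - convMatrix s cells ωU' ωV' := by
  ext i j
  simp only [convMatrix, assemble, Matrix.of_apply, Matrix.sub_apply, ← Finset.sum_sub_distrib]
  refine Finset.sum_congr rfl fun K _ => Finset.sum_congr rfl fun k _ =>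
    Finset.sum_congr rfl fun l _ => ?_
  ring

theorem exists_lipschitz_and_bound {E : Type*} [NormedAddCommGroup E] [NormedSpace ℝ E]
    {S : Set Plane} (hconv : Convex ℝ S) (hcomp : IsCompact S) {n : WithTop ℕ∞} (hn : n ≠ 0)
    {f : Plane → E} (hf : ContDiffOn ℝ n f S) : ∃ (L : NNReal) (B : ℝ), 0 ≤ B ∧
      LipschitzOnWith L f S ∧ ∀ x ∈ S, ‖f x‖ ≤ B := by
  obtain ⟨L, hL⟩ := hf.exists_lipschitzOnWith hn hconv hcomp
  obtain ⟨B, hB⟩ := hcomp.exists_bound_of_continuousOn hf.continuousOn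
  exact ⟨L, |B|, abs_nonneg B, hL, fun x hx => (hB x hx).trans (le_abs_self B)⟩

section

variable {Ω : Set Plane} {u v : Plane} {mesh : ℕ → GridMesh} {a : Plane → ℝ} {b : Plane → Plane}
  {J : ℕ → Cell → (Plane → ℝ) → ℝ} {W C : ℝ}

/-- Clustering and localization for the matrices of an element rule, once the computed diffusion
coefficients are bounded below and the convection form is not too negative. -/
theorem cluster_and_rectangle_of_rules (hc : cross u v ≠ 0)
    (H : ∀ m ≥ 1, IsUniformMesh Ω u v (mesh m) m)
    (hJ : ∀ m ≥ 1, IsElementRule (mesh m) m (J m) W C) {La : NNReal} {Ba Bb : ℝ}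
    (hLa : LipschitzOnWith La a (closure Ω)) (hBa0 : 0 ≤ Ba) (hBa : ∀ x ∈ closure Ω, ‖a x‖ ≤ Ba)
    (hb : ContinuousOn b (closure Ω)) (hBb0 : 0 ≤ Bb) (hBb : ∀ x ∈ closure Ω, ‖b x‖ ≤ Bb)
    {a₀ : ℝ} (ha₀ : 0 < a₀) {m₀ : ℕ} (hm₀ : 1 ≤ m₀)
    (hlow : ∀ m ≥ m₀, ∀ K ∈ (mesh m).cells, a₀ ≤ cellCoeff (mesh m) (J m) a K)
    {X Θ Ψ : ∀ m, Matrix (mesh m).inner (mesh m).inner ℝ}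
    (hΘ : ∀ m ≥ 1, Θ m = stiffness (mesh m).inner (mesh m).cells (gramUU u v) (gramVV u v)
      (gramUV u v) (cellCoeff (mesh m) (J m) a))
    (hΨ : ∀ m ≥ 1, Ψ m = convMatrix (mesh m).inner (mesh m).cells
      (convMoment (mesh m) (J m) b (mesh m).gradS) (convMoment (mesh m) (J m) b (mesh m).gradT))
    (hX : ∀ m, X m = (scaledPrecond (Θ m) ((mesh m).diffusion fun _ => 1))⁻¹ * (Θ m + Ψ m)) :
    ProperlyClustered X 1 ∧ ∃ d D δ : ℝ, 0 < d ∧ ∀ m ≥ m₀,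
      (∀ x, -(a₀ * ((gramUU u v * gramVV u v - gramUV u v ^ 2) / (gramUU u v + gramVV u v)) / 2) *
        gridEnergy (mesh m).cells (zeroExt (mesh m).inner x) ≤ (hform (Ψ m) x).re) →
      ∀ z ∈ complexEigenvalues (X m), d ≤ z.re ∧ z.re ≤ D ∧ |z.im| ≤ δ := by
  have hW := (hJ 1 le_rfl).W_nonneg
  have hC := (hJ 1 le_rfl).C_nonneg
  set E : ℝ := W * (La * (‖u‖ + ‖v‖)) + C * Ba with hE
  have hE0 : 0 ≤ E := by positivity
  set σ := (refLattice u v).gradS with hσ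
  set τ := (refLattice u v).gradT with hτ
  have harea := refArea_pos hc
  set w : ℝ := W * refArea u v * Bb * (‖σ‖ + ‖τ‖) with hw
  have hw0 : 0 ≤ w := by positivity
  have hlip : ∀ x ∈ closure Ω, ∀ y ∈ closure Ω, |a x - a y| ≤ La * ‖x - y‖ := by
    intro x hx y hy
    rw [← Real.dist_eq, ← dist_eq_norm]
    exact hLa.dist_le_mul x hx y hy
  have hnear : ∀ m ≥ 1, ∀ K ∈ (mesh m).cells, ∀ k,
      |cellCoeff (mesh m) (J m) a K - a ((mesh m).node (K.vertex k))| ≤ E / m :=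
    fun m hm K hK k => abs_cellCoeff_sub_le (H m hm) (hJ m hm) La.coe_nonneg hLa.continuousOn
      hlip hBa hK ((mesh m).node_mem_triangle K k)
  have hcoef : ∀ m ≥ m₀, IsCellCoefficient (mesh m).inner (mesh m).cells m
      (cellCoeff (mesh m) (J m) a) a₀ (Ba + E + 1) (2 * E) := by
    intro m hm
    have hm1 : 1 ≤ m := hm₀.trans hm
    refine ⟨hlow m hm, fun K hK => ?_, fun K hK K' hK' k k' hkk' _ => ?_⟩
    · have h1 := (abs_le.1 (hnear m hm1 K hK 0)).2
      have h2 := (abs_le.1 (hBa _ ((H m hm1).triangle_subset_closure hK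
        ((mesh m).node_mem_triangle K 0)))).2
      have h3 : E / m ≤ E := div_le_self hE0 (by exact_mod_cast hm1)
      linarith
    · -- compare with the value at the common vertex
      have h1 := abs_le.1 (hnear m hm1 K hK k)
      have h2 := abs_le.1 (hnear m hm1 K' hK' k')
      rw [← hkk'] at h2
      rw [mul_div_assoc, abs_le]
      constructor <;> linarith
  have hmom : ∀ m ≥ m₀, ∀ K ∈ (mesh m).cells, ∀ l,
      |convMoment (mesh m) (J m) b (mesh m).gradS K l| ≤ w / m ∧
      |convMoment (mesh m) (J m) b (mesh m).gradT K l| ≤ w / m := by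
    intro m hm K hK l
    have hm1 : 1 ≤ m := hm₀.trans hm
    rw [(H m hm1).gradS_eq, (H m hm1).gradT_eq]
    constructor
    · refine (abs_convMoment_le (H m hm1) (hJ m hm1) hb hBb σ hK l).trans ?_
      rw [hw]
      gcongr
      exact le_add_of_nonneg_right (norm_nonneg _)
    · refine (abs_convMoment_le (H m hm1) (hJ m hm1) hb hBb τ hK l).trans ?_
      rw [hw]
      gcongr
      exact le_add_of_nonneg_left (norm_nonneg _)
  obtain ⟨h1, d, D, δ, hd, h2⟩ := cluster_and_rectangle (gramUU_pos hc) (gramVV_pos hc)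
    (gramUV_sq_lt hc) ha₀ (by positivity : 0 < Ba + E + 1) (by positivity : 0 ≤ 2 * E) hw0
    (s := fun m => (mesh m).inner) (cells := fun m => (mesh m).cells) (X := X)
    (α := fun m => cellCoeff (mesh m) (J m) a)
    (ωU := fun m => convMoment (mesh m) (J m) b (mesh m).gradS)
    (ωV := fun m => convMoment (mesh m) (J m) b (mesh m).gradT) m₀
    (fun m hm => (H m (hm₀.trans hm)).lattice) hcoef
    (fun m hm K hK l => (hmom m hm K hK l).1) (fun m hm K hK l => (hmom m hm K hK l).2)
    (fun m hm => by
      have hm1 : 1 ≤ m := hm₀.trans hm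
      rw [hX m, hΘ m hm1, hΨ m hm1, diffusion_one_eq_stiffness (H m hm1)])
  refine ⟨h1, d, D, δ, hd, fun m hm hre => h2 m hm ?_⟩
  rwa [← hΨ m (hm₀.trans hm)]

theorem le_cellCoeff_triangleIntegral {M : GridMesh} {m : ℕ} (H : IsUniformMesh Ω u v M m)
    (ha : ContinuousOn a (closure Ω)) {a₀ : ℝ} (ha₀ : ∀ x ∈ closure Ω, a₀ ≤ a x) {K : Cell}
    (hK : K ∈ M.cells) : a₀ ≤ cellCoeff M (triangleIntegral M) a K := by
  have hsub := H.triangle_subset_closure hK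
  rw [cellCoeff, le_div_iff₀ (H.volume_real_triangle_pos K)]
  have hcomp := M.isCompact_triangle K
  have h1 := setIntegral_mono_on (μ := volume) (s := M.triangle K) (f := fun _ => a₀) (g := a)
    (continuousOn_const.integrableOn_compact hcomp) ((ha.mono hsub).integrableOn_compact hcomp)
    hcomp.measurableSet fun x hx => ha₀ x (hsub hx)
  simpa [triangleIntegral, mul_comm] using h1

theorem eventually_half_le_cellCoeff (H : ∀ m ≥ 1, IsUniformMesh Ω u v (mesh m) m)
    (hJ : ∀ m ≥ 1, IsElementRule (mesh m) m (J m) W C) {La : NNReal} {Ba : ℝ}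
    (hLa : LipschitzOnWith La a (closure Ω)) (hBa : ∀ x ∈ closure Ω, ‖a x‖ ≤ Ba)
    {a₀ : ℝ} (ha₀ : 0 < a₀) (hpos : ∀ x ∈ closure Ω, a₀ ≤ a x) :
    ∀ᶠ m in atTop, ∀ K ∈ (mesh m).cells, a₀ / 2 ≤ cellCoeff (mesh m) (J m) a K := by
  have hlim := tendsto_const_div_atTop_nhds_zero_nat (W * (La * (‖u‖ + ‖v‖)) + C * Ba)
  filter_upwards [eventually_ge_atTop 1, hlim.eventually_le_const (half_pos ha₀)] with m hm hE K hK
  have hlip : ∀ x ∈ closure Ω, ∀ y ∈ closure Ω, |a x - a y| ≤ La * ‖x - y‖ := by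
    intro x hx y hy
    rw [← Real.dist_eq, ← dist_eq_norm]
    exact hLa.dist_le_mul x hx y hy
  have hy := (mesh m).node_mem_triangle K 0
  have h1 := (abs_le.1 (abs_cellCoeff_sub_le (H m hm) (hJ m hm) La.coe_nonneg hLa.continuousOn
    hlip hBa hK hy)).1
  have h2 := hpos _ ((H m hm).triangle_subset_closure hK hy)
  linarith

/-- The convection form of an element rule is bounded below by a vanishing multiple of the energy:
it differs from the exact, nonnegative form by element moments of size `O(m⁻²)`, one order smaller
than what the energy controls. -/
theorem eventually_neg_mul_gridEnergy_le (hc : cross u v ≠ 0)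
    (H : ∀ m ≥ 1, IsUniformMesh Ω u v (mesh m) m)
    (hJ : ∀ m ≥ 1, IsElementRule (mesh m) m (J m) W C) {Lb : NNReal} {Bb : ℝ}
    (hLb : LipschitzOnWith Lb b (closure Ω)) (hBb0 : 0 ≤ Bb) (hBb : ∀ x ∈ closure Ω, ‖b x‖ ≤ Bb)
    (hnonneg : ∀ m ≥ 1, ∀ x, 0 ≤ (hform ((mesh m).convection b) x).re) {c : ℝ} (hcpos : 0 < c) :
    ∀ᶠ m in atTop, ∀ x, -c * gridEnergy (mesh m).cells (zeroExt (mesh m).inner x) ≤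
      (hform (convMatrix (mesh m).inner (mesh m).cells
        (convMoment (mesh m) (J m) b (mesh m).gradS)
        (convMoment (mesh m) (J m) b (mesh m).gradT)) x).re := by
  have hW := (hJ 1 le_rfl).W_nonneg
  have hC := (hJ 1 le_rfl).C_nonneg
  have harea := refArea_pos hc
  set σ := (refLattice u v).gradS with hσ
  set τ := (refLattice u v).gradT with hτ
  set w : ℝ := (Bb * C + (W + 1) * Lb * (‖u‖ + ‖v‖)) * refArea u v * (‖σ‖ + ‖τ‖) with hw
  have hw0 : 0 ≤ w := by positivity
  have hlip : ∀ x ∈ closure Ω, ∀ y ∈ closure Ω, ‖b x - b y‖ ≤ Lb * ‖x - y‖ := by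
    intro x hx y hy
    rw [← dist_eq_norm, ← dist_eq_norm]
    exact hLb.dist_le_mul x hx y hy
  have hlim := tendsto_const_div_atTop_nhds_zero_nat (24 * w)
  filter_upwards [eventually_ge_atTop 1, hlim.eventually_le_const hcpos] with m hm hcm x
  have Hm := H m hm
  have hmpos := Hm.m_pos
  have hle : ∀ g : Plane, ‖g‖ ≤ ‖σ‖ + ‖τ‖ → ∀ K ∈ (mesh m).cells, ∀ l,
      |convMoment (mesh m) (J m) b ((m : ℝ) • g) K l -
        convMoment (mesh m) (triangleIntegral (mesh m)) b ((m : ℝ) • g) K l| ≤ w / m / m := by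
    intro g hg K hK l
    refine (abs_convMoment_sub_le Hm (hJ m hm) Lb.coe_nonneg hLb.continuousOn hlip hBb g hK
      l).trans ?_
    rw [hw]
    gcongr
  have hdiff := norm_hform_convMatrix_le (mesh m).inner (mesh m).cells
    (fun K l => convMoment (mesh m) (J m) b ((m : ℝ) • σ) K l -
      convMoment (mesh m) (triangleIntegral (mesh m)) b ((m : ℝ) • σ) K l)
    (fun K l => convMoment (mesh m) (J m) b ((m : ℝ) • τ) K l -
      convMoment (mesh m) (triangleIntegral (mesh m)) b ((m : ℝ) • τ) K l)
    (hle σ (le_add_of_nonneg_right (norm_nonneg _)))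
    (hle τ (le_add_of_nonneg_left (norm_nonneg _))) (by positivity) x
  rw [convMatrix_sub, ← Hm.gradS_eq, ← Hm.gradT_eq,
    ← convection_eq_convMatrix Hm hLb.continuousOn, hform_sub] at hdiff
  have hG := gridEnergy_nonneg (mesh m).cells (zeroExt (mesh m).inner x)
  have h1 : 6 * (w / m / m) *
      √(gridEnergy (mesh m).cells (zeroExt (mesh m).inner x) * normSqSum x) ≤
      c * gridEnergy (mesh m).cells (zeroExt (mesh m).inner x) := by
    calc _ ≤ 6 * (w / m / m) * (4 * m * gridEnergy (mesh m).cells (zeroExt (mesh m).inner x)) := by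
          gcongr; exact sqrt_gridEnergy_mul_normSqSum_le Hm.lattice x
      _ = 24 * w / m * gridEnergy (mesh m).cells (zeroExt (mesh m).inner x) := by field_simp; ring
      _ ≤ _ := by gcongr
  have h2 := (abs_le.1 ((Complex.abs_re_le_norm _).trans (hdiff.trans h1))).1
  rw [Complex.sub_re] at h2
  have h3 := hnonneg m hm x
  linarith

end

theorem complexEigenvalues_eq_zero_of_isEmpty {ι : Type} [Fintype ι] [DecidableEq ι] [IsEmpty ι]
    (X : Matrix ι ι ℝ) : complexEigenvalues X = 0 := by
  have := card_complexEigenvalues_le X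
  rw [Fintype.card_eq_zero, Nat.le_zero, Multiset.card_eq_zero] at this
  exact this

/-! ### Clustering and localization of the spectrum -/

theorem mainTheorem4 (Ω : Set Plane) (mesh : ℕ → GridMesh) (hmesh : IsModelMesh Ω mesh)
    (a : Plane → ℝ) (b : Plane → Plane) (hab : AdmissibleCoefficients Ω a b) :
    (ProperlyClustered (fun m => (mesh m).precondMatrix a b) 1 ∧
      ∃ d D δ : ℝ, 0 < d ∧ ∀ m, ∀ z ∈ complexEigenvalues ((mesh m).precondMatrix a b),
        d ≤ z.re ∧ z.re ≤ D ∧ |z.im| ≤ δ) ∧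
    ∀ Q : ℕ → Cell → Plane →₀ ℝ, IsQuadratureOrderTwo mesh Q →
      ProperlyClustered (fun m => (mesh m).precondMatrixQuad (Q m) a b) 1 ∧
      ∃ d D δ : ℝ, 0 < d ∧ ∀ᶠ m in atTop,
        ∀ z ∈ complexEigenvalues ((mesh m).precondMatrixQuad (Q m) a b),
          d ≤ z.re ∧ z.re ≤ D ∧ |z.im| ≤ δ := by
  obtain ⟨u, v, hc, H⟩ := hmesh.exists_isUniformMesh
  obtain ⟨hopen, hconv, hbd⟩ := hmesh.isOpen_convex_isBounded
  obtain ⟨a₀, ha₀, hpos⟩ := hab.a_pos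
  obtain ⟨La, Ba, hBa0, hLa, hBa⟩ := exists_lipschitz_and_bound hconv.closure
    hbd.isCompact_closure two_ne_zero hab.a_smooth
  obtain ⟨Lb, Bb, hBb0, hLb, hBb⟩ := exists_lipschitz_and_bound hconv.closure
    hbd.isCompact_closure one_ne_zero hab.b_smooth
  have hdiff : ∀ x ∈ Ω, DifferentiableAt ℝ b x := fun x hx =>
    (hab.b_smooth.differentiableOn one_ne_zero).differentiableAt
      (mem_of_superset (hopen.mem_nhds hx) subset_closure)
  have hnonneg : ∀ m ≥ 1, ∀ x, 0 ≤ (hform ((mesh m).convection b) x).re := fun m hm =>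
    re_hform_convection_nonneg (H m hm) hopen hbd hLb hdiff hab.div_nonneg
  set c₀ := (gramUU u v * gramVV u v - gramUV u v ^ 2) / (gramUU u v + gramVV u v) with hc₀
  have hc₀pos : 0 < c₀ := div_pos (sub_pos.2 (gramUV_sq_lt hc))
    (add_pos (gramUU_pos hc) (gramVV_pos hc))
  refine ⟨?_, fun Q hQ => ?_⟩
  · obtain ⟨h1, d, D, δ, hd, h2⟩ := cluster_and_rectangle_of_rules hc H
      (fun m _ => isElementRule_triangleIntegral (mesh m) m) hLa hBa0 hBa hLb.continuousOn hBb0 hBb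
      ha₀ le_rfl (fun m hm K hK => le_cellCoeff_triangleIntegral (H m hm) hLa.continuousOn hpos hK)
      (fun m hm => diffusion_eq_stiffness (H m hm) hLa.continuousOn)
      (fun m hm => convection_eq_convMatrix (H m hm) hLb.continuousOn)
      (X := fun m => (mesh m).precondMatrix a b) fun m => rfl
    refine ⟨h1, d, D, δ, hd, fun m z hz => ?_⟩
    -- for `m = 0` the mesh has no inner nodes and the matrix is empty
    rcases Nat.eq_zero_or_pos m with rfl | hm
    · have : IsEmpty (mesh 0).inner := by rw [hmesh.inner_zero]; infer_instance
      rw [complexEigenvalues_eq_zero_of_isEmpty] at hz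
      exact absurd hz (Multiset.notMem_zero z)
    · refine h2 m hm (fun x => le_trans ?_ (hnonneg m hm x)) z hz
      have hG := gridEnergy_nonneg (mesh m).cells (zeroExt (mesh m).inner x)
      rw [neg_mul, neg_nonpos]
      positivity
  · obtain ⟨W, C, hJ⟩ := hQ.exists_isElementRule H
    obtain ⟨m₁, hm₁⟩ := eventually_atTop.1 (eventually_half_le_cellCoeff H hJ hLa hBa ha₀ hpos)
    obtain ⟨h1, d, D, δ, hd, h2⟩ := cluster_and_rectangle_of_rules hc H hJ hLa hBa0 hBa
      hLb.continuousOn hBb0 hBb (half_pos ha₀) (le_max_left 1 m₁)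
      (fun m hm => hm₁ m ((le_max_right 1 m₁).trans hm))
      (fun m hm => diffusionQuad_eq_stiffness (H m hm) (hJ m hm))
      (fun m hm => convectionQuad_eq_convMatrix (H m hm) (hJ m hm) hLb.continuousOn)
      (X := fun m => (mesh m).precondMatrixQuad (Q m) a b) fun m => rfl
    refine ⟨h1, d, D, δ, hd, ?_⟩
    filter_upwards [eventually_ge_atTop (max 1 m₁), eventually_neg_mul_gridEnergy_le hc H hJ hLb
      hBb0 hBb hnonneg (c := a₀ / 2 * c₀ / 2) (by positivity)] with m hm hre
    refine h2 m hm fun x => ?_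
    have hm1 : 1 ≤ m := (le_max_left 1 m₁).trans hm
    rw [convectionQuad_eq_convMatrix (H m hm1) (hJ m hm1) hLb.continuousOn]
    exact hre x

end
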